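/- Let $A$ be a periodic abelian group. An automorphism $\gamma$ of an abelian group is called inertial if every subgroup $H$ has finite index in the subgroup generated by $H$ and $H\gamma$, finitary if it is the identity on a subgroup of finite index, and a power automorphism if it leaves every subgroup invariant. Let $\mathrm{IAut}(A)$ be the group generated by the inertial automorphisms of $A$, and let $\mathrm{FAut}(A)$ and $\mathrm{PAut}(A)$ be the groups of finitary automorphisms and of power automorphisms of $A$. For a set $\pi$ of primes, let $A_\pi$ be the largest $\pi$-subgroup of $A$ and $\pi'$ the set of primes not in $\pi$; regard $\mathrm{FAut}(A_\pi)$ as a subgroup of $\mathrm{FAut}(A)$ by letting it act trivially on the second factor of $A=A_\pi\oplus A_{\pi'}$. Then there is a subgroup $\Delta$ of $\mathrm{IAut}(A)$ which is a (restricted) direct product of finite abelian groups, is trivial if $A$ is reduced, and satisfies $$\mathrm{IAut}(A)=\mathrm{PAut}(A)\cdot\mathrm{FAut}(A)\cdot\Delta .$$ Moreover, there are a set $\pi$ of primes and subgroups $\Sigma$, $\Psi$ of $\mathrm{IAut}(A)$ such that $\Sigma$ is an abelian $\pi'$-group with bounded primary components, $$\mathrm{FAut}(A)\cdot\Delta=\mathrm{FAut}(A_\pi)\times(\Sigma\rtimes\Psi)$$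 (internal direct and semidirect products), the automorphisms of $\Sigma$ induced by the elements of $\Psi$ via conjugation are inertial, and this action of $\Psi$ on $\Sigma$ is faithful. -/

import Mathlib

open scoped Pointwise

/-! Automorphisms of groups, written multiplicatively. -/

section Automorphisms

variable {G : Type*} [Group G]

/-- An automorphism `γ` is *inertial* if every subgroup `H` has finite index in the subgroup
generated by `H` and its image under `γ`. -/
def IsInertial (γ : MulAut G) : Prop :=
  ∀ H : Subgroup G, H.IsFiniteRelIndex (H ⊔ H.map γ.toMonoidHom)

/-- An automorphism is *finitary* if it is the identity on a subgroup of finite index. -/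
def IsFinitary (γ : MulAut G) : Prop :=
  ∃ H : Subgroup G, H.FiniteIndex ∧ ∀ x ∈ H, γ x = x

/-- A *power automorphism* leaves every subgroup invariant. -/
def IsPowerAut (γ : MulAut G) : Prop :=
  ∀ H : Subgroup G, H.map γ.toMonoidHom = H

variable (G) in
/-- The group generated by the inertial automorphisms. -/
def IAut : Subgroup (MulAut G) :=
  Subgroup.closure {γ | IsInertial γ}

variable (G) in
/-- The group of finitary automorphisms. -/
def FAut : Subgroup (MulAut G) where
  carrier := {γ | IsFinitary γ}
  one_mem' := ⟨⊤, inferInstance, fun _ _ => rfl⟩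
  mul_mem' := by
    rintro γ δ ⟨H, hH, hγ⟩ ⟨K, hK, hδ⟩
    refine ⟨H ⊓ K, inferInstance, fun x hx => ?_⟩
    rw [MulAut.mul_apply, hδ x hx.2, hγ x hx.1]
  inv_mem' := by
    rintro γ ⟨H, hH, hγ⟩
    refine ⟨H, hH, fun x hx => ?_⟩
    calc γ⁻¹ x = γ⁻¹ (γ x) := by rw [hγ x hx]
      _ = x := MulAut.inv_apply_self _ γ x

variable (G) in
/-- The group of power automorphisms. -/
def PAut : Subgroup (MulAut G) where
  carrier := {γ | IsPowerAut γ}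
  one_mem' := fun H => H.map_id
  mul_mem' := by
    intro γ δ hγ hδ H
    calc H.map (γ * δ).toMonoidHom = (H.map δ.toMonoidHom).map γ.toMonoidHom :=
          (Subgroup.map_map H γ.toMonoidHom δ.toMonoidHom).symm
      _ = H := by rw [hδ H, hγ H]
  inv_mem' := by
    intro γ hγ H
    have h : (H.map γ.toMonoidHom).map (γ⁻¹ : MulAut G).toMonoidHom = H := by
      rw [Subgroup.map_map]
      convert H.map_id
      ext x
      exact MulAut.inv_apply_self _ γ x
    rwa [hγ H] at h

end Automorphisms

section PiParts

variable {A : Type*} [CommGroup A]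

variable (A) in
/-- The largest `π`-subgroup `A_π` of an abelian group `A`: the elements of finite order whose
order has all its prime divisors in `π`. -/
def piPart (π : Set ℕ) : Subgroup A where
  carrier := {a | ∃ n : ℕ, n ≠ 0 ∧ (∀ p : ℕ, p.Prime → p ∣ n → p ∈ π) ∧ a ^ n = 1}
  one_mem' := ⟨1, one_ne_zero,
    fun p hp h => absurd (Nat.dvd_one.mp h) hp.ne_one, one_pow 1⟩
  mul_mem' := by
    rintro a b ⟨m, hm, hmπ, ha⟩ ⟨n, hn, hnπ, hb⟩
    refine ⟨m * n, mul_ne_zero hm hn, fun p hp h => ?_, ?_⟩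
    · rcases hp.dvd_mul.mp h with h | h
      · exact hmπ p hp h
      · exact hnπ p hp h
    · rw [mul_pow, pow_mul, ha, one_pow, mul_comm m n, pow_mul, hb, one_pow, one_mul]
  inv_mem' := by
    rintro a ⟨n, hn, hnπ, ha⟩
    exact ⟨n, hn, hnπ, by rw [inv_pow, ha, inv_one]⟩

variable (A) in
/-- `FAut (A_π)` viewed inside `Aut A`, for a periodic abelian group `A = A_π × A_π'`: the
automorphisms `φ × 1` with `φ` a finitary automorphism of `A_π` and `1` the identity of `A_π'`. -/
def FAutPi (π : Set ℕ) : Subgroup (MulAut A) where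
  carrier := {γ | ∃ φ ∈ FAut (piPart A π),
    (∀ a : piPart A π, γ a = φ a) ∧ ∀ b ∈ piPart A πᶜ, γ b = b}
  one_mem' := ⟨1, one_mem _, fun _ => rfl, fun _ _ => rfl⟩
  mul_mem' := by
    rintro γ δ ⟨φ, hφ, h1, h2⟩ ⟨ψ, hψ, h3, h4⟩
    refine ⟨φ * ψ, mul_mem hφ hψ, fun a => ?_, fun b hb => ?_⟩
    · rw [MulAut.mul_apply, MulAut.mul_apply, h3, h1]
    · rw [MulAut.mul_apply, h4 b hb, h2 b hb]
  inv_mem' := by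
    rintro γ ⟨φ, hφ, h1, h2⟩
    refine ⟨φ⁻¹, inv_mem hφ, fun a => ?_, fun b hb => ?_⟩
    · calc γ⁻¹ a = γ⁻¹ ((φ (φ⁻¹ a) : piPart A π) : A) := by rw [MulAut.apply_inv_self]
        _ = γ⁻¹ (γ (φ⁻¹ a : piPart A π)) := by rw [h1]
        _ = (φ⁻¹ a : piPart A π) := MulAut.inv_apply_self _ γ _
    · calc γ⁻¹ b = γ⁻¹ (γ b) := by rw [h2 b hb]
        _ = b := MulAut.inv_apply_self _ γ b

variable (A) in
/-- An abelian group is *reduced* if its only divisible subgroup is trivial. -/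
def IsReducedGroup : Prop :=
  ∀ D : Subgroup A, (∀ n : ℕ, n ≠ 0 → ∀ d ∈ D, ∃ x ∈ D, x ^ n = d) → D = ⊥

end PiParts

section Products

variable {G : Type*} [Group G]

/-- `Δ` is the (internal, restricted) direct product of a family of finite abelian subgroups. -/
def IsDirectProductOfFiniteAbelian (Δ : Subgroup G) : Prop :=
  ∃ 𝓕 : Set (Subgroup G),
    (∀ F ∈ 𝓕, Finite F ∧ ∀ x ∈ F, ∀ y ∈ F, Commute x y) ∧
    (∀ F ∈ 𝓕, ∀ K ∈ 𝓕, F ≠ K → ∀ x ∈ F, ∀ y ∈ K, Commute x y) ∧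
    sSupIndep 𝓕 ∧
    sSup 𝓕 = Δ

/-- The set `S` is the internal direct product of the subgroups `H` and `K`. -/
def IsInternalDirect (S : Set G) (H K : Subgroup G) : Prop :=
  S = (H : Set G) * (K : Set G) ∧ Disjoint H K ∧ ∀ x ∈ H, ∀ y ∈ K, Commute x y

/-- The set `S` is the internal semidirect product `N ⋊ K` of the subgroups `N` and `K`. -/
def IsInternalSemidirect (S : Set G) (N K : Subgroup G) : Prop :=
  S = (N : Set G) * (K : Set G) ∧ Disjoint N K ∧ K ≤ Subgroup.normalizer (N : Set G)

/-- The action by conjugation of a subgroup `K` on a subgroup `N` which it normalizes. -/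
def conjAction (N K : Subgroup G) (h : K ≤ Subgroup.normalizer (N : Set G)) : K →* MulAut N :=
  N.normalizerMonoidHom.comp (Subgroup.inclusion h)

/-- `S` is an abelian `π'`-group: its elements commute, have finite order, and these orders have
no prime divisor in `π`. -/
def IsAbelianPiPrimeGroup (π : Set ℕ) (S : Subgroup G) : Prop :=
  (∀ x ∈ S, ∀ y ∈ S, Commute x y) ∧
  ∀ x ∈ S, IsOfFinOrder x ∧ ∀ p ∈ π, ¬ p ∣ orderOf x

/-- The primary components of `S` are bounded: for each prime `p`, there is a common bound on the
exponents of the elements of `p`-power order of `S`. -/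
def HasBoundedPrimaryComponents (S : Subgroup G) : Prop :=
  ∀ p : ℕ, p.Prime → ∃ m : ℕ, ∀ x ∈ S, (∃ k : ℕ, x ^ p ^ k = 1) → x ^ p ^ m = 1

end Products

/-! ### Finiteness modulo a subgroup. -/

section FinMod

variable {M : Type*} [AddCommGroup M]

/-! Write `A` additively. For an inertial `γ`, a greedy construction yields a finite subgroup `F`
with `γ x ∈ ⟨x⟩ + F` whenever `⟨x⟩ ∩ F = 0` (`AddInertial.exists_finite`). Away from the primes
dividing `|F|` this makes `γ` a power automorphism, so only finitely many primary components remain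
(`IsInertial.mem_sup`).

On a `p`-component, take `C` maximal with `C ∩ F = 0` and cut it down to `C ∩ γ⁻¹ C`: there `γ` is a
pointwise multiplication, and the quotient by this subgroup has finite socle. Dividing `γ` by a
pointwise multiplication of the whole component, one finds (`AddInertial.structure`) that either `γ`
becomes finitary, or the component is critical, that is `D_p ⊕ B_p` with `D_p ≠ 0` divisible of
finite rank and `B_p` bounded. In the second case `γ` becomes, up to a finitary factor, the identity
on `D_p` and multiplication by an integer prime to `p` on `B_p`. Such multiplications form a finite
abelian group for each `p`, and together they generate `Δ`; they are inertial by
`finMod_image_of_isDivisiblePart`. A reduced group has no critical component, so there `Δ` is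
trivial.

For the splitting, let `T` be the set of critical primes, `π` the other primes, and `r` an
idempotent with image `D = ⨁ D_p`. Finite images contain no divisible part, so `FAut A · Δ` fixes
`D` pointwise and acts triangularly on `A_T = B ⊕ D`. Here `Σ` consists of the `1 + f` with `f : B →
D` of finite image, and `Ψ` of the elements with `r ψ = r` acting on `A_T` only. Composition in `Σ`
is addition of the maps `f`, and `ψ` acts by `f ↦ f ψ⁻¹`. This is inertial: an element of `Δ`
multiplies each `f` by an integer, and a finitary factor contributes only finitely many corrections.
It is faithful because `D_p` is injective and nonzero, so that homomorphisms `B_p → D_p` separate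
points. -/

/-- The set `X` meets only finitely many cosets of `C`. -/
def FinMod (X : Set M) (C : AddSubgroup M) : Prop :=
  ∃ S : Set M, S.Finite ∧ ∀ x ∈ X, ∃ s ∈ S, x - s ∈ C

lemma exists_finite_reps {ι : Type*} {T : Set ι} (hT : T.Finite) {X : Set M} {C : AddSubgroup M}
    (c : M → ι → Prop) (h1 : ∀ x ∈ X, ∃ t ∈ T, c x t)
    (h2 : ∀ x ∈ X, ∀ y ∈ X, ∀ t, c x t → c y t → x - y ∈ C) :
    ∃ S ⊆ X, S.Finite ∧ ∀ x ∈ X, ∃ s ∈ S, x - s ∈ C := by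
  classical
  let T' : Set ι := {t ∈ T | ∃ x ∈ X, c x t}
  have hT' : T'.Finite := hT.subset fun t ht => ht.1
  have hc : ∀ t : ι, ∃ x : M, t ∈ T' → x ∈ X ∧ c x t := by
    intro t
    by_cases h : t ∈ T'
    · obtain ⟨x, hx, hxt⟩ := h.2
      exact ⟨x, fun _ => ⟨hx, hxt⟩⟩
    · exact ⟨0, fun h' => absurd h' h⟩
  choose rep hrep using hc
  refine ⟨rep '' T', ?_, hT'.image _, fun x hx => ?_⟩
  · rintro _ ⟨t, ht, rfl⟩
    exact (hrep t ht).1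
  · obtain ⟨t, ht, hxt⟩ := h1 x hx
    have ht' : t ∈ T' := ⟨ht, x, hx, hxt⟩
    exact ⟨rep t, ⟨t, ht', rfl⟩, h2 x hx _ (hrep t ht').1 t hxt (hrep t ht').2⟩

lemma FinMod.of_classes {ι : Type*} {T : Set ι} (hT : T.Finite) {X : Set M} {C : AddSubgroup M}
    (c : M → ι → Prop) (h1 : ∀ x ∈ X, ∃ t ∈ T, c x t)
    (h2 : ∀ x ∈ X, ∀ y ∈ X, ∀ t, c x t → c y t → x - y ∈ C) : FinMod X C := by
  obtain ⟨S, -, hS⟩ := exists_finite_reps hT c h1 h2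
  exact ⟨S, hS⟩

lemma FinMod.mono {X Y : Set M} {C D : AddSubgroup M} (h : FinMod X C) (hY : Y ⊆ X)
    (hC : C ≤ D) : FinMod Y D := by
  obtain ⟨S, hS, h⟩ := h
  exact ⟨S, hS, fun x hx => (h x (hY hx)).imp fun s hs => ⟨hs.1, hC hs.2⟩⟩

lemma FinMod.trans {X : Set M} {C D : AddSubgroup M} (h : FinMod X C)
    (h' : FinMod (C : Set M) D) : FinMod X D := by
  obtain ⟨S, hS, h⟩ := h
  obtain ⟨T, hT, h'⟩ := h'
  refine ⟨S + T, hS.add hT, fun x hx => ?_⟩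
  obtain ⟨s, hs, hxs⟩ := h x hx
  obtain ⟨t, ht, hxt⟩ := h' _ hxs
  exact ⟨s + t, Set.add_mem_add hs ht, by rwa [← sub_sub]⟩

lemma Set.Finite.finMod {X : Set M} (h : X.Finite) (C : AddSubgroup M) : FinMod X C :=
  ⟨X, h, fun x hx => ⟨x, hx, by simp⟩⟩

lemma finMod_bot {X : Set M} : FinMod X ⊥ ↔ X.Finite := by
  refine ⟨fun ⟨S, hS, h⟩ => hS.subset fun x hx => ?_, fun h => h.finMod ⊥⟩
  obtain ⟨s, hs, hxs⟩ := h x hx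
  rw [AddSubgroup.mem_bot, sub_eq_zero] at hxs
  rwa [hxs]

lemma FinMod.image {N : Type*} [AddCommGroup N] {X : Set M} {C : AddSubgroup M} (h : FinMod X C)
    (f : M →+ N) {D : AddSubgroup N} (hf : ∀ c ∈ C, f c ∈ D) : FinMod (f '' X) D := by
  obtain ⟨S, hS, h⟩ := h
  refine ⟨f '' S, hS.image _, ?_⟩
  rintro _ ⟨x, hx, rfl⟩
  obtain ⟨s, hs, hxs⟩ := h x hx
  exact ⟨f s, ⟨s, hs, rfl⟩, by rw [← map_sub]; exact hf _ hxs⟩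

lemma FinMod.of_image {N : Type*} [AddCommGroup N] {X : Set M} {f : M →+ N} {D : AddSubgroup N}
    (h : FinMod (f '' X) D) {C : AddSubgroup M}
    (hC : ∀ x ∈ X, ∀ y ∈ X, f (x - y) ∈ D → x - y ∈ C) : FinMod X C := by
  obtain ⟨S, hS, h⟩ := h
  refine .of_classes hS (fun x s => f x - s ∈ D) (fun x hx => h _ ⟨x, hx, rfl⟩) ?_
  intro x hx y hy t h1 h2
  refine hC x hx y hy ?_
  simpa using D.sub_mem h1 h2

/-- The additive form of inertiality, for endomorphisms. -/
def AddInertial (γ : M →+ M) : Prop :=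
  ∀ H : AddSubgroup M, FinMod (γ '' H) H

end FinMod

/-! ### Arithmetic modulo prime powers. -/

section PrimePower

variable {q : ℤ}

/-- The gcd of `j` and `q ^ N` divides `q ^ N`, so it is a power of `q` up to sign; the sign is
absorbed into the Bezout coefficients. -/
lemma exists_bezout_prime_pow (hq : Prime q) (j : ℤ) (N : ℕ) :
    ∃ i ≤ N, q ^ i ∣ j ∧ ∃ a b : ℤ, a * j + b * q ^ N = q ^ i := by
  have hd : (Int.gcd j (q ^ N) : ℤ) ∣ q ^ N := Int.gcd_dvd_right _ _
  obtain ⟨i, hi, hass⟩ := (dvd_prime_pow hq _).1 hd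
  refine ⟨i, hi, hass.symm.dvd.trans (Int.gcd_dvd_left _ _), ?_⟩
  obtain ⟨c, hc⟩ := hass.dvd
  refine ⟨c * Int.gcdA j (q ^ N), c * Int.gcdB j (q ^ N), ?_⟩
  rw [hc, Int.gcd_eq_gcd_ab]
  ring

variable {M : Type*} [AddCommGroup M]

lemma pow_dvd_of_smul_eq_zero (hq : Prime q) {x : M} {n : ℕ} {j : ℤ} (h0 : q ^ n • x ≠ 0)
    (h1 : ∃ N, q ^ N • x = 0) (hj : j • x = 0) : q ^ (n + 1) ∣ j := by
  obtain ⟨N, hN⟩ := h1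
  obtain ⟨i, hi, hij, a, b, hab⟩ := exists_bezout_prime_pow hq j N
  have hix : q ^ i • x = 0 := by
    rw [← hab, add_smul, mul_smul, mul_smul, hj, hN]; simp
  have : n + 1 ≤ i := by
    by_contra hlt
    apply h0
    obtain ⟨k, rfl⟩ := Nat.exists_eq_add_of_le (show i ≤ n by omega)
    rw [pow_add, mul_comm, mul_smul, hix, smul_zero]
  exact (pow_dvd_pow q this).trans hij

lemma smul_pow_eq_zero_of_le {x : M} {k l : ℕ} (h : q ^ k • x = 0) (hkl : k ≤ l) :
    q ^ l • x = 0 := by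
  obtain ⟨m, rfl⟩ := Nat.exists_eq_add_of_le hkl
  rw [pow_add, mul_comm, mul_smul, h, smul_zero]

/-- In a `q`-torsion setting, multiplication by an integer prime to `q` can be undone. -/
lemma mem_of_smul_mem_of_not_dvd (hq : Prime q) {x : M} {C : AddSubgroup M} {k : ℕ} {j : ℤ}
    (hk : q ^ k • x ∈ C) (hj : ¬ q ∣ j) (h : j • x ∈ C) : x ∈ C := by
  obtain ⟨i, hi, hij, a, b, hab⟩ := exists_bezout_prime_pow hq j k
  have hi0 : i = 0 := by
    by_contra h0
    exact hj ((dvd_pow_self q h0).trans hij)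
  subst hi0
  have : x = a • (j • x) + b • (q ^ k • x) := by
    rw [smul_smul, smul_smul, ← add_smul, hab]; simp
  rw [this]
  exact C.add_mem (C.zsmul_mem h a) (C.zsmul_mem hk b)

lemma exists_inverse_mod_pow (hq : Prime q) {j : ℤ} (hj : ¬ q ∣ j) (k : ℕ) :
    ∃ a : ℤ, q ^ k ∣ a * j - 1 ∧ ¬ q ∣ a := by
  -- For `k = 0` the Bezout coefficient might be divisible by `q`, so `a = 1` is chosen by hand.
  rcases Nat.eq_zero_or_pos k with rfl | h
  · exact ⟨1, by simp, hq.not_dvd_one⟩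
  obtain ⟨i, hi, hij, a, b, hab⟩ := exists_bezout_prime_pow hq j k
  have hi0 : i = 0 := by
    by_contra h0
    exact hj ((dvd_pow_self q h0).trans hij)
  subst hi0
  refine ⟨a, ⟨-b, by rw [pow_zero] at hab; linear_combination hab⟩, fun ha => ?_⟩
  have : q ∣ 1 := by
    rw [← pow_zero q, ← hab]
    exact dvd_add (ha.mul_right _) ((dvd_pow_self q h.ne').mul_left _)
  exact hq.not_dvd_one this

end PrimePower

/-! ### The greedy construction of a finite exceptional subgroup. -/

section Greedy

variable {M : Type*} [AddCommGroup M]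

lemma finite_zmultiples_of_torsion (hM : ∀ x : M, ∃ n : ℤ, n ≠ 0 ∧ n • x = 0) (x : M) :
    (AddSubgroup.zmultiples x : Set M).Finite := by
  obtain ⟨n, hn, hx⟩ := hM x
  have : IsOfFinAddOrder x := isOfFinAddOrder_iff_zsmul_eq_zero.2 ⟨n, hn, hx⟩
  exact this.finite_zmultiples

lemma AddSubgroup.finite_coe_sup {H K : AddSubgroup M} (hH : (H : Set M).Finite)
    (hK : (K : Set M).Finite) : ((H ⊔ K : AddSubgroup M) : Set M).Finite := by
  rw [AddSubgroup.add_normal]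
  exact hH.add hK

/-- An inertial endomorphism of a torsion group is pointwise a multiplication modulo some finite
subgroup `F`, at the elements which are independent of `F`. -/
lemma AddInertial.exists_finite (hM : ∀ x : M, ∃ n : ℤ, n ≠ 0 ∧ n • x = 0) {γ : M →+ M}
    (hγ : AddInertial γ) :
    ∃ F : AddSubgroup M, (F : Set M).Finite ∧
      ∀ x, (∀ j : ℤ, j • x ∈ F → j • x = 0) → ∃ j : ℤ, γ x - j • x ∈ F := by
  by_contra! hcon
  choose! x hx1 hx2 using hcon
  -- Each `H n` is finite, so `x (F (H n))` witnesses the failure of the claim for the finite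
  -- subgroup `H n + γ (H n)`; adjoining it to `H n` gives `H (n + 1)`.
  let F : AddSubgroup M → AddSubgroup M := fun H => H ⊔ H.map γ
  let H : ℕ → AddSubgroup M := fun n =>
    n.rec (motive := fun _ => AddSubgroup M) ⊥ fun _ K => K ⊔ AddSubgroup.zmultiples (x (F K))
  have hsucc : ∀ n, H (n + 1) = H n ⊔ AddSubgroup.zmultiples (x (F (H n))) := fun n => rfl
  have hfin : ∀ n, (H n : Set M).Finite := by
    intro n
    induction n with
    | zero => exact Set.finite_singleton 0
    | succ n ih =>
      rw [hsucc]
      exact AddSubgroup.finite_coe_sup ih (finite_zmultiples_of_torsion hM _)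
  have hFfin : ∀ n, (F (H n) : Set M).Finite := fun n =>
    AddSubgroup.finite_coe_sup (hfin n) ((hfin n).image γ)
  have hmono : Monotone H := monotone_nat_of_le_succ fun n => by rw [hsucc]; exact le_sup_left
  have hFmono : Monotone fun n => F (H n) := fun m n h =>
    sup_le_sup (hmono h) (AddSubgroup.map_mono (hmono h))
  have hxH : ∀ n, x (F (H n)) ∈ H (n + 1) := fun n => by
    rw [hsucc]
    exact AddSubgroup.mem_sup_right (AddSubgroup.mem_zmultiples _)
  -- The new generator is independent of `F (H n)`, so adjoining it brings no further element of `F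
  -- (H n)` into the chain.
  have hstep : ∀ n y, y ∈ H (n + 1) → y ∈ F (H n) → y ∈ H n := by
    intro n y hy hyF
    rw [hsucc, AddSubgroup.mem_sup] at hy
    obtain ⟨h, hh, z, hz, rfl⟩ := hy
    obtain ⟨j, rfl⟩ := AddSubgroup.mem_zmultiples_iff.1 hz
    have : j • x (F (H n)) ∈ F (H n) := by
      simpa using (F (H n)).sub_mem hyF (AddSubgroup.mem_sup_left hh)
    rw [hx1 _ (hFfin n) j this, add_zero]
    exact hh
  have hdesc : ∀ n k y, y ∈ H (n + k) → y ∈ F (H n) → y ∈ H n := by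
    intro n k
    induction k with
    | zero => exact fun y hy _ => hy
    | succ k ih =>
      intro y hy hyF
      exact ih y (hstep (n + k) y hy (hFmono (Nat.le_add_right n k) hyF)) hyF
  obtain ⟨S, hS, hSH⟩ := hγ (⨆ n, H n)
  have hS' : ∀ n, ∃ s ∈ S, γ (x (F (H n))) - s ∈ ⨆ n, H n := fun n =>
    hSH _ ⟨_, (le_iSup H (n + 1)) (hxH n), rfl⟩
  choose s hs hs' using hS'
  have := hS.to_subtype
  obtain ⟨m, n, hmn, heq⟩ := Finite.exists_ne_map_eq_of_infinite fun n => (⟨s n, hs n⟩ : S)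
  have heq : s m = s n := congrArg Subtype.val heq
  -- For `m < n` the difference of the two images lies in the union and in `F (H (n + 1))`, hence in
  -- `H n + ⟨x (F (H n))⟩`. Since `γ (x (F (H m)))` is in `F (H n)`, this contradicts the choice of
  -- `x (F (H n))`.
  have key : ∀ m n, m < n → s m = s n → False := by
    intro m n hlt heq
    have hd : γ (x (F (H n))) - γ (x (F (H m))) ∈ ⨆ n, H n := by
      have := AddSubgroup.sub_mem _ (hs' n) (hs' m)
      rwa [heq, sub_sub_sub_cancel_right] at this
    rw [AddSubgroup.mem_iSup_of_directed hmono.directed_le] at hd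
    obtain ⟨N, hN⟩ := hd
    have hm : γ (x (F (H m))) ∈ F (H n) :=
      AddSubgroup.mem_sup_right ⟨_, hmono hlt (hxH m), rfl⟩
    have hn : γ (x (F (H n))) ∈ F (H (n + 1)) := AddSubgroup.mem_sup_right ⟨_, hxH n, rfl⟩
    have h1 := hdesc (n + 1) N _ (hmono (Nat.le_add_left N (n + 1)) hN)
      (AddSubgroup.sub_mem _ hn (hFmono n.le_succ hm))
    rw [hsucc, AddSubgroup.mem_sup] at h1
    obtain ⟨h, hh, z, hz, hhz⟩ := h1
    obtain ⟨j, rfl⟩ := AddSubgroup.mem_zmultiples_iff.1 hz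
    refine hx2 _ (hFfin n) j ?_
    have : γ (x (F (H n))) - j • x (F (H n)) = h + γ (x (F (H m))) := by
      rw [eq_sub_iff_add_eq] at hhz
      rw [← hhz]; abel
    rw [this]
    exact AddSubgroup.add_mem _ (AddSubgroup.mem_sup_left hh) hm
  rcases lt_or_gt_of_ne hmn with h | h
  · exact key m n h heq
  · exact key n m h heq.symm

end Greedy

/-! ### Quotients with finite socle, and high subgroups. -/

section FiniteSocle

variable {M : Type*} [AddCommGroup M] {q : ℤ} {C : AddSubgroup M}

/-- The quotient `M / C` has finite `q`-socle. -/
def FiniteSocle (q : ℤ) (C : AddSubgroup M) : Prop :=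
  FinMod {x : M | q • x ∈ C} C

/-- Multiplication by `q ^ k` carries the `q ^ (k + 1)`-torsion of `M / C` into the socle, and its
kernel is covered by the induction hypothesis. -/
lemma FiniteSocle.pow (h : FiniteSocle q C) (k : ℕ) : FinMod {x : M | q ^ k • x ∈ C} C := by
  induction k with
  | zero => exact ⟨{0}, Set.finite_singleton _, fun x hx => ⟨0, rfl, by simpa using hx⟩⟩
  | succ k ih =>
    have h1 : FinMod {x : M | q ^ (k + 1) • x ∈ C}
        (C.comap (zsmulAddGroupHom (α := M) (q ^ k))) := by
      refine FinMod.of_image (f := zsmulAddGroupHom (α := M) (q ^ k)) (D := C) ?_ ?_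
      · refine FinMod.mono h ?_ le_rfl
        rintro _ ⟨x, hx, rfl⟩
        simpa [smul_smul, pow_succ'] using hx
      · intro x _ y _ hxy
        exact hxy
    exact h1.trans ih

/-- `P k x` says that `x` has height at least `k` in `M / C`. The socle is finite, so beyond some
`K` its elements have infinite height. An `x` of height at least `K` then has height at least `K +
1`, by induction on its order `q ^ r`: the socle element one step before zero can be divided by any
power of `q`, and subtracting the resulting `q ^ (K + 1) • z` from `x` lowers the order. -/
lemma FiniteSocle.exists_divisible (h : FiniteSocle q C) (hM : ∀ x : M, ∃ k : ℕ, q ^ k • x = 0) :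
    ∃ K : ℕ, ∀ x : M, ∃ y : M, q ^ K • x - q ^ (K + 1) • y ∈ C := by
  let P : ℕ → M → Prop := fun k x => ∃ y, x - q ^ k • y ∈ C
  have hP : ∀ {k l x}, k ≤ l → P l x → P k x := by
    rintro k l x hkl ⟨y, hy⟩
    obtain ⟨m, rfl⟩ := Nat.exists_eq_add_of_le hkl
    exact ⟨q ^ m • y, by rwa [smul_smul, ← pow_add]⟩
  have hPC : ∀ {k x z}, x - z ∈ C → P k x → P k z := by
    rintro k x z hxz ⟨y, hy⟩
    refine ⟨y, ?_⟩
    have := C.sub_mem hy hxz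
    rwa [show x - q ^ k • y - (x - z) = z - q ^ k • y by abel] at this
  obtain ⟨S, hS, hSC⟩ := h
  have hK : ∀ s : M, ∃ K, P K s → ∀ k, P k s := by
    intro s
    by_cases hs : ∀ k, P k s
    · exact ⟨0, fun _ => hs⟩
    · push Not at hs
      obtain ⟨k, hk⟩ := hs
      exact ⟨k, fun h => absurd h hk⟩
  choose κ hκ using hK
  obtain ⟨K, hKS⟩ : ∃ K, ∀ s ∈ S, κ s ≤ K := by
    obtain ⟨K, hK⟩ := (hS.image κ).bddAbove
    exact ⟨K, fun s hs => hK ⟨s, hs, rfl⟩⟩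
  have hsoc : ∀ x, q • x ∈ C → P K x → ∀ k, P k x := by
    intro x hx hxK k
    obtain ⟨s, hs, hxs⟩ := hSC x hx
    refine hPC (z := x) (x := s) ?_ (hκ s (hP (hKS s hs) (hPC hxs hxK)) k)
    simpa using C.neg_mem hxs
  have main : ∀ r x, q ^ r • x ∈ C → P K x → P (K + 1) x := by
    intro r
    induction r with
    | zero =>
      intro x hx _
      exact ⟨0, by simpa using hx⟩
    | succ r ih =>
      rintro x hx ⟨y, hy⟩
      have h1 : P K (q ^ r • x) := by
        refine ⟨q ^ r • y, ?_⟩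
        rw [smul_comm, ← smul_sub]
        exact C.zsmul_mem hy _
      obtain ⟨z, hz⟩ := hsoc (q ^ r • x) (by rwa [smul_smul, ← pow_succ']) h1 (r + (K + 1))
      have hz' : q ^ r • (x - q ^ (K + 1) • z) ∈ C := by
        rwa [smul_sub, smul_smul, ← pow_add]
      obtain ⟨w, hw⟩ := ih (x - q ^ (K + 1) • z) hz' ⟨y - q • z, by
        rw [smul_sub, smul_smul, ← pow_succ]
        rwa [sub_sub_sub_cancel_right]⟩
      exact ⟨z + w, by rwa [smul_add, ← sub_sub]⟩
  refine ⟨K, fun x => ?_⟩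
  obtain ⟨r, hr⟩ := hM (q ^ K • x)
  exact main r (q ^ K • x) (by rw [hr]; exact C.zero_mem) ⟨x, by simp⟩

lemma exists_pow_add_of_divisible {K : ℕ} (h : ∀ x : M, ∃ y : M, q ^ K • x - q ^ (K + 1) • y ∈ C)
    (k : ℕ) (x : M) : ∃ y : M, q ^ K • x - q ^ (K + k) • y ∈ C := by
  induction k with
  | zero => exact ⟨x, by simp⟩
  | succ k ih =>
    obtain ⟨y, hy⟩ := ih
    obtain ⟨z, hz⟩ := h y
    refine ⟨z, ?_⟩
    have := C.add_mem hy (C.zsmul_mem hz (q ^ k))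
    rw [smul_sub, smul_smul, smul_smul, ← pow_add, ← pow_add] at this
    rw [show k + K = K + k by omega, show k + (K + 1) = K + (k + 1) by omega] at this
    rwa [sub_add_sub_cancel] at this

/-- As `q ^ K • x` agrees with some `q ^ (K + k) • y` modulo `C`, the difference `x - q ^ k • y` is
`q ^ K`-torsion modulo `C`, and this torsion is finite. -/
lemma FiniteSocle.finMod_pow (h : FiniteSocle q C) (hM : ∀ x : M, ∃ k : ℕ, q ^ k • x = 0) (k : ℕ) :
    FinMod Set.univ (C ⊔ (zsmulAddGroupHom (α := M) (q ^ k)).range) := by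
  obtain ⟨K, hK⟩ := h.exists_divisible hM
  obtain ⟨S, hS, hSC⟩ := h.pow K
  refine ⟨S, hS, fun x _ => ?_⟩
  obtain ⟨y, hy⟩ := exists_pow_add_of_divisible hK k x
  obtain ⟨s, hs, hxs⟩ := hSC (x - q ^ k • y) (by
    change q ^ K • (x - q ^ k • y) ∈ C
    rwa [smul_sub, smul_smul, ← pow_add])
  refine ⟨s, hs, ?_⟩
  rw [show x - s = (x - q ^ k • y - s) + q ^ k • y by abel]
  exact AddSubgroup.add_mem _ (AddSubgroup.mem_sup_left hxs)
    (AddSubgroup.mem_sup_right ⟨y, rfl⟩)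

/-- A subgroup `C` maximal subject to `C ∩ F = 0` has a quotient whose socle is covered by that
of `F`. -/
lemma exists_high (hq : Prime q) (F : AddSubgroup M) :
    ∃ C : AddSubgroup M, (∀ x ∈ C, x ∈ F → x = 0) ∧
      ∀ x, q • x ∈ C → ∃ f ∈ F, q • f = 0 ∧ x - f ∈ C := by
  obtain ⟨C, -, hC⟩ := zorn_le_nonempty₀ {C : AddSubgroup M | ∀ x ∈ C, x ∈ F → x = 0} (by
    intro c hc hchain y hy
    refine ⟨sSup c, fun x hx hxF => ?_, fun z hz => le_sSup hz⟩
    obtain ⟨s, hs, hxs⟩ := (AddSubgroup.mem_sSup_of_directedOn ⟨y, hy⟩ hchain.directedOn).1 hx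
    exact hc hs x hxs hxF) ⊥ (by intro x hx _; simpa using hx)
  refine ⟨C, hC.prop, fun x hx => ?_⟩
  by_cases hxC : x ∈ C
  · exact ⟨0, F.zero_mem, by simp, by simpa using hxC⟩
  have hnot : ¬ ∀ z ∈ C ⊔ AddSubgroup.zmultiples x, z ∈ F → z = 0 := by
    intro hall
    have := hC.le_of_ge (y := C ⊔ AddSubgroup.zmultiples x) hall le_sup_left
    exact hxC (this (AddSubgroup.mem_sup_right (AddSubgroup.mem_zmultiples x)))
  push Not at hnot
  obtain ⟨f, hf, hfF, hf0⟩ := hnot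
  obtain ⟨c, hc, z, hz, rfl⟩ := AddSubgroup.mem_sup.1 hf
  obtain ⟨j, rfl⟩ := AddSubgroup.mem_zmultiples_iff.1 hz
  -- Otherwise `j • x` and hence `c + j • x` would lie in `C`, which avoids `F`. So `j` can be
  -- inverted modulo `q`, and `x` is in `F + C`.
  have hj : ¬ q ∣ j := by
    rintro ⟨i, rfl⟩
    refine hf0 (hC.prop _ (C.add_mem hc ?_) hfF)
    rw [mul_comm, mul_smul]
    exact C.zsmul_mem hx i
  obtain ⟨a, ⟨b, hab⟩, -⟩ := exists_inverse_mod_pow hq hj 1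
  have hxeq : x = (a * j) • x - b • (q • x) := by
    rw [smul_smul, ← sub_smul, show a * j - b * q = 1 by linear_combination hab, one_smul]
  refine ⟨a • (c + j • x), F.zsmul_mem hfF a, ?_, ?_⟩
  · refine hC.prop _ ?_ (F.zsmul_mem (F.zsmul_mem hfF a) q)
    rw [smul_comm]
    refine C.zsmul_mem ?_ a
    rw [smul_add, smul_comm]
    exact C.add_mem (C.zsmul_mem hc _) (C.zsmul_mem hx _)
  · have : x - a • (c + j • x) = -(b • (q • x)) - a • c := by
      nth_rewrite 1 [hxeq]
      rw [smul_add, mul_smul]; abel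
    rw [this]
    exact C.sub_mem (C.neg_mem (C.zsmul_mem hx b)) (C.zsmul_mem hc a)

end FiniteSocle

/-! ### Divisible subgroups. -/

section Divisible

variable {M : Type*} [AddCommGroup M]

/-- The subgroup `D` is divisible by all integers in `I`. -/
def IsDivBy (I : Set ℤ) (D : AddSubgroup M) : Prop :=
  ∀ n ∈ I, ∀ d ∈ D, ∃ x ∈ D, n • x = d

lemma isDivBy_singleton {q : ℤ} {D : AddSubgroup M} :
    IsDivBy {q} D ↔ ∀ d ∈ D, ∃ x ∈ D, q • x = d := by
  simp only [IsDivBy, Set.mem_singleton_iff, forall_eq]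

lemma isDivBy_sSup (I : Set ℤ) (𝓓 : Set (AddSubgroup M)) (h : ∀ D ∈ 𝓓, IsDivBy I D) :
    IsDivBy I (sSup 𝓓) := by
  intro n hn d hd
  rw [sSup_eq_iSup'] at hd ⊢
  induction hd using AddSubgroup.iSup_induction' with
  | hp i x hx =>
    obtain ⟨y, hy, rfl⟩ := h i.1 i.2 n hn x hx
    exact ⟨y, AddSubgroup.mem_iSup_of_mem i hy, rfl⟩
  | h1 => exact ⟨0, AddSubgroup.zero_mem _, smul_zero n⟩
  | hadd x y _ _ hx hy =>
    obtain ⟨x', hx', rfl⟩ := hx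
    obtain ⟨y', hy', rfl⟩ := hy
    exact ⟨x' + y', AddSubgroup.add_mem _ hx' hy', smul_add _ _ _⟩

/-- Divisible groups are injective by Baer's criterion, so the identity of `D` extends to `M`. -/
lemma exists_retraction {D : AddSubgroup M} (hD : IsDivBy {0}ᶜ D) :
    ∃ r : M →+ M, (∀ x, r x ∈ D) ∧ ∀ d ∈ D, r d = d := by
  have : DivisibleBy D ℤ := AddCommGroup.divisibleByIntOfSMulTopEqTop _ fun {n} hn => by
    rw [eq_top_iff]
    rintro ⟨d, hd⟩ -
    obtain ⟨x, hx, rfl⟩ := hD n hn d hd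
    exact ⟨⟨x, hx⟩, trivial, rfl⟩
  obtain ⟨r, hr⟩ := (Module.Baer.of_divisible D).extension_property_addMonoidHom D.subtype
    D.subtype_injective (AddMonoidHom.id D)
  refine ⟨D.subtype.comp r, fun x => (r x).2, fun d hd => ?_⟩
  exact congrArg Subtype.val (DFunLike.congr_fun hr ⟨d, hd⟩)

variable {q : ℤ}

lemma IsDivBy.pow {D : AddSubgroup M} (hD : IsDivBy {q} D) (k : ℕ) {d : M} (hd : d ∈ D) :
    ∃ x ∈ D, q ^ k • x = d := by
  induction k with
  | zero => exact ⟨d, hd, by simp⟩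
  | succ k ih =>
    obtain ⟨x, hx, rfl⟩ := ih
    obtain ⟨y, hy, rfl⟩ := hD q rfl x hx
    exact ⟨y, hy, by rw [pow_succ, mul_smul]⟩

/-- The part of `n` prime to `q` is invertible on `q`-primary elements, so only the power of `q` in
`n` matters. -/
lemma IsDivBy.of_prime (hq : Prime q) {D : AddSubgroup M}
    (hM : ∀ x ∈ D, ∃ k : ℕ, q ^ k • x = 0) (hD : IsDivBy {q} D) : IsDivBy {0}ᶜ D := by
  intro n hn d hd
  obtain ⟨L, hL⟩ := FiniteMultiplicity.of_prime_left hq hn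
  obtain ⟨x, hx, rfl⟩ := hD.pow (L + 1) hd
  obtain ⟨N, hN⟩ := hM x hx
  obtain ⟨i, -, hin, a, b, hab⟩ := exists_bezout_prime_pow hq n N
  have hi : i ≤ L + 1 := by
    by_contra h
    exact hL ((pow_dvd_pow q (by omega)).trans hin)
  obtain ⟨k, hk⟩ := Nat.exists_eq_add_of_le hi
  refine ⟨(q ^ k * a) • x, D.zsmul_mem hx _, ?_⟩
  have : q ^ i • x = (a * n) • x := by
    rw [← hab, add_smul, mul_smul b, hN, smul_zero, add_zero]
  rw [hk, pow_add, mul_comm (q ^ i), mul_smul _ (q ^ i), this, smul_smul, smul_smul]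
  congr 1
  ring

lemma FinMod.exists_pow_smul_mem (hM : ∀ x : M, ∃ k : ℕ, q ^ k • x = 0) {Y : Set M}
    {C : AddSubgroup M} (h : FinMod Y C) : ∃ k : ℕ, ∀ y ∈ Y, q ^ k • y ∈ C := by
  obtain ⟨S, hS, h⟩ := h
  choose κ hκ using hM
  obtain ⟨K, hK⟩ := (hS.image κ).bddAbove
  refine ⟨K, fun y hy => ?_⟩
  obtain ⟨s, hs, hys⟩ := h y hy
  have h0 : q ^ K • s = 0 := smul_pow_eq_zero_of_le (hκ s) (hK ⟨s, hs, rfl⟩)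
  have := C.zsmul_mem hys (q ^ K)
  rwa [smul_sub, h0, sub_zero] at this

/-- Some `q ^ k` maps `Y` into `C`, while `q ^ k Y = Y`. -/
lemma IsDivBy.le_of_finMod (hM : ∀ x : M, ∃ k : ℕ, q ^ k • x = 0) {Y C : AddSubgroup M}
    (hY : IsDivBy {q} Y) (h : FinMod (Y : Set M) C) : Y ≤ C := by
  obtain ⟨k, hk⟩ := h.exists_pow_smul_mem hM
  intro y hy
  obtain ⟨x, hx, rfl⟩ := hY.pow k hy
  exact hk x hx

/-- An inertial endomorphism acts as a pointwise multiplication on divisible subgroups. -/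
lemma AddInertial.exists_smul_of_isDivBy (hq : Prime q) (hM : ∀ x : M, ∃ k : ℕ, q ^ k • x = 0)
    {γ : M →+ M} (hγ : AddInertial γ) {D : AddSubgroup M} (hD : IsDivBy {q} D) {d : M}
    (hd : d ∈ D) : ∃ j : ℤ, γ d = j • d := by
  by_cases hd0 : d = 0
  · exact ⟨0, by simp [hd0]⟩
  choose! half hhalf hhalf' using hD q rfl
  -- Successive division by `q` yields a quasicyclic subgroup `H` containing `d`. Its image `γ H` is
  -- divisible and finite modulo `H`, hence contained in `H`.
  let x : ℕ → M := fun n => half^[n] d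
  have hxs : ∀ n, x (n + 1) = half (x n) := fun n => Function.iterate_succ_apply' half n d
  have hxD : ∀ n, x n ∈ D := by
    intro n
    induction n with
    | zero => exact hd
    | succ n ih => rw [hxs]; exact hhalf _ ih
  have hx : ∀ n, q • x (n + 1) = x n := fun n => by rw [hxs]; exact hhalf' _ (hxD n)
  have hxn : ∀ n, q ^ n • x n = d := by
    intro n
    induction n with
    | zero => simp [x]
    | succ n ih => rw [pow_succ, mul_smul, hx, ih]
  let Z : ℕ → AddSubgroup M := fun n => AddSubgroup.zmultiples (x n)
  have hZ : Monotone Z := monotone_nat_of_le_succ fun n => by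
    simp only [Z, AddSubgroup.zmultiples_le, ← hx n]
    exact AddSubgroup.zsmul_mem _ (AddSubgroup.mem_zmultiples _) _
  let H : AddSubgroup M := ⨆ n, Z n
  have hH : ∀ y, y ∈ H ↔ ∃ n, ∃ j : ℤ, j • x n = y := fun y => by
    rw [AddSubgroup.mem_iSup_of_directed hZ.directed_le]
    simp only [Z, AddSubgroup.mem_zmultiples_iff]
  have hHdiv : IsDivBy {q} H := by
    refine isDivBy_singleton.2 fun y hy => ?_
    obtain ⟨n, j, rfl⟩ := (hH y).1 hy
    exact ⟨j • x (n + 1), (hH _).2 ⟨_, _, rfl⟩, by rw [smul_comm, hx]⟩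
  have hγH : H.map γ ≤ H := by
    refine IsDivBy.le_of_finMod hM (isDivBy_singleton.2 ?_) (by simpa using hγ H)
    rintro _ ⟨y, hy, rfl⟩
    obtain ⟨z, hz, rfl⟩ := hHdiv q rfl y hy
    exact ⟨γ z, ⟨z, hz, rfl⟩, (map_zsmul γ q z).symm⟩
  obtain ⟨n, j, hj⟩ := (hH _).1 (hγH ⟨d, (hH d).2 ⟨0, 1, by simp [x]⟩, rfl⟩)
  obtain ⟨k, hk, hkmin⟩ : ∃ k : ℕ, q ^ (k + 1) • d = 0 ∧ q ^ k • d ≠ 0 := by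
    classical
    obtain ⟨hk, hmin⟩ := (Nat.find_eq_iff (hM d)).1 rfl
    rcases h : Nat.find (hM d) with _ | k
    · rw [h] at hk; exact absurd (by simpa using hk) hd0
    · exact ⟨k, by rwa [h] at hk, hmin k (by omega)⟩
  -- `x n` has order `q ^ (k + n + 1)` while `γ d = j • x n` is killed by `q ^ (k + 1)`. Hence `q ^
  -- n` divides `j`, and `γ d` is a multiple of `q ^ n • x n = d`.
  have h1 : q ^ (k + n + 1) ∣ j * q ^ (k + 1) := by
    refine pow_dvd_of_smul_eq_zero hq (x := x n) ?_ (hM _) ?_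
    · rwa [pow_add, mul_smul, hxn]
    · rw [mul_comm, mul_smul, hj, ← map_zsmul, hk, map_zero]
  obtain ⟨i, hi⟩ : q ^ n ∣ j := by
    rw [show k + n + 1 = n + (k + 1) by omega, pow_add] at h1
    exact Int.dvd_of_mul_dvd_mul_right (pow_ne_zero _ hq.ne_zero) h1
  refine ⟨i, ?_⟩
  rw [← hj, hi, mul_comm, mul_smul, hxn]

/-- In a divisible group, finite socle passes from a quotient by a bounded part. -/
lemma FiniteSocle.finite_of_isDivBy {C D : AddSubgroup M} (h : FiniteSocle q C)
    (hD : IsDivBy {q} D) {n : ℕ} (hn : ∀ x ∈ C, x ∈ D → q ^ n • x = 0) :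
    {x ∈ (D : Set M) | q • x = 0}.Finite := by
  have h1 : FinMod {x ∈ (D : Set M) | q ^ (n + 1) • x = 0} (C ⊓ D) := by
    refine FinMod.of_image (f := AddMonoidHom.id M) (D := C) ?_
      fun x hx y hy hxy => ⟨hxy, D.sub_mem hx.1 hy.1⟩
    refine (h.pow (n + 1)).mono ?_ le_rfl
    rintro _ ⟨x, hx, rfl⟩
    change q ^ (n + 1) • x ∈ C
    rw [hx.2]
    exact C.zero_mem
  have h2 := finMod_bot.1 (h1.image (zsmulAddGroupHom (α := M) (q ^ n)) (D := ⊥)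
    fun x hx => hn x hx.1 hx.2)
  refine h2.subset ?_
  rintro x ⟨hx, hx0⟩
  obtain ⟨y, hy, rfl⟩ := hD.pow n hx
  exact ⟨y, ⟨hy, by rw [pow_succ', mul_smul]; exact hx0⟩, rfl⟩

end Divisible

/-! ### Pointwise multiplications on primary groups. -/

section Power

variable {M : Type*} [AddCommGroup M] {q : ℤ}

/-- A pointwise multiplication on a bounded primary group is the multiplication by an integer. -/
lemma exists_smul_of_bounded (hq : Prime q) {C : AddSubgroup M} {e : ℕ}
    (he : ∀ x ∈ C, q ^ e • x = 0) {ψ : M →+ M} (hψ : ∀ x ∈ C, ∃ j : ℤ, ψ x = j • x) :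
    ∃ m : ℤ, ∀ x ∈ C, ψ x = m • x := by
  classical
  have hex : ∃ f : ℕ, ∀ x ∈ C, q ^ f • x = 0 := ⟨e, he⟩
  obtain ⟨hf, hmin⟩ := (Nat.find_eq_iff hex).1 rfl
  rcases h : Nat.find hex with _ | f
  · rw [h] at hf
    refine ⟨0, fun x hx => ?_⟩
    have : x = 0 := by simpa using hf x hx
    simp [this]
  rw [h] at hf
  have := hmin f (by omega)
  push Not at this
  -- `x` has maximal order in `C`, so the multiplier `m` at `x` is the candidate for all of `C`.
  obtain ⟨x, hx, hxf⟩ := this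
  obtain ⟨m, hm⟩ := hψ x hx
  refine ⟨m, fun y hy => ?_⟩
  let X := AddSubgroup.zmultiples x
  have hky : ∃ k : ℕ, q ^ k • y ∈ X := ⟨f + 1, by rw [hf y hy]; exact X.zero_mem⟩
  obtain ⟨hk, hkmin⟩ := (Nat.find_eq_iff hky).1 rfl
  set k := Nat.find hky
  have hkf : k ≤ f + 1 := Nat.find_le (by rw [hf y hy]; exact X.zero_mem)
  obtain ⟨s, hs⟩ := AddSubgroup.mem_zmultiples_iff.1 hk
  -- By maximality of the order of `x`, `q ^ k • y` is divisible by `q ^ k` already inside `⟨x⟩`. So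
  -- `y` may be corrected by a multiple of `x` to some `y'` with `⟨y'⟩ ∩ ⟨x⟩ = 0`.
  have hsk : q ^ k ∣ s := by
    obtain ⟨l, hl⟩ := Nat.exists_eq_add_of_le hkf
    have h1 : q ^ (f + 1) ∣ q ^ l * s := by
      refine pow_dvd_of_smul_eq_zero hq hxf ⟨_, hf x hx⟩ ?_
      rw [mul_smul, hs, smul_smul, ← pow_add, add_comm l k, ← hl]
      exact hf y hy
    rw [hl, add_comm k l, pow_add] at h1
    exact Int.dvd_of_mul_dvd_mul_left (pow_ne_zero _ hq.ne_zero) h1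
  obtain ⟨t, rfl⟩ := hsk
  obtain ⟨y', rfl⟩ : ∃ y', y = y' + t • x := ⟨y - t • x, by abel⟩
  have hy' : y' ∈ C := by simpa using C.sub_mem hy (C.zsmul_mem hx t)
  have hky' : q ^ k • y' = 0 := by
    rw [smul_add, smul_smul] at hs
    exact left_eq_add.1 (by rw [add_comm]; exact hs)
  have hindep : ∀ j : ℤ, j • y' ∈ X → j • y' = 0 := by
    intro j hj
    obtain ⟨i, hi, hij, a, b, hab⟩ := exists_bezout_prime_pow hq j k
    have hiX : q ^ i • (y' + t • x) ∈ X := by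
      rw [smul_add, ← hab, add_smul, mul_smul, mul_smul, hky', smul_zero, add_zero]
      exact X.add_mem (X.zsmul_mem hj a)
        (X.zsmul_mem (X.zsmul_mem (AddSubgroup.mem_zmultiples x) _) _)
    have hik : i = k := by
      by_contra hne
      exact hkmin i (by omega) hiX
    obtain ⟨c, rfl⟩ := hij
    rw [hik, mul_comm, mul_smul, hky', smul_zero]
  obtain ⟨n, hn⟩ := hψ y' hy'
  -- The multiplier at `x + y'` agrees with those at `x` and at `y'` by independence; a congruence
  -- modulo the order of `x` also holds on `y'`.
  obtain ⟨l, hl⟩ := hψ (x + y') (C.add_mem hx hy')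
  rw [map_add, hm, hn, smul_add] at hl
  have h1 : (n - l) • y' = (l - m) • x := by
    rw [sub_smul, sub_smul, sub_eq_sub_iff_add_eq_add, add_comm, hl]
  have h2 : (n - l) • y' = 0 := hindep _ (by
    rw [h1]; exact X.zsmul_mem (AddSubgroup.mem_zmultiples x) _)
  have h3 : q ^ (f + 1) ∣ l - m :=
    pow_dvd_of_smul_eq_zero hq hxf ⟨_, hf x hx⟩ (by rw [← h1, h2])
  have h4 : (l - m) • y' = 0 := by
    obtain ⟨c, hc⟩ := h3
    rw [hc, mul_comm, mul_smul, hf y' hy', smul_zero]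
  rw [sub_smul, sub_eq_zero] at h2 h4
  rw [map_add, map_zsmul, hm, hn, h2, h4, smul_add, smul_comm]

lemma exists_unit_smul_of_bounded (hq : Prime q) {C : AddSubgroup M} {e : ℕ}
    (he : ∀ x ∈ C, q ^ e • x = 0) {ψ : M →+ M} (hψ : ∀ x ∈ C, ∃ j : ℤ, ψ x = j • x)
    (hinj : ∀ x ∈ C, ψ x = 0 → x = 0) :
    ∃ m : ℤ, ¬ q ∣ m ∧ ∀ x ∈ C, ψ x = m • x := by
  by_cases hC : ∀ x ∈ C, x = 0
  · exact ⟨1, hq.not_dvd_one, fun x hx => by simp [hC x hx]⟩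
  obtain ⟨m, hm⟩ := exists_smul_of_bounded hq he hψ
  refine ⟨m, ?_, hm⟩
  rintro ⟨c, rfl⟩
  refine hC fun x hx => ?_
  have key : ∀ k : ℕ, ∀ x ∈ C, q ^ k • x = 0 → x = 0 := by
    intro k
    induction k with
    | zero => intro x _ h; simpa using h
    | succ k ih =>
      intro x hx h
      refine hinj x hx ?_
      rw [hm x hx, mul_comm, mul_smul, ih (q • x) (C.zsmul_mem hx q)
        (by rwa [smul_smul, ← pow_succ]), smul_zero]
  exact key e x hx (he x hx)

/-- A coherent sequence of integers prime to `q` acts on a `q`-primary group. -/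
lemma exists_addEquiv_of_coherent (hq : Prime q) (hM : ∀ x : M, ∃ k : ℕ, q ^ k • x = 0)
    {m : ℕ → ℤ} (hm : ∀ k l, k ≤ l → q ^ k ∣ m l - m k) (hu : ∀ k, ¬ q ∣ m k) :
    ∃ μ : M ≃+ M, ∀ (k : ℕ) (x : M), q ^ k • x = 0 → μ x = m k • x := by
  have hwd : ∀ (k l : ℕ) (x : M), q ^ k • x = 0 → q ^ l • x = 0 → m l • x = m k • x := by
    have : ∀ (k l : ℕ) (x : M), k ≤ l → q ^ k • x = 0 → m l • x = m k • x := by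
      intro k l x hkl hx
      obtain ⟨c, hc⟩ := hm k l hkl
      rw [← sub_eq_zero, ← sub_smul, hc, mul_comm, mul_smul, hx, smul_zero]
    intro k l x hk hl
    rcases le_total k l with h | h
    · exact this k l x h hk
    · exact (this l k x h hl).symm
  choose κ hκ using hM
  let f : M →+ M := AddMonoidHom.mk' (fun x => m (κ x) • x) (by
    intro x y
    have hx := smul_pow_eq_zero_of_le (hκ x) (le_max_left (κ x) (κ y))
    have hy := smul_pow_eq_zero_of_le (hκ y) (le_max_right (κ x) (κ y))
    rw [hwd _ _ _ hx (hκ x), hwd _ _ _ hy (hκ y),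
      hwd _ _ (x + y) (by rw [smul_add, hx, hy, add_zero]) (hκ _), smul_add])
  have hf : ∀ (k : ℕ) (x : M), q ^ k • x = 0 → f x = m k • x := fun k x hx =>
    hwd k (κ x) x hx (hκ x)
  have hbij : Function.Bijective f := by
    constructor
    · rw [injective_iff_map_eq_zero]
      intro x hx
      have := mem_of_smul_mem_of_not_dvd hq (C := ⊥) (x := x) (j := m (κ x)) (k := κ x)
        (by rw [hκ x]; exact AddSubgroup.zero_mem _) (hu _) hx
      simpa using this
    · intro y
      obtain ⟨a, ⟨c, hc⟩, -⟩ := exists_inverse_mod_pow hq (hu (κ y)) (κ y)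
      refine ⟨a • y, ?_⟩
      rw [hf (κ y) (a • y) (by rw [smul_comm, hκ, smul_zero]), smul_smul, mul_comm,
        show a * m (κ y) = 1 + c * q ^ κ y by linear_combination hc, add_smul, mul_smul, hκ]
      simp
  exact ⟨AddEquiv.ofBijective f hbij, hf⟩

/-- An injective pointwise multiplication on a subgroup of a primary group extends to the whole
group. -/
lemma exists_addEquiv_extension (hq : Prime q) (hM : ∀ x : M, ∃ k : ℕ, q ^ k • x = 0)
    {C : AddSubgroup M} {ψ : M →+ M} (hψ : ∀ x ∈ C, ∃ j : ℤ, ψ x = j • x)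
    (hinj : ∀ x ∈ C, ψ x = 0 → x = 0) :
    ∃ μ : M ≃+ M, (∀ k : ℕ, ∃ j : ℤ, ¬ q ∣ j ∧ ∀ x, q ^ k • x = 0 → μ x = j • x) ∧
      ∀ x ∈ C, ψ x = μ x := by
  by_cases hC : ∃ e : ℕ, ∀ x ∈ C, q ^ e • x = 0
  · obtain ⟨e, he⟩ := hC
    obtain ⟨m, hm, hmC⟩ := exists_unit_smul_of_bounded hq he hψ hinj
    obtain ⟨μ, hμ⟩ := exists_addEquiv_of_coherent hq hM (m := fun _ => m) (by simp) fun _ => hm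
    exact ⟨μ, fun k => ⟨m, hm, hμ k⟩, fun x hx => by rw [hmC x hx, hμ e x (he x hx)]⟩
  push Not at hC
  have hex : ∀ k : ℕ, ∃ m : ℤ, ¬ q ∣ m ∧ ∀ x ∈ C, q ^ k • x = 0 → ψ x = m • x := by
    intro k
    obtain ⟨m, hm, h⟩ := exists_unit_smul_of_bounded hq (e := k) (ψ := ψ)
      (C := C ⊓ (zsmulAddGroupHom (α := M) (q ^ k)).ker) (fun x hx => hx.2)
      (fun x hx => hψ x hx.1) fun x hx => hinj x hx.1
    exact ⟨m, hm, fun x hx hxk => h x ⟨hx, hxk⟩⟩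
  choose m hm hmC using hex
  -- Since `C` is unbounded it contains elements of every order `q ^ k`, which determine `m k`
  -- modulo `q ^ k`; this is the coherence.
  obtain ⟨μ, hμ⟩ := exists_addEquiv_of_coherent hq hM (m := m) (by
    intro k l hkl
    rcases k with _ | k
    · simp
    obtain ⟨x, hx, hxk⟩ := hC k
    obtain ⟨N, hN⟩ := hM x
    obtain ⟨z, hzC, hz0, hz1⟩ : ∃ z ∈ C, q ^ (k + 1) • z = 0 ∧ q ^ k • z ≠ 0 := by
      classical
      obtain ⟨hf, hmin⟩ := (Nat.find_eq_iff (hM x)).1 rfl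
      set f := Nat.find (hM x)
      have hkf : k + 1 ≤ f := by
        by_contra h
        exact hxk (smul_pow_eq_zero_of_le hf (by omega))
      obtain ⟨i, hi⟩ := Nat.exists_eq_add_of_le hkf
      refine ⟨q ^ i • x, C.zsmul_mem hx _, ?_, ?_⟩
      · rwa [smul_smul, ← pow_add, ← hi]
      · rw [smul_smul, ← pow_add]
        exact hmin _ (by omega)
    refine pow_dvd_of_smul_eq_zero hq hz1 (hM z) ?_
    rw [sub_smul, ← hmC l z hzC (smul_pow_eq_zero_of_le hz0 hkl), ← hmC _ z hzC hz0, sub_self]) hm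
  refine ⟨μ, fun k => ⟨m k, hm k, hμ k⟩, fun x hx => ?_⟩
  obtain ⟨k, hk⟩ := hM x
  rw [hmC k x hx hk, hμ k x hk]

end Power

/-! ### Inertial monomorphisms of a primary group. -/

section Local

variable {M : Type*} [AddCommGroup M] {q : ℤ}

lemma FiniteSocle.inf {C D : AddSubgroup M} (hC : FiniteSocle q C) (hD : FiniteSocle q D) :
    FiniteSocle q (C ⊓ D) := by
  obtain ⟨S, hS, hSC⟩ := hC
  obtain ⟨T, hT, hTD⟩ := hD
  refine FinMod.of_classes (hS.prod hT) (fun x st => x - st.1 ∈ C ∧ x - st.2 ∈ D) ?_ ?_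
  · intro x hx
    obtain ⟨s, hs, hxs⟩ := hSC x hx.1
    obtain ⟨t, ht, hxt⟩ := hTD x hx.2
    exact ⟨(s, t), ⟨hs, ht⟩, hxs, hxt⟩
  · rintro x _ y _ ⟨s, t⟩ h1 h2
    exact ⟨by simpa using C.sub_mem h1.1 h2.1, by simpa using D.sub_mem h1.2 h2.2⟩

lemma FiniteSocle.comap {C : AddSubgroup M} (hC : FiniteSocle q C) (f : M →+ M) :
    FiniteSocle q (C.comap f) := by
  refine FinMod.of_image (f := f) (D := C) ?_ fun x _ y _ h => h
  refine FinMod.mono hC ?_ le_rfl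
  rintro _ ⟨x, hx, rfl⟩
  simpa using hx

lemma torsion_of_primary (hq : Prime q) (hM : ∀ x : M, ∃ k : ℕ, q ^ k • x = 0) (x : M) :
    ∃ n : ℤ, n ≠ 0 ∧ n • x = 0 := by
  obtain ⟨k, hk⟩ := hM x
  exact ⟨q ^ k, pow_ne_zero _ hq.ne_zero, hk⟩

/-- A bounded subgroup whose quotient has finite socle forces the group to be divisible by
bounded. -/
lemma FiniteSocle.exists_divisible_of_bounded (hM : ∀ x : M, ∃ k : ℕ, q ^ k • x = 0)
    {C : AddSubgroup M} (hC : FiniteSocle q C) {t : ℕ} (ht : ∀ x ∈ C, q ^ t • x = 0) :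
    ∃ e : ℕ, ∀ x : M, ∃ y : M, q ^ e • x = q ^ (e + 1) • y := by
  obtain ⟨K, hK⟩ := hC.exists_divisible hM
  refine ⟨K + t, fun x => ?_⟩
  obtain ⟨y, hy⟩ := hK x
  refine ⟨y, ?_⟩
  have := ht _ hy
  rw [smul_sub, smul_smul, smul_smul, ← pow_add, ← pow_add, sub_eq_zero] at this
  rw [add_comm K t, this, add_assoc]

lemma isDivBy_range_pow {e : ℕ} (h : ∀ x : M, ∃ y : M, q ^ e • x = q ^ (e + 1) • y) :
    IsDivBy {q} (zsmulAddGroupHom (α := M) (q ^ e)).range := by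
  refine isDivBy_singleton.2 ?_
  rintro _ ⟨x, rfl⟩
  obtain ⟨y, hy⟩ := h x
  exact ⟨q ^ e • y, ⟨y, rfl⟩, by rw [smul_smul, ← pow_succ']; exact hy.symm⟩

/-- An inertial endomorphism of a primary group is a pointwise multiplication on a subgroup
whose quotient has finite socle. -/
lemma AddInertial.exists_finiteSocle (hq : Prime q) (hM : ∀ x : M, ∃ k : ℕ, q ^ k • x = 0)
    {γ : M →+ M} (hγ : AddInertial γ) :
    ∃ C : AddSubgroup M, FiniteSocle q C ∧ ∀ x ∈ C, ∃ j : ℤ, γ x = j • x := by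
  obtain ⟨F, hF, hFγ⟩ := hγ.exists_finite (torsion_of_primary hq hM)
  obtain ⟨C, hCF, hC⟩ := exists_high hq F
  have hC' : FiniteSocle q C := ⟨F, hF, fun x hx => by
    obtain ⟨f, hf, -, hxf⟩ := hC x hx
    exact ⟨f, hf, hxf⟩⟩
  -- Membership in the preimage puts `γ x - j • x` into `C` as well as into `F`, so that it
  -- vanishes.
  refine ⟨C ⊓ C.comap γ, hC'.inf (hC'.comap γ), fun x hx => ?_⟩
  obtain ⟨j, hj⟩ := hFγ x fun j hj => hCF _ (C.zsmul_mem hx.1 j) hj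
  exact ⟨j, sub_eq_zero.1 (hCF _ (C.sub_mem hx.2 (C.zsmul_mem hx.1 j)) hj)⟩

/-- If `γ` agrees with a pointwise multiplication `μ` on an unbounded subgroup with quotient of
finite socle, then `γ` agrees with `μ` on every divisible subgroup. -/
lemma AddInertial.eq_on_divisible (hq : Prime q) (hM : ∀ x : M, ∃ k : ℕ, q ^ k • x = 0)
    {γ : M →+ M} (hγ : AddInertial γ) {μ : M →+ M} (hμ : ∀ x, ∃ j : ℤ, μ x = j • x)
    {C : AddSubgroup M} (hC : FiniteSocle q C) (hγC : ∀ x ∈ C, γ x = μ x)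
    (hunb : ∀ t : ℕ, ∃ x ∈ C, q ^ t • x ≠ 0) {D : AddSubgroup M} (hD : IsDivBy {q} D)
    (hDmax : ∀ D', IsDivBy {q} D' → D' ≤ D) {d₀ : M} (hd₀ : d₀ ∈ D) : γ d₀ = μ d₀ := by
  by_contra hne
  let η : M →+ M := γ - μ
  have hη : ∀ x, γ x = η x + μ x := fun x => by simp [η]
  have hηd₀ : η d₀ ≠ 0 := by simpa [η, sub_eq_zero] using hne
  have hηC : ∀ x ∈ C, η x = 0 := fun x hx => by simp [η, hγC x hx]
  have hηD : ∀ x ∈ D, ∃ j : ℤ, η x = j • x := by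
    intro x hx
    obtain ⟨i, hi⟩ := hγ.exists_smul_of_isDivBy hq hM hD hx
    obtain ⟨j, hj⟩ := hμ x
    exact ⟨i - j, by simp [η, hi, hj, sub_smul]⟩
  obtain ⟨n, hn⟩ := hM d₀
  -- On torsion of bounded exponent `η` is multiplication by one integer; if it killed an element of
  -- order exceeding `q ^ n` it would kill `d₀`. Consequently `C ∩ D` is bounded and `D` has finite
  -- socle.
  have hker : ∀ d ∈ D, η d = 0 → q ^ n • d = 0 := by
    intro d hd hd0
    by_contra hnd
    obtain ⟨N, hN⟩ := hM d
    obtain ⟨j, hj⟩ := exists_smul_of_bounded hq (e := max N n) (ψ := η)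
      (C := D ⊓ (zsmulAddGroupHom (α := M) (q ^ max N n)).ker) (fun x hx => hx.2)
      fun x hx => hηD x hx.1
    have hjd : j • d = 0 := by
      rw [← hj d ⟨hd, smul_pow_eq_zero_of_le hN (le_max_left _ _)⟩, hd0]
    obtain ⟨c, hc⟩ := pow_dvd_of_smul_eq_zero hq hnd (hM d) hjd
    refine hηd₀ ?_
    rw [hj d₀ ⟨hd₀, smul_pow_eq_zero_of_le hn (le_max_right _ _)⟩, hc, pow_succ, mul_comm,
      mul_comm (q ^ n), ← mul_assoc, mul_smul, hn, smul_zero]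
  have hsoc : {x ∈ (D : Set M) | q • x = 0}.Finite :=
    hC.finite_of_isDivBy hD fun x hx hxD => hker x hxD (hηC x hx)
  obtain ⟨F, hF, hFγ⟩ := hγ.exists_finite (torsion_of_primary hq hM)
  obtain ⟨s, hs⟩ := (finMod_bot.2 hF).exists_pow_smul_mem hM
  replace hs : ∀ f ∈ F, q ^ s • f = 0 := hs
  have hFD : {x ∈ ((F ⊔ D : AddSubgroup M) : Set M) | q • x = 0}.Finite := by
    have h1 : FinMod {x ∈ ((F ⊔ D : AddSubgroup M) : Set M) | q • x = 0}
        (D ⊓ (zsmulAddGroupHom (α := M) q).ker) := by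
      refine FinMod.of_classes hF (fun x f => x - f ∈ D) ?_ ?_
      · rintro x ⟨hx, -⟩
        obtain ⟨f, hf, d, hd, rfl⟩ := AddSubgroup.mem_sup.1 hx
        exact ⟨f, hf, by simpa using hd⟩
      · intro x hx y hy f h1 h2
        refine ⟨by simpa using D.sub_mem h1 h2, ?_⟩
        change q • (x - y) = 0
        rw [smul_sub, hx.2, hy.2, sub_zero]
    exact finMod_bot.1 (h1.trans (finMod_bot.2 hsoc))
  obtain ⟨C₁, hC₁F, hC₁⟩ := exists_high hq (F ⊔ D)
  have hC₁' : FiniteSocle q C₁ := ⟨_, hFD, fun x hx => by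
    obtain ⟨f, hf, hf0, hxf⟩ := hC₁ x hx
    exact ⟨f, ⟨hf, hf0⟩, hxf⟩⟩
  -- Otherwise some `q ^ e M` would be divisible, hence inside `D`, and by `hker` the subgroup `C`
  -- would be bounded.
  have hunb' : ∀ t : ℕ, ∃ x ∈ C ⊓ C₁, q ^ t • x ≠ 0 := by
    by_contra! hcon
    obtain ⟨t, ht⟩ := hcon
    obtain ⟨e, he⟩ := (hC.inf hC₁').exists_divisible_of_bounded hM ht
    have hle := hDmax _ (isDivBy_range_pow he)
    obtain ⟨x, hx, hxn⟩ := hunb (n + e)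
    refine hxn ?_
    rw [pow_add, mul_smul]
    exact hker _ (hle ⟨x, rfl⟩) (by rw [map_zsmul, hηC x hx, smul_zero])
  -- The exponent `s` kills `F` and `n` kills the kernel of `η` on `D`. With `c` independent of `F +
  -- D` and of larger order than `d`, inertiality at `c + d` forces `η d ∈ F`, whence `q ^ (s + n) •
  -- d = d₀` would be zero.
  obtain ⟨d, hd, hdd₀⟩ := hD.pow (s + n) hd₀
  have hd0 : q ^ (s + n) • d ≠ 0 := by
    rw [hdd₀]
    rintro rfl
    exact hηd₀ (map_zero η)
  obtain ⟨N, hN⟩ := hM d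
  obtain ⟨c, hc, hcN⟩ := hunb' N
  have hind : ∀ j : ℤ, j • c ∈ F ⊔ D → j • c = 0 ∧ j • d = 0 := by
    intro j hj
    have h0 := hC₁F _ (C₁.zsmul_mem hc.2 j) hj
    obtain ⟨a, ha⟩ := pow_dvd_of_smul_eq_zero hq hcN (hM c) h0
    refine ⟨h0, ?_⟩
    rw [ha, pow_succ, mul_assoc, mul_comm, mul_smul, hN, smul_zero]
  obtain ⟨j, hj⟩ := hFγ (c + d) (by
    intro j hj
    have : j • c ∈ F ⊔ D := by
      have := AddSubgroup.sub_mem _ (AddSubgroup.mem_sup_left (T := D) hj)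
        (AddSubgroup.mem_sup_right (S := F) (D.zsmul_mem hd j))
      rwa [smul_add, add_sub_cancel_right] at this
    rw [smul_add, (hind j this).1, (hind j this).2, add_zero])
  obtain ⟨i, hi⟩ := hμ (c + d)
  have hj' : η d + (i - j) • (c + d) ∈ F := by
    rw [hη, hi, map_add, hηC c hc.1, zero_add, add_sub_assoc, ← sub_smul] at hj
    exact hj
  have hηdD : η d ∈ D := by
    obtain ⟨l, hl⟩ := hηD d hd
    rw [hl]
    exact D.zsmul_mem hd l
  have hcF : (i - j) • c ∈ F ⊔ D := by
    have := AddSubgroup.sub_mem _ (AddSubgroup.mem_sup_left (T := D) hj')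
      (AddSubgroup.mem_sup_right (S := F) (D.add_mem hηdD (D.zsmul_mem hd (i - j))))
    rwa [smul_add, show η d + ((i - j) • c + (i - j) • d) - (η d + (i - j) • d) = (i - j) • c by
      abel] at this
  rw [smul_add, (hind _ hcF).1, (hind _ hcF).2, add_zero, add_zero] at hj'
  refine hd0 ?_
  rw [add_comm, pow_add, mul_smul]
  refine hker _ (D.zsmul_mem hd _) ?_
  rw [map_zsmul, hs _ hj']

/-- If moreover `γ` agrees with `μ` on the divisible radical, then `γ - μ` has finite image. -/
lemma AddInertial.finite_range_sub (hq : Prime q) (hM : ∀ x : M, ∃ k : ℕ, q ^ k • x = 0)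
    {γ : M →+ M} (hγ : AddInertial γ) {μ : M →+ M} (hμ : ∀ x, ∃ j : ℤ, μ x = j • x)
    {C : AddSubgroup M} (hC : FiniteSocle q C) (hγC : ∀ x ∈ C, γ x = μ x)
    {D : AddSubgroup M} (hD : IsDivBy {q} D) (hDmax : ∀ D', IsDivBy {q} D' → D' ≤ D)
    (hγD : ∀ x ∈ D, γ x = μ x) : (Set.range (γ - μ)).Finite := by
  obtain ⟨K, hK⟩ := hC.exists_divisible hM
  obtain ⟨r, hrD, hr⟩ := exists_retraction (hD.of_prime hq fun x _ => hM x)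
  have hηC : ∀ x ∈ C, (γ - μ) x = 0 := fun x hx => by simp [hγC x hx]
  have hηD : ∀ x ∈ D, (γ - μ) x = 0 := fun x hx => by simp [hγD x hx]
  set η := γ - μ
  -- `η` kills `C`, and multiplication by `q ^ K` makes `M / C` divisible, so `E` is divisible. It
  -- therefore lies in `D`, where `r` is the identity, and finiteness of the image of `r ∘ η` gives
  -- `E = 0`.
  let E : AddSubgroup M := (zsmulAddGroupHom (α := M) (q ^ K)).range.map η
  have hE : IsDivBy {q} E := by
    refine isDivBy_singleton.2 ?_
    rintro _ ⟨_, ⟨x, rfl⟩, rfl⟩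
    obtain ⟨y, hy⟩ := hK x
    refine ⟨_, ⟨_, ⟨y, rfl⟩, rfl⟩, ?_⟩
    have := hηC _ hy
    rw [map_sub, sub_eq_zero] at this
    rw [← map_zsmul]
    change η (q • q ^ K • y) = η (q ^ K • x)
    rw [this, smul_smul, ← pow_succ']
  -- Inertiality is applied to the complement `ker r` of `D`. It is preserved by `μ`, and `η`
  -- vanishes on `D`, so the whole image is obtained.
  have hrη : (Set.range (r.comp η)).Finite := by
    have h1 : FinMod (η '' (r.ker : Set M)) r.ker := by
      obtain ⟨S, hS, h⟩ := hγ r.ker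
      refine ⟨S, hS, ?_⟩
      rintro _ ⟨x, hx, rfl⟩
      obtain ⟨s, hs, hxs⟩ := h _ ⟨x, hx, rfl⟩
      obtain ⟨j, hj⟩ := hμ x
      refine ⟨s, hs, ?_⟩
      have : η x - s = (γ x - s) - j • x := by simp only [η, AddMonoidHom.sub_apply, hj]; abel
      rw [this]
      exact AddSubgroup.sub_mem _ hxs (AddSubgroup.zsmul_mem _ hx j)
    refine (finMod_bot.1 (h1.image r (D := ⊥) fun c hc => hc)).subset ?_
    rintro _ ⟨x, rfl⟩
    refine ⟨η x, ⟨x - r x, ?_, ?_⟩, rfl⟩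
    · change r (x - r x) = 0
      rw [map_sub, hr _ (hrD x), sub_self]
    · rw [map_sub, hηD _ (hrD x), sub_zero]
  have hE0 : ∀ x ∈ E, x = 0 := by
    have : E ≤ ⊥ := by
      refine hE.le_of_finMod hM (finMod_bot.2 (hrη.subset ?_))
      intro y hy
      have hyD := hDmax E hE hy
      obtain ⟨x, -, rfl⟩ := hy
      exact ⟨x, hr _ hyD⟩
    exact fun x hx => by simpa using this hx
  have h2 := finMod_bot.1 ((hC.finMod_pow hM K).image η (D := ⊥) (by
    intro x hx
    obtain ⟨c, hc, z, hz, rfl⟩ := AddSubgroup.mem_sup.1 hx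
    rw [map_add, hηC c hc, hE0 _ ⟨z, hz, rfl⟩, add_zero]
    exact AddSubgroup.zero_mem _))
  rwa [Set.image_univ] at h2

/-- The structure of the inertial monomorphisms of a primary group: up to a pointwise
multiplication, they are finitary or the group is divisible of finite rank by bounded. -/
theorem AddInertial.structure (hq : Prime q) (hM : ∀ x : M, ∃ k : ℕ, q ^ k • x = 0)
    {γ : M →+ M} (hγ : AddInertial γ) (hinj : Function.Injective γ) :
    ∃ μ : M ≃+ M, (∀ x, ∃ j : ℤ, μ x = j • x) ∧
      ((Set.range fun x => γ x - μ x).Finite ∨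
      ∃ e : ℕ, (∀ x : M, ∃ y : M, q ^ e • x = q ^ (e + 1) • y) ∧ (∃ x : M, q ^ e • x ≠ 0) ∧
        {x : M | q • x = 0 ∧ ∃ y : M, q ^ e • y = x}.Finite ∧
        (∀ x, γ (q ^ e • x) = μ (q ^ e • x)) ∧
        ∃ k : ℤ, ¬ q ∣ k ∧
          FinMod (Set.range fun x => γ x - k • μ x) (zsmulAddGroupHom (α := M) (q ^ e)).range) := by
  have hinj' : ∀ x, γ x = 0 → x = 0 := (injective_iff_map_eq_zero γ).1 hinj
  obtain ⟨C, hC, hγC⟩ := hγ.exists_finiteSocle hq hM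
  have hpt : ∀ μ : M ≃+ M, (∀ k : ℕ, ∃ j : ℤ, ¬ q ∣ j ∧ ∀ x, q ^ k • x = 0 → μ x = j • x) →
      ∀ x, ∃ j : ℤ, μ x = j • x := by
    intro μ hμ x
    obtain ⟨k, hk⟩ := hM x
    obtain ⟨j, -, hj⟩ := hμ k
    exact ⟨j, hj x hk⟩
  by_cases hb : ∃ t : ℕ, ∀ x ∈ C, q ^ t • x = 0
  · obtain ⟨t, ht⟩ := hb
    obtain ⟨e, he⟩ := hC.exists_divisible_of_bounded hM ht
    -- When `M` itself is bounded, `M / C` is finite, and any `μ` extending `γ` on `C` works.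
    by_cases h0 : ∀ x : M, q ^ e • x = 0
    · obtain ⟨μ, hμ, hμC⟩ := exists_addEquiv_extension hq hM hγC fun x _ => hinj' x
      refine ⟨μ, hpt μ hμ, Or.inl ?_⟩
      have h2 := finMod_bot.1 ((hC.pow e).image (γ - μ.toAddMonoidHom) (D := ⊥) (by
        intro x hx
        have : γ x - μ x = 0 := by rw [hμC x hx, sub_self]
        exact this))
      refine h2.subset ?_
      rintro _ ⟨x, rfl⟩
      exact ⟨x, by simp [h0 x], rfl⟩
    · push Not at h0
      have hD := isDivBy_range_pow he
      obtain ⟨μ, hμ, hμD⟩ := exists_addEquiv_extension hq hM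
        (C := (zsmulAddGroupHom (α := M) (q ^ e)).range) (ψ := γ)
        (fun x hx => hγ.exists_smul_of_isDivBy hq hM hD hx) fun x _ => hinj' x
      refine ⟨μ, hpt μ hμ, Or.inr ⟨e, he, h0, ?_, fun x => hμD _ ⟨x, rfl⟩, ?_⟩⟩
      · refine (hC.finite_of_isDivBy hD fun x hx _ => ht x hx).subset ?_
        rintro _ ⟨hx, y, rfl⟩
        exact ⟨⟨y, rfl⟩, hx⟩
      · obtain ⟨m, hm, hmC⟩ := exists_unit_smul_of_bounded hq ht hγC fun x _ => hinj' x
        obtain ⟨j, hj, hjμ⟩ := hμ t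
        obtain ⟨a, ⟨b, hab⟩, ha⟩ := exists_inverse_mod_pow hq hj t
        -- On `C`, `γ` is `m`, `μ` is `j`, and `a` inverts `j` modulo the exponent `q ^ t`; so `γ =
        -- (a * m) μ` there. Moreover `C + q ^ e M` has finite index.
        refine ⟨a * m, fun h => (hq.dvd_or_dvd h).elim ha hm, ?_⟩
        have h2 := (hC.finMod_pow hM e).image (γ - (a * m) • μ.toAddMonoidHom)
          (D := (zsmulAddGroupHom (α := M) (q ^ e)).range) (by
            intro x hx
            obtain ⟨c, hc, z, ⟨z, rfl⟩, rfl⟩ := AddSubgroup.mem_sup.1 hx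
            rw [map_add]
            refine AddSubgroup.add_mem _ ?_ ?_
            · have : (γ - (a * m) • μ.toAddMonoidHom) c = 0 := by
                change γ c - (a * m) • μ c = 0
                rw [hmC c hc, hjμ c (ht c hc), smul_smul, ← sub_smul,
                  show m - a * m * j = -(m * b) * q ^ t by linear_combination (-m) * hab,
                  mul_smul, ht c hc, smul_zero]
              rw [this]
              exact AddSubgroup.zero_mem _
            · refine ⟨(γ - (a * m) • μ.toAddMonoidHom) z, ?_⟩
              exact (map_zsmul (γ - (a * m) • μ.toAddMonoidHom) (q ^ e) z).symm)
        rw [Set.image_univ] at h2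
        exact h2
  · push Not at hb
    obtain ⟨μ, hμ, hμC⟩ := exists_addEquiv_extension hq hM hγC fun x _ => hinj' x
    let D : AddSubgroup M := sSup {D | IsDivBy {q} D}
    have hD : IsDivBy {q} D := isDivBy_sSup _ _ fun D h => h
    have hDmax : ∀ D', IsDivBy {q} D' → D' ≤ D := fun D' h => le_sSup h
    refine ⟨μ, hpt μ hμ, Or.inl ?_⟩
    exact hγ.finite_range_sub hq hM (μ := μ.toAddMonoidHom) (hpt μ hμ) hC hμC hD hDmax
      fun x hx => hγ.eq_on_divisible hq hM (μ := μ.toAddMonoidHom) (hpt μ hμ) hC hμC hb hD hDmax hx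

end Local

/-! ### Primary decomposition of a torsion group. -/

section PiTorsion

variable {M : Type*} [AddCommGroup M]

/-- The element `x` is annihilated by a nonzero `π`-number. -/
def PiTorsion (π : Set ℕ) (x : M) : Prop :=
  ∃ n : ℕ, n ≠ 0 ∧ (∀ p : ℕ, p.Prime → p ∣ n → p ∈ π) ∧ n • x = 0

variable {π ρ : Set ℕ} {x y : M}

lemma PiTorsion.mono (h : PiTorsion π x) (hπ : π ⊆ ρ) : PiTorsion ρ x := by
  obtain ⟨n, hn, hp, hx⟩ := h
  exact ⟨n, hn, fun p hp' hd => hπ (hp p hp' hd), hx⟩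

lemma PiTorsion.map {N : Type*} [AddCommGroup N] (h : PiTorsion π x) (f : M →+ N) :
    PiTorsion π (f x) := by
  obtain ⟨n, hn, hp, hx⟩ := h
  exact ⟨n, hn, hp, by rw [← map_nsmul, hx, map_zero]⟩

variable (M) in
/-- The subgroup of `π`-torsion elements. -/
def piSubgroup (π : Set ℕ) : AddSubgroup M where
  carrier := {x | PiTorsion π x}
  zero_mem' := ⟨1, one_ne_zero, fun p hp h => absurd (Nat.dvd_one.mp h) hp.ne_one, smul_zero _⟩
  add_mem' := by
    rintro a b ⟨m, hm, hmπ, ha⟩ ⟨n, hn, hnπ, hb⟩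
    refine ⟨m * n, mul_ne_zero hm hn, fun p hp h => ?_, ?_⟩
    · exact (hp.dvd_mul.mp h).elim (hmπ p hp) (hnπ p hp)
    · rw [smul_add, mul_comm m n, mul_smul, ha, smul_zero, mul_comm n m, mul_smul, hb, smul_zero,
        add_zero]
  neg_mem' := fun {a} h => h.map (-AddMonoidHom.id M)

lemma PiTorsion.inter (h : PiTorsion π x) (h' : PiTorsion ρ x) : PiTorsion (π ∩ ρ) x := by
  obtain ⟨m, hm, hmπ, hx⟩ := h
  obtain ⟨n, hn, hnρ, hx'⟩ := h'
  refine ⟨m.gcd n, Nat.gcd_ne_zero_left hm, fun p hp hd =>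
    ⟨hmπ p hp (hd.trans (Nat.gcd_dvd_left _ _)), hnρ p hp (hd.trans (Nat.gcd_dvd_right _ _))⟩, ?_⟩
  rw [← addOrderOf_dvd_iff_nsmul_eq_zero] at *
  exact Nat.dvd_gcd hx hx'

lemma PiTorsion.eq_zero (h : PiTorsion ∅ x) : x = 0 := by
  obtain ⟨n, hn, hp, hx⟩ := h
  have : n = 1 := by
    by_contra h1
    obtain ⟨p, hp', hd⟩ := Nat.exists_prime_and_dvd h1
    exact hp p hp' hd
  rwa [this, one_smul] at hx

lemma PiTorsion.eq_zero_of_compl (h : PiTorsion π x) (h' : PiTorsion πᶜ x) : x = 0 := by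
  have := h.inter h'
  rw [Set.inter_compl_self] at this
  exact this.eq_zero

lemma piTorsion_singleton {p : ℕ} (hp : p.Prime) :
    PiTorsion {p} x ↔ ∃ k : ℕ, (p : ℤ) ^ k • x = 0 := by
  constructor
  · rintro ⟨n, hn, h, hx⟩
    refine ⟨n.primeFactorsList.length, ?_⟩
    have := Nat.eq_prime_pow_of_unique_prime_dvd hn (p := p) (fun {d} hd hdn => h d hd hdn)
    rw [← Int.natCast_pow, ← this, natCast_zsmul, hx]
  · rintro ⟨k, hk⟩
    refine ⟨p ^ k, pow_ne_zero _ hp.ne_zero, fun q hq hd => ?_, ?_⟩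
    · exact (Nat.prime_dvd_prime_iff_eq hq hp).1 (hq.dvd_of_dvd_pow hd)
    · rwa [← Int.natCast_pow, natCast_zsmul] at hk

lemma exists_pi_factorization (π : Set ℕ) {n : ℕ} (hn : n ≠ 0) :
    ∃ a b : ℕ, n = a * b ∧ (∀ p : ℕ, p.Prime → p ∣ a → p ∈ π) ∧
      ∀ p : ℕ, p.Prime → p ∣ b → p ∈ πᶜ := by
  induction n using Nat.recOnMul with
  | zero => exact absurd rfl hn
  | one =>
    exact ⟨1, 1, rfl, fun p hp h => absurd (Nat.dvd_one.mp h) hp.ne_one,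
      fun p hp h => absurd (Nat.dvd_one.mp h) hp.ne_one⟩
  | prime p hp =>
    by_cases h : p ∈ π
    · refine ⟨p, 1, by simp, fun q hq hd => ?_, fun p hp h => absurd (Nat.dvd_one.mp h) hp.ne_one⟩
      rwa [(Nat.prime_dvd_prime_iff_eq hq hp).1 hd]
    · refine ⟨1, p, by simp, fun p hp h => absurd (Nat.dvd_one.mp h) hp.ne_one, fun q hq hd => ?_⟩
      rwa [(Nat.prime_dvd_prime_iff_eq hq hp).1 hd]
  | mul m n ihm ihn =>
    obtain ⟨a, b, rfl, ha, hb⟩ := ihm (left_ne_zero_of_mul hn)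
    obtain ⟨c, d, rfl, hc, hd⟩ := ihn (right_ne_zero_of_mul hn)
    refine ⟨a * c, b * d, by ring, fun p hp h => ?_, fun p hp h => ?_⟩
    · exact (hp.dvd_mul.1 h).elim (ha p hp) (hc p hp)
    · exact (hp.dvd_mul.1 h).elim (hb p hp) (hd p hp)

/-- On the elements killed by `n`, the projection to the `π`-part is a multiplication. -/
lemma exists_pi_coefficient (π : Set ℕ) {n : ℕ} (hn : n ≠ 0) :
    ∃ c : ℤ, ∀ {M : Type*} [AddCommGroup M] (x : M), n • x = 0 →
      PiTorsion π (c • x) ∧ PiTorsion πᶜ (x - c • x) := by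
  obtain ⟨a, b, rfl, ha, hb⟩ := exists_pi_factorization π hn
  have hcop : Nat.Coprime a b := by
    rw [Nat.coprime_iff_gcd_eq_one]
    by_contra h
    obtain ⟨p, hp, hd⟩ := Nat.exists_prime_and_dvd h
    exact hb p hp (hd.trans (Nat.gcd_dvd_right _ _)) (ha p hp (hd.trans (Nat.gcd_dvd_left _ _)))
  obtain ⟨s, t, hst⟩ := (Nat.isCoprime_iff_coprime.2 hcop)
  refine ⟨t * b, fun {M} _ x hx => ⟨⟨a, left_ne_zero_of_mul hn, ha, ?_⟩,
    ⟨b, right_ne_zero_of_mul hn, hb, ?_⟩⟩⟩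
  · rw [← natCast_zsmul, smul_smul, show (a : ℤ) * (t * b) = t * ((a * b : ℕ) : ℤ) by
      push_cast; ring, mul_smul, natCast_zsmul, hx, smul_zero]
  · have : x - (t * b : ℤ) • x = (s * a) • x := by
      rw [sub_eq_iff_eq_add, ← add_smul, hst, one_smul]
    rw [this, ← natCast_zsmul, smul_smul, show (b : ℤ) * (s * a) = s * ((a * b : ℕ) : ℤ) by
      push_cast; ring, mul_smul, natCast_zsmul, hx, smul_zero]

lemma exists_piProj (hM : ∀ x : M, ∃ n : ℕ, n ≠ 0 ∧ n • x = 0) (π : Set ℕ) :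
    ∃ e : AddMonoid.End M, ∀ x, PiTorsion π (e x) ∧ PiTorsion πᶜ (x - e x) := by
  have hex : ∀ x : M, ∃ y : M, PiTorsion π y ∧ PiTorsion πᶜ (x - y) := by
    intro x
    obtain ⟨n, hn, hx⟩ := hM x
    obtain ⟨c, hc⟩ := exists_pi_coefficient π hn
    exact ⟨_, hc x hx⟩
  choose f hf1 hf2 using hex
  refine ⟨AddMonoidHom.mk' f fun x y => ?_, fun x => ⟨hf1 x, hf2 x⟩⟩
  rw [← sub_eq_zero]
  refine PiTorsion.eq_zero_of_compl (π := π) ?_ ?_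
  · exact (piSubgroup M π).sub_mem (hf1 _) ((piSubgroup M π).add_mem (hf1 x) (hf1 y))
  · have := (piSubgroup M πᶜ).sub_mem ((piSubgroup M πᶜ).add_mem (hf2 x) (hf2 y)) (hf2 (x + y))
    rwa [show x - f x + (y - f y) - (x + y - f (x + y)) = f (x + y) - (f x + f y) by abel] at this

variable (hM : ∀ x : M, ∃ n : ℕ, n ≠ 0 ∧ n • x = 0)

/-- The projection of a torsion group to its `π`-part. -/
noncomputable def piProj (π : Set ℕ) : AddMonoid.End M :=
  (exists_piProj hM π).choose

lemma piTorsion_piProj (π : Set ℕ) (x : M) : PiTorsion π (piProj hM π x) :=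
  ((exists_piProj hM π).choose_spec x).1

lemma piTorsion_sub_piProj (π : Set ℕ) (x : M) : PiTorsion πᶜ (x - piProj hM π x) :=
  ((exists_piProj hM π).choose_spec x).2

lemma piProj_eq (h : PiTorsion π y) (h' : PiTorsion πᶜ (x - y)) : piProj hM π x = y := by
  rw [← sub_eq_zero]
  refine PiTorsion.eq_zero_of_compl (π := π) ?_ ?_
  · exact (piSubgroup M π).sub_mem (piTorsion_piProj hM π x) h
  · have := (piSubgroup M πᶜ).sub_mem h' (piTorsion_sub_piProj hM π x)
    rwa [sub_sub_sub_cancel_left] at this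

lemma piProj_of_piTorsion (h : PiTorsion π x) : piProj hM π x = x :=
  piProj_eq hM h (by rw [sub_self]; exact (piSubgroup M πᶜ).zero_mem)

lemma piProj_of_compl (h : PiTorsion πᶜ x) : piProj hM π x = 0 :=
  piProj_eq hM (piSubgroup M π).zero_mem (by rwa [sub_zero])

lemma exists_piProj_eq_smul (π : Set ℕ) {n : ℕ} (hn : n ≠ 0) :
    ∃ c : ℤ, ∀ x : M, n • x = 0 → piProj hM π x = c • x := by
  obtain ⟨c, hc⟩ := exists_pi_coefficient π hn
  exact ⟨c, fun x hx => piProj_eq hM (hc x hx).1 (hc x hx).2⟩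

lemma exists_piProj_apply_eq_smul (π : Set ℕ) (x : M) : ∃ c : ℤ, piProj hM π x = c • x := by
  obtain ⟨n, hn, hx⟩ := hM x
  obtain ⟨c, hc⟩ := exists_piProj_eq_smul hM π hn
  exact ⟨c, hc x hx⟩

/-- On the elements killed by a given `n` the projection is multiplication by one integer, so it is
central in the endomorphism ring. -/
lemma piProj_comm (π : Set ℕ) (u : AddMonoid.End M) : Commute (piProj hM π) u := by
  ext x
  obtain ⟨n, hn, hx⟩ := hM x
  obtain ⟨c, hc⟩ := exists_piProj_eq_smul hM π hn
  change piProj hM π (u x) = u (piProj hM π x)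
  rw [hc x hx, hc (u x) (by rw [← map_nsmul, hx, map_zero]), map_zsmul]

lemma piProj_mul_of_subset (h : π ⊆ ρ) : piProj hM π * piProj hM ρ = piProj hM π := by
  ext x
  change piProj hM π (piProj hM ρ x) = _
  have := piProj_of_compl hM (π := π)
    ((piTorsion_sub_piProj hM ρ x).mono (Set.compl_subset_compl.2 h))
  rw [map_sub, sub_eq_zero] at this
  exact this.symm

lemma piProj_mul_self (π : Set ℕ) : piProj hM π * piProj hM π = piProj hM π :=
  piProj_mul_of_subset hM subset_rfl

lemma piProj_mul_of_disjoint (h : Disjoint π ρ) : piProj hM π * piProj hM ρ = 0 := by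
  ext x
  exact piProj_of_compl hM ((piTorsion_piProj hM ρ x).mono h.symm.subset_compl_right)

lemma piProj_empty : piProj hM ∅ = 0 := by
  ext x
  exact (piTorsion_piProj hM ∅ x).eq_zero

lemma piProj_insert {p : ℕ} (h : p ∉ π) :
    piProj hM (insert p π) = piProj hM {p} + piProj hM π := by
  ext x
  refine piProj_eq hM ?_ ?_
  · exact (piSubgroup M (insert p π)).add_mem ((piTorsion_piProj hM {p} x).mono (by simp))
      ((piTorsion_piProj hM π x).mono (by simp))
  · have h1 : PiTorsion {p}ᶜ (x - (piProj hM {p} + piProj hM π) x) := by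
      have := (piSubgroup M {p}ᶜ).sub_mem (piTorsion_sub_piProj hM {p} x)
        ((piTorsion_piProj hM π x).mono (ρ := {p}ᶜ) (by simpa using h))
      rwa [sub_sub] at this
    have h2 : PiTorsion πᶜ (x - (piProj hM {p} + piProj hM π) x) := by
      have := (piSubgroup M πᶜ).sub_mem (piTorsion_sub_piProj hM π x)
        ((piTorsion_piProj hM {p} x).mono (ρ := πᶜ) (by simpa using h))
      rwa [sub_sub, add_comm] at this
    exact (h1.inter h2).mono (by rw [← Set.compl_union, Set.singleton_union])

end PiTorsion

/-! ### Endomorphisms with finite image. -/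

section FiniteRange

variable {M : Type*} [AddCommGroup M]

/-- The endomorphism `f` has finite image. -/
def FiniteRange (f : AddMonoid.End M) : Prop :=
  (Set.range f).Finite

lemma FiniteRange.mul_left {f : AddMonoid.End M} (h : FiniteRange f) (g : AddMonoid.End M) :
    FiniteRange (g * f) := by
  refine (h.image g).subset ?_
  rintro _ ⟨x, rfl⟩
  exact ⟨f x, ⟨x, rfl⟩, rfl⟩

lemma FiniteRange.mul_right {f : AddMonoid.End M} (h : FiniteRange f) (g : AddMonoid.End M) :
    FiniteRange (f * g) := by
  refine h.subset ?_
  rintro _ ⟨x, rfl⟩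
  exact ⟨g x, rfl⟩

lemma FiniteRange.exists_nsmul {f : AddMonoid.End M} (h : FiniteRange f) :
    ∃ n : ℕ, n ≠ 0 ∧ ∀ x, n • f x = 0 := by
  have hfin : Finite (AddMonoidHom.range (f : M →+ M)) := h.to_subtype
  refine ⟨Nat.card (AddMonoidHom.range (f : M →+ M)), Nat.card_pos.ne', fun x => ?_⟩
  have := card_nsmul_eq_zero' (x := (⟨f x, x, rfl⟩ : AddMonoidHom.range (f : M →+ M)))
  exact congrArg Subtype.val this

end FiniteRange

/-! ### Translation from automorphisms to the endomorphism ring. -/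

section ToEnd

variable {A : Type*} [CommGroup A]

variable (A) in
/-- The embedding of the automorphism group into the endomorphism ring. -/
def toEnd : MulAut A →* AddMonoid.End (Additive A) where
  toFun γ := MonoidHom.toAdditive γ.toMonoidHom
  map_one' := rfl
  map_mul' _ _ := rfl

lemma toEnd_injective : Function.Injective (toEnd A) := by
  intro γ δ h
  ext x
  exact congrArg Additive.toMul (DFunLike.congr_fun h (Additive.ofMul x))

lemma toEnd_mul_inv (γ : MulAut A) : toEnd A γ * toEnd A γ⁻¹ = 1 := by
  rw [← map_mul, mul_inv_cancel, map_one]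

lemma toEnd_inv_mul (γ : MulAut A) : toEnd A γ⁻¹ * toEnd A γ = 1 := by
  rw [← map_mul, inv_mul_cancel, map_one]

lemma exists_mulAut {u v : AddMonoid.End (Additive A)} (huv : u * v = 1) (hvu : v * u = 1) :
    ∃ γ : MulAut A, toEnd A γ = u ∧ toEnd A γ⁻¹ = v := by
  let γ : MulAut A :=
    { toFun := fun x => (u (Additive.ofMul x)).toMul
      invFun := fun x => (v (Additive.ofMul x)).toMul
      left_inv := fun x => DFunLike.congr_fun hvu (Additive.ofMul x)
      right_inv := fun x => DFunLike.congr_fun huv (Additive.ofMul x)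
      map_mul' := fun x y => map_add u (Additive.ofMul x) (Additive.ofMul y) }
  exact ⟨γ, rfl, rfl⟩

/-- Commutativity is a hypothesis and not an instance, so that the lemma also applies to the
subgroup `sigmaGroup`. -/
lemma inertial_of_finite {G : Type*} [Group G] (hG : ∀ x y : G, x * y = y * x) {γ : MulAut G}
    (h : ∀ H : Subgroup G, ∃ S : Set G, S.Finite ∧ ∀ x ∈ H, ∃ s ∈ S, s⁻¹ * γ x ∈ H) :
    IsInertial γ := by
  intro H
  have hN : H.Normal := ⟨fun x hx g => by rwa [hG g x, mul_inv_cancel_right]⟩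
  obtain ⟨S, hS, h⟩ := h H
  rw [Subgroup.isFiniteRelIndex_iff_finiteIndex]
  have := hS.to_subtype
  have key : ∀ y : (H ⊔ H.map γ.toMonoidHom : Subgroup G), ∃ s : S, (s : G)⁻¹ * y ∈ H := by
    rintro ⟨y, hy⟩
    rw [← SetLike.mem_coe, Subgroup.normal_mul] at hy
    obtain ⟨a, ha, _, ⟨b, hb, rfl⟩, rfl⟩ := hy
    obtain ⟨s, hs, hbs⟩ := h b hb
    refine ⟨⟨s, hs⟩, ?_⟩
    change s⁻¹ * (a * γ b) ∈ H
    rw [hG a, ← mul_assoc]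
    exact H.mul_mem hbs ha
  choose f hf using key
  have hfin : Finite ((H ⊔ H.map γ.toMonoidHom : Subgroup G) ⧸
      H.subgroupOf (H ⊔ H.map γ.toMonoidHom)) := by
    refine Finite.of_injective (fun x => f x.out) fun x y hxy => ?_
    rw [← QuotientGroup.out_eq' x, ← QuotientGroup.out_eq' y, QuotientGroup.eq]
    have h1 := hf x.out
    have h2 := hf y.out
    simp only at hxy
    rw [hxy] at h1
    rw [Subgroup.mem_subgroupOf]
    have := H.mul_mem (H.inv_mem h1) h2
    rw [mul_inv_rev, inv_inv, mul_assoc, mul_inv_cancel_left] at this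
    exact this
  exact Subgroup.finiteIndex_of_finite_quotient

lemma addInertial_toEnd {γ : MulAut A} (h : IsInertial γ) : AddInertial (toEnd A γ) := by
  intro H
  have := h H.toSubgroup'
  rw [Subgroup.isFiniteRelIndex_iff_finiteIndex] at this
  set H' : Subgroup A := H.toSubgroup'
  set K := H' ⊔ H'.map γ.toMonoidHom
  have hmem : ∀ x ∈ H, γ x.toMul ∈ K := fun x hx => Subgroup.mem_sup_right ⟨x.toMul, hx, rfl⟩
  have hfin : Finite (K ⧸ H'.subgroupOf K) := inferInstance
  refine FinMod.of_classes (ι := K ⧸ H'.subgroupOf K) (T := Set.univ) Set.finite_univ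
    (fun y t => ∃ hy : y.toMul ∈ K, QuotientGroup.mk (s := H'.subgroupOf K) ⟨y.toMul, hy⟩ = t) ?_ ?_
  · rintro _ ⟨x, hx, rfl⟩
    exact ⟨_, trivial, hmem x hx, rfl⟩
  · rintro x _ y _ t ⟨hx, hxt⟩ ⟨hy, hyt⟩
    rw [← hyt, eq_comm, QuotientGroup.eq, Subgroup.mem_subgroupOf] at hxt
    have h3 : -y + x ∈ H := hxt
    rwa [neg_add_eq_sub] at h3

lemma inertial_of_finMod {γ : MulAut A}
    (h : ∀ H : AddSubgroup (Additive A), FinMod ((toEnd A γ) '' H) H) : IsInertial γ := by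
  refine inertial_of_finite mul_comm fun H => ?_
  obtain ⟨S, hS, h⟩ := h H.toAddSubgroup
  refine ⟨Additive.ofMul ⁻¹' S, hS.preimage Additive.ofMul.injective.injOn, fun x hx => ?_⟩
  obtain ⟨s, hs, hxs⟩ := h _ ⟨Additive.ofMul x, hx, rfl⟩
  refine ⟨s.toMul, hs, ?_⟩
  have h3 : -s + toEnd A γ (Additive.ofMul x) ∈ H.toAddSubgroup := by rwa [neg_add_eq_sub]
  exact h3

lemma isFinitary_iff {γ : MulAut A} :
    IsFinitary γ ↔ FiniteRange (toEnd A γ - 1) := by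
  have hker : ∀ x : A, x ∈ (AddMonoidHom.ker (toEnd A γ - 1 : AddMonoid.End (Additive A))).toSubgroup' ↔ γ x = x := by
    intro x
    change toEnd A γ (Additive.ofMul x) - Additive.ofMul x = 0 ↔ _
    rw [sub_eq_zero]
    exact Iff.rfl
  constructor
  · rintro ⟨H, hH, h⟩
    refine finMod_bot.1 ?_
    rw [← Set.image_univ]
    refine FinMod.image (C := H.toAddSubgroup) ?_ _ fun x hx => ?_
    · have : Finite (A ⧸ H) := inferInstance
      refine FinMod.of_classes (ι := A ⧸ H) (T := Set.univ) Set.finite_univ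
        (fun y t => QuotientGroup.mk (s := H) y.toMul = t) (fun x _ => ⟨_, trivial, rfl⟩) ?_
      rintro x _ y _ t rfl hy
      rw [QuotientGroup.eq] at hy
      have h3 : -y + x ∈ H.toAddSubgroup := hy
      rwa [neg_add_eq_sub] at h3
    · rw [AddSubgroup.mem_bot]
      change toEnd A γ x - x = 0
      rw [sub_eq_zero]
      exact h x.toMul hx
  · intro h
    refine ⟨(AddMonoidHom.ker (toEnd A γ - 1 : AddMonoid.End (Additive A))).toSubgroup', ?_, fun x hx => (hker x).1 hx⟩
    have := h.to_subtype
    have hfin : Finite (A ⧸ (AddMonoidHom.ker (toEnd A γ - 1 : AddMonoid.End (Additive A))).toSubgroup') := by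
      refine Finite.of_injective (β := Set.range (toEnd A γ - 1 : AddMonoid.End (Additive A)))
        (fun x => ⟨_, Additive.ofMul x.out, rfl⟩) fun x y hxy => ?_
      have hxy : (toEnd A γ - 1) (Additive.ofMul x.out) = (toEnd A γ - 1) (Additive.ofMul y.out) :=
        congrArg Subtype.val hxy
      rw [← QuotientGroup.out_eq' x, ← QuotientGroup.out_eq' y, QuotientGroup.eq]
      change (toEnd A γ - 1) (-Additive.ofMul x.out + Additive.ofMul y.out) = 0
      rw [map_add, map_neg, hxy, neg_add_cancel]
    exact Subgroup.finiteIndex_of_finite_quotient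

lemma isPowerAut_of_forall {γ : MulAut A} (hγ : ∀ x, ∃ j : ℤ, toEnd A γ x = j • x)
    (hγ' : ∀ x, ∃ j : ℤ, toEnd A γ⁻¹ x = j • x) : IsPowerAut γ := by
  intro H
  apply le_antisymm
  · rintro _ ⟨x, hx, rfl⟩
    obtain ⟨j, hj⟩ := hγ (Additive.ofMul x)
    have : γ x = x ^ j := hj
    change γ x ∈ H
    rw [this]
    exact H.zpow_mem hx j
  · intro x hx
    obtain ⟨j, hj⟩ := hγ' (Additive.ofMul x)
    have : γ⁻¹ x = x ^ j := hj
    refine ⟨x ^ j, H.zpow_mem hx j, ?_⟩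
    rw [← this]
    exact MulAut.apply_inv_self _ γ x

/-- On a torsion group, a pointwise multiplication has a pointwise multiplication as inverse. -/
lemma exists_smul_inverse {M : Type*} [AddCommGroup M] (hM : ∀ x : M, ∃ n : ℕ, n ≠ 0 ∧ n • x = 0)
    {u v : AddMonoid.End M} (hvu : v * u = 1) (hu : ∀ x, ∃ j : ℤ, u x = j • x) (x : M) :
    ∃ j : ℤ, v x = j • x := by
  have hvu' : ∀ y, v (u y) = y := fun y => DFunLike.congr_fun hvu y
  let Z := AddSubgroup.zmultiples x
  have hfin : Finite Z := (finite_zmultiples_of_torsion (fun x => by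
    obtain ⟨n, hn, hx⟩ := hM x
    exact ⟨n, by exact_mod_cast hn, by rwa [natCast_zsmul]⟩) x).to_subtype
  have hmaps : ∀ z : Z, u z ∈ Z := fun z => by
    obtain ⟨j, hj⟩ := hu z
    rw [hj]
    exact Z.zsmul_mem z.2 j
  have hinj : Function.Injective fun z : Z => (⟨u z, hmaps z⟩ : Z) := by
    intro a b hab
    have : u a = u b := congrArg Subtype.val hab
    rw [Subtype.ext_iff, ← hvu' a, this, hvu']
  obtain ⟨z, hz⟩ := Finite.surjective_of_injective hinj ⟨x, AddSubgroup.mem_zmultiples x⟩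
  have hz : u z = x := congrArg Subtype.val hz
  obtain ⟨j, hj⟩ := AddSubgroup.mem_zmultiples_iff.1 z.2
  exact ⟨j, by rw [hj, ← hvu' z, hz]⟩

variable (A) in
instance FAut_normal : (FAut A).Normal := by
  refine ⟨fun φ hφ g => ?_⟩
  change IsFinitary _ at hφ
  change IsFinitary _
  rw [isFinitary_iff] at hφ ⊢
  refine (Set.Finite.image (toEnd A g) hφ).subset ?_
  rintro _ ⟨x, rfl⟩
  refine ⟨_, ⟨toEnd A g⁻¹ x, rfl⟩, ?_⟩
  have h1 : toEnd A g (toEnd A g⁻¹ x) = x := DFunLike.congr_fun (toEnd_mul_inv g) x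
  change toEnd A g (toEnd A φ (toEnd A g⁻¹ x) - toEnd A g⁻¹ x) = toEnd A (g * φ * g⁻¹) x - x
  rw [map_sub, h1, map_mul, map_mul]
  rfl

variable (A) in
instance PAut_normal : (PAut A).Normal := by
  refine ⟨fun φ hφ g => ?_⟩
  intro H
  have h := hφ (H.map (g⁻¹ : MulAut A).toMonoidHom)
  have h2 := congrArg (Subgroup.map g.toMonoidHom) h
  have h3 : (H.map (g⁻¹ : MulAut A).toMonoidHom).map g.toMonoidHom = H := by
    rw [Subgroup.map_map]
    convert H.map_id
    ext x
    exact MulAut.apply_inv_self _ g x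
  rw [h3, Subgroup.map_map, Subgroup.map_map] at h2
  exact h2

lemma FAut_le_IAut : FAut A ≤ IAut A := by
  intro φ hφ
  refine Subgroup.subset_closure (inertial_of_finMod fun H => ?_)
  refine ⟨Set.range (toEnd A φ - 1 : AddMonoid.End (Additive A)), isFinitary_iff.1 hφ, ?_⟩
  rintro _ ⟨x, hx, rfl⟩
  refine ⟨_, ⟨x, rfl⟩, ?_⟩
  change toEnd A φ x - (toEnd A φ x - x) ∈ H
  rwa [sub_sub_cancel]

lemma PAut_le_IAut : PAut A ≤ IAut A := by
  intro φ hφ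
  refine Subgroup.subset_closure (inertial_of_finMod fun H => ?_)
  refine ⟨{0}, Set.finite_singleton 0, ?_⟩
  rintro _ ⟨x, hx, rfl⟩
  refine ⟨0, rfl, ?_⟩
  have h := hφ H.toSubgroup'
  have h2 : φ x.toMul ∈ H.toSubgroup' := by
    rw [← h]
    exact ⟨x.toMul, hx, rfl⟩
  rw [sub_zero]
  exact h2

end ToEnd

/-! ### The divisible part of the critical components. -/

section DivisiblePart

variable {M : Type*} [AddCommGroup M]

variable (M) in
/-- The `p`-component of `M` is the direct sum of a bounded group and of a nonzero divisible group
of finite rank, the latter being the image of the multiplication by `p ^ e`. -/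
def IsCritical (p e : ℕ) : Prop :=
  (∀ x : M, PiTorsion {p} x → ∃ y : M, PiTorsion {p} y ∧ (p : ℤ) ^ e • x = (p : ℤ) ^ (e + 1) • y) ∧
  (∃ x : M, PiTorsion {p} x ∧ (p : ℤ) ^ e • x ≠ 0) ∧
  {x : M | (p : ℤ) • x = 0 ∧ ∃ y, PiTorsion {p} y ∧ (p : ℤ) ^ e • y = x}.Finite

/-- The idempotent `r` projects `M` onto the sum of the divisible parts of the `p`-components of
`M`, for `p` in the set `T` of the primes for which the `p`-component is critical. -/
structure IsDivisiblePart (hM : ∀ x : M, ∃ n : ℕ, n ≠ 0 ∧ n • x = 0) (T : Set ℕ)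
    (r : AddMonoid.End M) : Prop where
  prime : ∀ p ∈ T, p.Prime
  idem : ∀ x, r (r x) = r x
  div : ∀ n : ℤ, n ≠ 0 → ∀ x, ∃ y, n • r y = r x
  piTorsion : ∀ x, PiTorsion T (r x)
  bounded : ∀ p ∈ T, ∃ e : ℕ, ∀ x, PiTorsion {p} x → (p : ℤ) ^ e • (x - r x) = 0
  finite : ∀ n : ℕ, n ≠ 0 → {x | r x = x ∧ n • x = 0}.Finite
  socle : ∀ p ∈ T, ∃ x, r x = x ∧ x ≠ 0 ∧ p • x = 0
  critical : ∀ p e : ℕ, p.Prime → IsCritical M p e →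
    p ∈ T ∧ ∀ x, PiTorsion {p} x → r ((p : ℤ) ^ e • x) = (p : ℤ) ^ e • x

/-- `T` is the set of critical primes and `r` a retraction onto the largest divisible `T`-torsion
subgroup `D`, which contains `p ^ e A_p` for every critical `p`. -/
lemma exists_isDivisiblePart (hM : ∀ x : M, ∃ n : ℕ, n ≠ 0 ∧ n • x = 0) :
    ∃ (T : Set ℕ) (r : AddMonoid.End M), IsDivisiblePart hM T r := by
  let T : Set ℕ := {p | p.Prime ∧ ∃ e, IsCritical M p e}
  let D : AddSubgroup M := sSup {D | IsDivBy {0}ᶜ D ∧ D ≤ piSubgroup M T}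
  have hD : IsDivBy {0}ᶜ D := isDivBy_sSup _ _ fun D h => h.1
  have hDT : D ≤ piSubgroup M T := sSup_le fun D h => h.2
  obtain ⟨r, hrD, hr⟩ : ∃ r : AddMonoid.End M, (∀ x, r x ∈ D) ∧ ∀ d ∈ D, r d = d :=
    exists_retraction hD
  have hiff : ∀ x, r x = x ↔ x ∈ D := fun x => ⟨fun h => h ▸ hrD x, hr x⟩
  have hcrit : ∀ p e : ℕ, p.Prime → IsCritical M p e →
      ∀ x, PiTorsion {p} x → (p : ℤ) ^ e • x ∈ D := by
    intro p e hp hc x hx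
    let Dp := (piSubgroup M {p}).map (zsmulAddGroupHom (α := M) ((p : ℤ) ^ e))
    have hDp : Dp ≤ piSubgroup M {p} := by
      rintro _ ⟨x, hx, rfl⟩
      exact (piSubgroup M {p}).zsmul_mem hx _
    have hmem : Dp ≤ D := by
      refine le_sSup ⟨IsDivBy.of_prime (Nat.prime_iff_prime_int.1 hp)
        (fun x hx => (piTorsion_singleton hp).1 (hDp hx)) (isDivBy_singleton.2 ?_),
        fun x hx => PiTorsion.mono (hDp hx) (Set.singleton_subset_iff.2 ⟨hp, e, hc⟩)⟩
      rintro _ ⟨x, hx, rfl⟩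
      obtain ⟨y, hy, hxy⟩ := hc.1 x hx
      refine ⟨_, ⟨y, hy, rfl⟩, ?_⟩
      change (p : ℤ) • (p : ℤ) ^ e • y = (p : ℤ) ^ e • x
      rw [hxy, smul_smul, ← pow_succ']
    exact hmem ⟨x, hx, rfl⟩
  refine ⟨T, r, fun p h => h.1, fun x => hr _ (hrD x), ?_, fun x => hDT (hrD x), ?_, ?_, ?_, ?_⟩
  · intro n hn x
    obtain ⟨y, hy, hyx⟩ := hD n hn _ (hrD x)
    exact ⟨y, by rw [hr y hy, hyx]⟩
  · rintro p ⟨hp, e, hc⟩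
    refine ⟨e, fun x hx => ?_⟩
    rw [smul_sub, ← map_zsmul, hr _ (hcrit p e hp hc x hx), sub_self]
  · intro n
    induction n using Nat.recOnMul with
    | zero => intro h; exact absurd rfl h
    | one =>
      intro _
      refine (Set.finite_singleton (0 : M)).subset ?_
      rintro x ⟨-, hx⟩
      simpa using hx
    | prime p hp =>
      intro _
      have hp1 : ∀ x : M, p • x = 0 → PiTorsion {p} x := fun x hx =>
        (piTorsion_singleton hp).2 ⟨1, by rwa [pow_one, natCast_zsmul]⟩
      by_cases hpT : p ∈ T
      · obtain ⟨-, e, hc⟩ := hpT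
        refine hc.2.2.subset ?_
        rintro x ⟨hx, hpx⟩
        refine ⟨by rwa [natCast_zsmul], ?_⟩
        obtain ⟨d, -, rfl⟩ := hD ((p : ℤ) ^ e)
          (pow_ne_zero _ (by exact_mod_cast hp.ne_zero)) x ((hiff x).1 hx)
        refine ⟨piProj hM {p} d, piTorsion_piProj hM _ d, ?_⟩
        rw [← map_zsmul, piProj_of_piTorsion hM (hp1 _ hpx)]
      · refine (Set.finite_singleton (0 : M)).subset ?_
        rintro x ⟨hx, hpx⟩
        have h1 : PiTorsion T x := hDT ((hiff x).1 hx)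
        exact ((h1.inter (hp1 x hpx)).mono (ρ := ∅) (by
          rintro q ⟨hq, rfl⟩
          exact hpT hq)).eq_zero
    | mul m n ihm ihn =>
      intro hmn
      have hm := ihm (left_ne_zero_of_mul hmn)
      have hn := ihn (right_ne_zero_of_mul hmn)
      have h1 : FinMod {x | r x = x ∧ (m * n) • x = 0} (D ⊓ (nsmulAddMonoidHom (α := M) m).ker) := by
        refine FinMod.of_image (f := nsmulAddMonoidHom (α := M) m) (D := ⊥)
          (finMod_bot.2 (hn.subset ?_)) ?_
        · rintro _ ⟨x, ⟨hx, hx'⟩, rfl⟩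
          refine ⟨?_, ?_⟩
          · change r (m • x) = m • x
            rw [map_nsmul, hx]
          · change n • m • x = 0
            rwa [smul_smul, mul_comm]
        · intro x hx y hy hxy
          exact ⟨D.sub_mem ((hiff x).1 hx.1) ((hiff y).1 hy.1), hxy⟩
      refine finMod_bot.1 (h1.trans (finMod_bot.2 (hm.subset ?_)))
      rintro x ⟨hx, hx'⟩
      exact ⟨hr x hx, hx'⟩
  · rintro p ⟨hp, e, hc⟩
    obtain ⟨x, hx, hx0⟩ := hc.2.1
    obtain ⟨N, hN⟩ := (piTorsion_singleton hp).1 ((piSubgroup M {p}).zsmul_mem hx ((p : ℤ) ^ e))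
    have hmem := hcrit p e hp hc x hx
    classical
    have hex : ∃ N : ℕ, (p : ℤ) ^ N • (p : ℤ) ^ e • x = 0 := ⟨N, hN⟩
    obtain ⟨hf, hmin⟩ := (Nat.find_eq_iff hex).1 rfl
    rcases h : Nat.find hex with _ | f
    · rw [h, pow_zero, one_smul] at hf
      exact absurd hf hx0
    · refine ⟨(p : ℤ) ^ f • (p : ℤ) ^ e • x, hr _ (D.zsmul_mem hmem _), hmin f (by omega), ?_⟩
      rw [h, pow_succ', mul_smul] at hf
      rwa [← natCast_zsmul]
  · intro p e hp hc
    exact ⟨⟨hp, e, hc⟩, fun x hx => hr _ (hcrit p e hp hc x hx)⟩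

variable {hM : ∀ x : M, ∃ n : ℕ, n ≠ 0 ∧ n • x = 0} {T : Set ℕ} {r : AddMonoid.End M}

namespace IsDivisiblePart

lemma mul_self (h : IsDivisiblePart hM T r) : r * r = r := by
  ext x
  exact h.idem x

lemma piProj_mul (h : IsDivisiblePart hM T r) : piProj hM T * r = r := by
  ext x
  exact piProj_of_piTorsion hM (h.piTorsion x)

lemma eq_empty (h : IsDivisiblePart hM T r)
    (hred : ∀ D : AddSubgroup M, IsDivBy {0}ᶜ D → D = ⊥) : T = ∅ := by
  rw [Set.eq_empty_iff_forall_notMem]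
  intro p hp
  obtain ⟨x, hx, hx0, -⟩ := h.socle p hp
  have := hred (AddMonoidHom.range r) (by
    rintro n hn _ ⟨x, rfl⟩
    obtain ⟨y, hy⟩ := h.div n hn x
    exact ⟨r y, ⟨y, rfl⟩, hy⟩)
  have hxr : x ∈ AddMonoidHom.range r := ⟨x, hx⟩
  rw [this] at hxr
  exact hx0 (by simpa using hxr)

/-- A finite image has bounded exponent, while the image of `r` is divisible. This is why finitary
automorphisms fix the divisible part pointwise. -/
lemma mul_eq_of_finiteRange (h : IsDivisiblePart hM T r) {f : AddMonoid.End M}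
    (hf : FiniteRange f) : f * r = 0 := by
  obtain ⟨n, hn, hnf⟩ := hf.exists_nsmul
  ext x
  obtain ⟨y, hy⟩ := h.div n (by exact_mod_cast hn) x
  change f (r x) = 0
  rw [← hy, map_zsmul, natCast_zsmul, hnf]

end IsDivisiblePart

/-- The projection of `M` to a bounded complement of the divisible part of its `p`-component. -/
noncomputable def boundedProj (hM : ∀ x : M, ∃ n : ℕ, n ≠ 0 ∧ n • x = 0) (r : AddMonoid.End M)
    (p : ℕ) : AddMonoid.End M :=
  (1 - r) * piProj hM {p}

lemma boundedProj_apply (p : ℕ) (x : M) :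
    boundedProj hM r p x = piProj hM {p} x - r (piProj hM {p} x) := rfl

lemma boundedProj_mul_self (h : IsDivisiblePart hM T r) (p : ℕ) :
    boundedProj hM r p * boundedProj hM r p = boundedProj hM r p := by
  have h1 := (piProj_comm hM {p} (1 - r)).eq
  have h2 : (1 - r) * (1 - r) = 1 - r := by
    rw [sub_mul, mul_sub, mul_sub, one_mul, one_mul, mul_one, h.mul_self]; simp
  unfold boundedProj
  rw [mul_assoc, ← mul_assoc (piProj hM {p}), h1, ← mul_assoc, ← mul_assoc, h2, mul_assoc,
    piProj_mul_self]

lemma mul_boundedProj (h : IsDivisiblePart hM T r) (p : ℕ) : r * boundedProj hM r p = 0 := by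
  rw [boundedProj, ← mul_assoc, mul_sub, mul_one, h.mul_self, sub_self, zero_mul]

lemma boundedProj_mul (h : IsDivisiblePart hM T r) (p : ℕ) : boundedProj hM r p * r = 0 := by
  rw [boundedProj, mul_assoc, (piProj_comm hM {p} r).eq, ← mul_assoc, sub_mul, one_mul,
    h.mul_self, sub_self, zero_mul]

lemma boundedProj_mul_of_ne (p q : ℕ) (hpq : p ≠ q) :
    boundedProj hM r p * boundedProj hM r q = 0 := by
  unfold boundedProj
  rw [mul_assoc, (piProj_comm hM {p} _).eq, mul_assoc (1 - r) (piProj hM {q}),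
    piProj_mul_of_disjoint hM (Set.disjoint_singleton.2 hpq.symm), mul_zero, mul_zero]

lemma exists_pow_smul_boundedProj (h : IsDivisiblePart hM T r) {p : ℕ} (hp : p ∈ T) :
    ∃ e : ℕ, ∀ x, (p : ℤ) ^ e • boundedProj hM r p x = 0 := by
  obtain ⟨e, he⟩ := h.bounded p hp
  exact ⟨e, fun x => he _ (piTorsion_piProj hM {p} x)⟩

end DivisiblePart

/-! ### Factorization at a single prime. -/

section Components

variable {M : Type*} [AddCommGroup M] (hM : ∀ x : M, ∃ n : ℕ, n ≠ 0 ∧ n • x = 0)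

/-- Extend an endomorphism of the `π`-part by the identity on the `π'`-part. -/
noncomputable def extendByOne (π : Set ℕ) (f : piSubgroup M π →+ piSubgroup M π) :
    AddMonoid.End M :=
  (show AddMonoid.End M from (piSubgroup M π).subtype.comp (f.comp
    (AddMonoidHom.codRestrict (piProj hM π : M →+ M) (piSubgroup M π) (piTorsion_piProj hM π)))) +
    (1 - piProj hM π)

lemma extendByOne_apply (π : Set ℕ) (f : piSubgroup M π →+ piSubgroup M π) (x : M) :
    extendByOne hM π f x = f ⟨piProj hM π x, piTorsion_piProj hM π x⟩ + (x - piProj hM π x) := rfl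

lemma extendByOne_of_mem {π : Set ℕ} (f : piSubgroup M π →+ piSubgroup M π) {x : M}
    (hx : PiTorsion π x) : extendByOne hM π f x = f ⟨x, hx⟩ := by
  have h := piProj_of_piTorsion hM hx
  rw [extendByOne_apply]
  simp only [h, sub_self, add_zero]

lemma extendByOne_of_compl {π : Set ℕ} (f : piSubgroup M π →+ piSubgroup M π) {x : M}
    (hx : PiTorsion πᶜ x) : extendByOne hM π f x = x := by
  have h := piProj_of_compl hM hx
  rw [extendByOne_apply]
  simp only [h, sub_zero]
  have : (⟨0, (piSubgroup M π).zero_mem⟩ : piSubgroup M π) = 0 := rfl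
  rw [this, map_zero]
  simp

lemma extendByOne_mul {π : Set ℕ} {f g : piSubgroup M π →+ piSubgroup M π}
    (h : ∀ x, f (g x) = x) : extendByOne hM π f * extendByOne hM π g = 1 := by
  ext x
  change extendByOne hM π f (extendByOne hM π g x) = x
  obtain ⟨y, z, hy, hz, rfl⟩ : ∃ y z, PiTorsion π y ∧ PiTorsion πᶜ z ∧ x = y + z :=
    ⟨_, _, piTorsion_piProj hM π x, piTorsion_sub_piProj hM π x, by simp⟩
  rw [map_add, map_add, extendByOne_of_mem hM g hy, extendByOne_of_compl hM g hz,
    extendByOne_of_mem hM f (g ⟨y, hy⟩).2, extendByOne_of_compl hM f hz]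
  rw [Subtype.coe_eta, h]

lemma extendByOne_smul {π : Set ℕ} {f : piSubgroup M π →+ piSubgroup M π}
    (h : ∀ x, ∃ j : ℤ, f x = j • x) (x : M) : ∃ j : ℤ, extendByOne hM π f x = j • x := by
  obtain ⟨c, hc⟩ := exists_piProj_apply_eq_smul hM π x
  obtain ⟨j, hj⟩ := h ⟨piProj hM π x, piTorsion_piProj hM π x⟩
  refine ⟨j * c + (1 - c), ?_⟩
  rw [extendByOne_apply, hj]
  change j • piProj hM π x + _ = _
  rw [hc, add_smul, sub_smul, one_smul, mul_smul]

variable {T : Set ℕ} {r : AddMonoid.End M}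

/-- The restriction of an inertial automorphism to a primary component is, up to a pointwise
multiplication and the multiplication by an integer on the bounded part, finitary. -/
lemma exists_local_factor (h : IsDivisiblePart hM T r) {u : AddMonoid.End M}
    (hinj : Function.Injective u) (hu : AddInertial u) {p : ℕ} (hp : p.Prime) :
    ∃ μ ν : AddMonoid.End M, μ * ν = 1 ∧ ν * μ = 1 ∧ (∀ x, ∃ j : ℤ, μ x = j • x) ∧
      ∃ k : ℤ, (k = 1 ∨ p ∈ T ∧ ¬ (p : ℤ) ∣ k) ∧
        FiniteRange ((u * piProj hM {p} + (1 - piProj hM {p})) -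
          (1 + (k - 1) • boundedProj hM r p) * μ) := by
  have hq := Nat.prime_iff_prime_int.1 hp
  let N := piSubgroup M {p}
  let γ : N →+ N := AddMonoidHom.codRestrict ((u : M →+ M).comp N.subtype) N
    fun x => PiTorsion.map x.2 u
  have hN : ∀ x : N, ∃ k : ℕ, (p : ℤ) ^ k • x = 0 := fun x => by
    obtain ⟨k, hk⟩ := (piTorsion_singleton hp).1 x.2
    exact ⟨k, Subtype.ext hk⟩
  have hγi : AddInertial γ := by
    intro H
    refine FinMod.of_image (f := N.subtype) (D := H.map N.subtype) ?_ ?_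
    · refine (hu (H.map N.subtype)).mono ?_ le_rfl
      rintro _ ⟨_, ⟨x, hx, rfl⟩, rfl⟩
      exact ⟨_, ⟨x, hx, rfl⟩, rfl⟩
    · rintro x - y - ⟨z, hz, hzxy⟩
      rwa [← N.subtype_injective hzxy]
  obtain ⟨μ₀, hμ₀, hcases⟩ := hγi.structure hq hN fun x y hxy =>
    Subtype.ext (hinj (congrArg Subtype.val hxy))
  let μ := extendByOne hM {p} (μ₀ : N →+ N)
  let ν := extendByOne hM {p} (μ₀.symm : N →+ N)
  have hμN : ∀ x (hx : x ∈ N), μ x = μ₀ ⟨x, hx⟩ := fun x hx => extendByOne_of_mem hM _ hx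
  have hμc : ∀ x, PiTorsion {p}ᶜ x → μ x = x := fun x hx => extendByOne_of_compl hM _ hx
  have hμj : ∀ x, ∃ j : ℤ, μ x = j • x := extendByOne_smul hM hμ₀
  refine ⟨μ, ν, extendByOne_mul hM fun x => μ₀.apply_symm_apply x,
    extendByOne_mul hM fun x => μ₀.symm_apply_apply x, hμj, ?_⟩
  have key : ∀ (k : ℤ) (x : M), ((u * piProj hM {p} + (1 - piProj hM {p})) -
      (1 + (k - 1) • boundedProj hM r p) * μ) x = u (piProj hM {p} x) - μ (piProj hM {p} x) -
        (k - 1) • (μ (piProj hM {p} x) - r (μ (piProj hM {p} x))) := by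
    intro k x
    obtain ⟨y, z, hy, hz, rfl⟩ : ∃ y z, PiTorsion {p} y ∧ PiTorsion {p}ᶜ z ∧ x = y + z :=
      ⟨_, _, piTorsion_piProj hM {p} x, piTorsion_sub_piProj hM {p} x, by simp⟩
    change u (piProj hM {p} (y + z)) + (y + z - piProj hM {p} (y + z)) - (μ (y + z) + (k - 1) •
      (piProj hM {p} (μ (y + z)) - r (piProj hM {p} (μ (y + z))))) = _
    have hμy : PiTorsion {p} (μ y) := hy.map μ
    have h1 : piProj hM {p} (y + z) = y := by
      rw [map_add, piProj_of_piTorsion hM hy, piProj_of_compl hM hz, add_zero]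
    have h2 : piProj hM {p} (μ (y + z)) = μ y := by
      rw [map_add, map_add, piProj_of_piTorsion hM hμy, hμc z hz, piProj_of_compl hM hz, add_zero]
    rw [h1, h2, map_add, hμc z hz]
    abel
  rcases hcases with hfin | ⟨e, he1, ⟨x₀, hx₀⟩, he3, he4, k, hk, hkfin⟩
  · refine ⟨1, Or.inl rfl, (hfin.image N.subtype).subset ?_⟩
    rintro _ ⟨x, rfl⟩
    refine ⟨_, ⟨⟨piProj hM {p} x, piTorsion_piProj hM {p} x⟩, rfl⟩, ?_⟩
    rw [key, sub_self, zero_smul, sub_zero, hμN _ (piTorsion_piProj hM {p} x)]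
    rfl
  · have hcrit : IsCritical M p e := by
      refine ⟨fun x hx => ?_, ⟨x₀, x₀.2, fun h0 => hx₀ (Subtype.ext h0)⟩,
        (he3.image N.subtype).subset ?_⟩
      · obtain ⟨y, hy⟩ := he1 ⟨x, hx⟩
        exact ⟨y, y.2, congrArg Subtype.val hy⟩
      · rintro _ ⟨hx, y, hy, rfl⟩
        exact ⟨(p : ℤ) ^ e • ⟨y, hy⟩, ⟨Subtype.ext hx, ⟨y, hy⟩, rfl⟩, rfl⟩
    obtain ⟨hpT, hrp⟩ := h.critical p e hp hcrit
    refine ⟨k, Or.inr ⟨hpT, hk⟩, ?_⟩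
    obtain ⟨e', he'⟩ := h.bounded p hpT
    have hur : ∀ y, PiTorsion {p} y → u (r y) = μ (r y) := by
      intro y hy
      obtain ⟨z, hz⟩ := h.div ((p : ℤ) ^ e) (pow_ne_zero _ hq.ne_zero) y
      have h1 : r y = (p : ℤ) ^ e • piProj hM {p} (r z) := by
        rw [← map_zsmul, hz]
        exact (piProj_of_piTorsion hM (PiTorsion.map hy r)).symm
      have h2 := congrArg Subtype.val (he4 ⟨_, piTorsion_piProj hM {p} (r z)⟩)
      rw [h1, hμN _ (N.zsmul_mem (piTorsion_piProj hM {p} (r z)) _)]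
      exact h2
    have hrμ : ∀ y, r (μ (r y)) = μ (r y) := by
      intro y
      obtain ⟨j, hj⟩ := hμj (r y)
      rw [hj, map_zsmul, h.idem]
    -- `u` and `μ` agree on the divisible part, so the error depends only on the bounded component
    -- `y - r y`, where it is `u - k μ`.
    have key2 : ∀ y, PiTorsion {p} y → u y - μ y - (k - 1) • (μ y - r (μ y)) =
        u (y - r y) - k • μ (y - r y) := by
      intro y hy
      have h1 : r (μ y) = μ (r y) := by
        obtain ⟨j, hj⟩ := hμj (y - r y)
        have : r (μ (y - r y)) = 0 := by
          rw [hj, map_zsmul, map_sub, h.idem, sub_self, smul_zero]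
        rw [map_sub, map_sub, hrμ, sub_eq_zero] at this
        exact this
      rw [h1, map_sub, map_sub, hur y hy]
      module
    -- The error is finite modulo the divisible part and is killed by `p ^ e'`; the divisible part
    -- has finite `p ^ e'`-torsion, so the error has finite image.
    have h1 : FinMod (Set.range ((u * piProj hM {p} + (1 - piProj hM {p})) -
        (1 + (k - 1) • boundedProj hM r p) * μ : AddMonoid.End M))
        (AddMonoidHom.range (r : M →+ M) ⊓
          (zsmulAddGroupHom (α := M) ((p : ℤ) ^ e')).ker) := by
      refine FinMod.of_image (f := AddMonoidHom.id M) (D := AddMonoidHom.range (r : M →+ M)) ?_ ?_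
      · refine (hkfin.image N.subtype (D := AddMonoidHom.range (r : M →+ M)) ?_).mono ?_ le_rfl
        · rintro _ ⟨x, rfl⟩
          exact ⟨_, hrp x x.2⟩
        · rintro _ ⟨_, ⟨x, rfl⟩, rfl⟩
          have hy : PiTorsion {p} (piProj hM {p} x - r (piProj hM {p} x)) :=
            N.sub_mem (piTorsion_piProj hM {p} x) ((piTorsion_piProj hM {p} x).map r)
          refine ⟨_, ⟨⟨_, hy⟩, rfl⟩, ?_⟩
          change _ = ((u * piProj hM {p} + (1 - piProj hM {p})) -
            (1 + (k - 1) • boundedProj hM r p) * μ : AddMonoid.End M) x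
          rw [key, key2 _ (piTorsion_piProj hM {p} x), hμN _ hy]
          rfl
      · rintro _ ⟨x, rfl⟩ _ ⟨y, rfl⟩ hxy
        refine ⟨hxy, ?_⟩
        have h0 : ∀ x, (p : ℤ) ^ e' • ((u * piProj hM {p} + (1 - piProj hM {p})) -
            (1 + (k - 1) • boundedProj hM r p) * μ : AddMonoid.End M) x = 0 := by
          intro x
          have hx := he' _ (piTorsion_piProj hM {p} x)
          rw [key, key2 _ (piTorsion_piProj hM {p} x), smul_sub, smul_comm _ k, ← map_zsmul,
            ← map_zsmul, hx, map_zero, map_zero, smul_zero, sub_zero]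
        refine AddMonoidHom.mem_ker.2 ?_
        rw [map_sub]
        refine (sub_eq_zero.2 ?_)
        exact (h0 x).trans (h0 y).symm
    refine finMod_bot.1 (h1.trans (finMod_bot.2 ?_))
    refine (h.finite (p ^ e') (pow_ne_zero _ hp.ne_zero)).subset ?_
    rintro _ ⟨⟨x, rfl⟩, hx⟩
    refine ⟨h.idem x, ?_⟩
    change (p : ℤ) ^ e' • r x = 0 at hx
    rwa [← natCast_zsmul, Nat.cast_pow]

end Components

/-! ### Multiplications on the bounded parts: the group `delta`. -/

section Delta

variable {A : Type*} [CommGroup A]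

/-- The automorphisms `γ` with `γ s = s`. -/
def fixLeft (s : AddMonoid.End (Additive A)) : Subgroup (MulAut A) where
  carrier := {γ | toEnd A γ * s = s}
  one_mem' := by simp
  mul_mem' := by
    intro γ δ hγ hδ
    simp only [Set.mem_ofPred_eq] at *
    rw [map_mul, mul_assoc, hδ, hγ]
  inv_mem' := by
    intro γ hγ
    simp only [Set.mem_ofPred_eq] at *
    nth_rewrite 1 [← hγ]
    rw [← mul_assoc, toEnd_inv_mul, one_mul]

/-- The automorphisms `γ` with `s γ = s`. -/
def fixRight (s : AddMonoid.End (Additive A)) : Subgroup (MulAut A) where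
  carrier := {γ | s * toEnd A γ = s}
  one_mem' := by simp
  mul_mem' := by
    intro γ δ hγ hδ
    simp only [Set.mem_ofPred_eq] at *
    rw [map_mul, ← mul_assoc, hγ, hδ]
  inv_mem' := by
    intro γ hγ
    simp only [Set.mem_ofPred_eq] at *
    nth_rewrite 1 [← hγ]
    rw [mul_assoc, toEnd_mul_inv, mul_one]

lemma mem_fixLeft {s : AddMonoid.End (Additive A)} {γ : MulAut A} :
    γ ∈ fixLeft s ↔ toEnd A γ * s = s := Iff.rfl

lemma mem_fixRight {s : AddMonoid.End (Additive A)} {γ : MulAut A} :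
    γ ∈ fixRight s ↔ s * toEnd A γ = s := Iff.rfl

variable {hM : ∀ x : Additive A, ∃ n : ℕ, n ≠ 0 ∧ n • x = 0} {T : Set ℕ}
  {r : AddMonoid.End (Additive A)}

lemma one_add_zsmul_mul {R : Type*} [Ring R] {b : R} (hb : b * b = b) (k l : ℤ) :
    (1 + k • b) * (1 + l • b) = 1 + (k + l + k * l) • b := by
  rw [mul_add, mul_one, add_mul, one_mul, smul_mul_smul_comm, hb]
  module

/-- The automorphisms which are the multiplication by an integer on the bounded part of the
`p`-component and trivial elsewhere. -/
def deltaComponent (h : IsDivisiblePart hM T r) (p : ℕ) : Subgroup (MulAut A) where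
  carrier := {δ | (∃ k : ℤ, toEnd A δ = 1 + k • boundedProj hM r p) ∧
    ∃ k : ℤ, toEnd A δ⁻¹ = 1 + k • boundedProj hM r p}
  one_mem' := ⟨⟨0, by simp⟩, ⟨0, by simp⟩⟩
  mul_mem' := by
    rintro γ δ ⟨⟨k, hk⟩, ⟨l, hl⟩⟩ ⟨⟨k', hk'⟩, ⟨l', hl'⟩⟩
    have hb := boundedProj_mul_self h p
    exact ⟨⟨_, by rw [map_mul, hk, hk', one_add_zsmul_mul hb]⟩,
      ⟨_, by rw [mul_inv_rev, map_mul, hl, hl', one_add_zsmul_mul hb]⟩⟩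
  inv_mem' := by
    rintro γ ⟨h1, h2⟩
    exact ⟨h2, by rwa [inv_inv]⟩

/-- The group generated by the groups `deltaComponent`. -/
def delta (h : IsDivisiblePart hM T r) : Subgroup (MulAut A) :=
  ⨆ p : T, deltaComponent h p

/-- The inverse multiplies by an inverse of `k` modulo the exponent of the bounded part. -/
lemma exists_mem_deltaComponent (h : IsDivisiblePart hM T r) {p : ℕ} (hp : p ∈ T) {k : ℤ}
    (hk : ¬ (p : ℤ) ∣ k) :
    ∃ δ ∈ deltaComponent h p, toEnd A δ = 1 + (k - 1) • boundedProj hM r p := by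
  obtain ⟨e, he⟩ := exists_pow_smul_boundedProj h hp
  obtain ⟨l, ⟨c, hc⟩, -⟩ :=
    exists_inverse_mod_pow (Nat.prime_iff_prime_int.1 (h.prime p hp)) hk e
  have hb := boundedProj_mul_self h p
  have hl : (l * k - 1) • boundedProj hM r p = 0 := by
    ext x
    change (l * k - 1) • boundedProj hM r p x = 0
    rw [hc, mul_comm, mul_smul, he, smul_zero]
  obtain ⟨δ, h1, h2⟩ := exists_mulAut (A := A) (u := 1 + (k - 1) • boundedProj hM r p)
    (v := 1 + (l - 1) • boundedProj hM r p)
    (by rw [one_add_zsmul_mul hb, show k - 1 + (l - 1) + (k - 1) * (l - 1) = l * k - 1 by ring,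
      hl, add_zero])
    (by rw [one_add_zsmul_mul hb, show l - 1 + (k - 1) + (l - 1) * (k - 1) = l * k - 1 by ring,
      hl, add_zero])
  exact ⟨δ, ⟨⟨_, h1⟩, ⟨_, h2⟩⟩, h1⟩

lemma deltaComponent_le_fixLeft (h : IsDivisiblePart hM T r) {p : ℕ}
    {s : AddMonoid.End (Additive A)} (hs : boundedProj hM r p * s = 0) :
    deltaComponent h p ≤ fixLeft s := by
  rintro δ ⟨⟨k, hk⟩, -⟩
  rw [mem_fixLeft, hk]
  ext x
  change s x + k • boundedProj hM r p (s x) = s x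
  rw [show boundedProj hM r p (s x) = 0 from DFunLike.congr_fun hs x, smul_zero, add_zero]

lemma deltaComponent_le_fixRight (h : IsDivisiblePart hM T r) {p : ℕ}
    {s : AddMonoid.End (Additive A)} (hs : s * boundedProj hM r p = 0) :
    deltaComponent h p ≤ fixRight s := by
  rintro δ ⟨⟨k, hk⟩, -⟩
  rw [mem_fixRight, hk]
  ext x
  change s (x + k • boundedProj hM r p x) = s x
  rw [map_add, map_zsmul, show s (boundedProj hM r p x) = 0 from DFunLike.congr_fun hs x,
    smul_zero, add_zero]

lemma delta_le_fixLeft (h : IsDivisiblePart hM T r) : delta h ≤ fixLeft r :=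
  iSup_le fun p => deltaComponent_le_fixLeft h (boundedProj_mul h p)

lemma delta_le_fixRight (h : IsDivisiblePart hM T r) : delta h ≤ fixRight r :=
  iSup_le fun p => deltaComponent_le_fixRight h (mul_boundedProj h p)

lemma delta_le_fixLeft_compl (h : IsDivisiblePart hM T r) :
    delta h ≤ fixLeft (1 - piProj hM T) := by
  refine iSup_le fun p => deltaComponent_le_fixLeft h ?_
  rw [boundedProj, mul_assoc, mul_sub, mul_one,
    piProj_mul_of_subset hM (Set.singleton_subset_iff.2 p.2), sub_self, mul_zero]

lemma deltaComponent_finite (h : IsDivisiblePart hM T r) {p : ℕ} (hp : p ∈ T) :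
    Finite (deltaComponent h p) := by
  obtain ⟨e, he⟩ := exists_pow_smul_boundedProj h hp
  have hpos : (0 : ℤ) < (p : ℤ) ^ e := pow_pos (by exact_mod_cast (h.prime p hp).pos) e
  refine Set.Finite.to_subtype (s := (deltaComponent h p : Set (MulAut A))) ?_
  refine Set.Finite.of_finite_image (f := toEnd A) ?_ toEnd_injective.injOn
  refine ((Set.finite_Ico (0 : ℤ) ((p : ℤ) ^ e)).image
    fun k => 1 + k • boundedProj hM r p).subset ?_
  rintro _ ⟨δ, ⟨⟨k, hk⟩, -⟩, rfl⟩
  refine ⟨k % (p : ℤ) ^ e, ⟨Int.emod_nonneg _ hpos.ne', Int.emod_lt_of_pos _ hpos⟩, ?_⟩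
  ext x
  rw [hk]
  change x + (k % (p : ℤ) ^ e) • boundedProj hM r p x = x + k • boundedProj hM r p x
  rw [Int.emod_def, sub_smul, mul_comm, mul_smul, he, smul_zero, sub_zero]

/-- The idempotents `boundedProj` are orthogonal: the other components fix the bounded part at `p`,
on which a nontrivial element of `deltaComponent h p` acts nontrivially. -/
lemma delta_isDirectProduct (h : IsDivisiblePart hM T r) :
    IsDirectProductOfFiniteAbelian (delta h) := by
  have hcomm : ∀ p q : ℕ, ∀ x ∈ deltaComponent h p, ∀ y ∈ deltaComponent h q, Commute x y := by
    rintro p q x ⟨⟨k, hk⟩, -⟩ y ⟨⟨l, hl⟩, -⟩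
    apply toEnd_injective
    rw [map_mul, map_mul, hk, hl]
    have hb : Commute (boundedProj hM r p) (boundedProj hM r q) := by
      by_cases hpq : p = q
      · rw [hpq]
      · rw [Commute, SemiconjBy, boundedProj_mul_of_ne p q hpq,
          boundedProj_mul_of_ne q p (Ne.symm hpq)]
    exact ((Commute.one_left _).add_left
      ((Commute.one_right _).add_right ((hb.smul_left k).smul_right l))).eq
  refine ⟨Set.range fun p : T => deltaComponent h p, ?_, ?_, ?_, rfl⟩
  · rintro _ ⟨p, rfl⟩
    exact ⟨deltaComponent_finite h p.2, hcomm p p⟩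
  · rintro _ ⟨p, rfl⟩ _ ⟨q, rfl⟩ -
    exact hcomm p q
  · rintro _ ⟨p, rfl⟩
    have hle : sSup ((Set.range fun p : T => deltaComponent h p) \ {deltaComponent h p}) ≤
        fixLeft (boundedProj hM r p) := by
      refine sSup_le ?_
      rintro _ ⟨⟨q, rfl⟩, hq⟩
      refine deltaComponent_le_fixLeft h (boundedProj_mul_of_ne _ _ ?_)
      rintro hqp
      exact hq (by simp [hqp])
    refine Disjoint.mono_right hle ?_
    rw [Subgroup.disjoint_def]
    rintro δ ⟨⟨k, hk⟩, -⟩ hδ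
    rw [mem_fixLeft, hk, add_mul, one_mul, smul_mul_assoc, boundedProj_mul_self h,
      add_eq_left] at hδ
    apply toEnd_injective
    rw [hk, hδ, add_zero, map_one]

/-- This carries the inertiality of `delta`. For `x ∈ H`, `p ^ e` kills the bounded component, so `p
^ e` times the divisible component of `x` lies in `K ≤ H`. As `K` has finite socle, `K / p ^ e K` is
finite, and division by `p ^ e` costs only the finite torsion group `L`. -/
lemma finMod_image_of_isDivisiblePart (h : IsDivisiblePart hM T r) {p : ℕ} (hp : p ∈ T)
    (H : AddSubgroup (Additive A)) : FinMod ((r * piProj hM {p}) '' (H : Set (Additive A))) H := by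
  have hpp := h.prime p hp
  obtain ⟨e, he⟩ := h.bounded p hp
  let K : AddSubgroup (Additive A) :=
    H ⊓ AddMonoidHom.range (r : Additive A →+ Additive A) ⊓ piSubgroup (Additive A) {p}
  have hK : ∀ x : K, ∃ k : ℕ, (p : ℤ) ^ k • x = 0 := fun x => by
    obtain ⟨k, hk⟩ := (piTorsion_singleton hpp).1 x.2.2
    exact ⟨k, Subtype.ext hk⟩
  have hrange : ∀ x ∈ AddMonoidHom.range (r : Additive A →+ Additive A), r x = x := by
    rintro _ ⟨x, rfl⟩
    exact h.idem x
  have hsoc : FiniteSocle (p : ℤ) (⊥ : AddSubgroup K) := by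
    refine finMod_bot.2 (Set.Finite.of_finite_image (f := Subtype.val)
      ((h.finite p hpp.ne_zero).subset ?_) Subtype.val_injective.injOn)
    rintro _ ⟨x, hx, rfl⟩
    refine ⟨hrange x x.2.1.2, ?_⟩
    have : (p : ℤ) • x = 0 := by simpa using hx
    rw [← natCast_zsmul]
    exact congrArg Subtype.val this
  obtain ⟨S, hS, hSK⟩ := hsoc.finMod_pow hK e
  let L : AddSubgroup (Additive A) := AddMonoidHom.range (r : Additive A →+ Additive A) ⊓
    (zsmulAddGroupHom (α := Additive A) ((p : ℤ) ^ e)).ker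
  have hL : (L : Set (Additive A)).Finite := by
    refine (h.finite (p ^ e) (pow_ne_zero _ hpp.ne_zero)).subset fun x hx => ⟨hrange x hx.1, ?_⟩
    rw [← natCast_zsmul, Nat.cast_pow]
    exact hx.2
  have hpe : ∀ x ∈ H, (p : ℤ) ^ e • r (piProj hM {p} x) ∈ K := by
    intro x hx
    have h1 := he _ (piTorsion_piProj hM {p} x)
    rw [smul_sub, sub_eq_zero] at h1
    obtain ⟨c, hc⟩ := exists_piProj_apply_eq_smul hM {p} x
    refine ⟨⟨?_, AddSubgroup.zsmul_mem (AddMonoidHom.range (r : Additive A →+ Additive A))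
      ⟨_, rfl⟩ _⟩, AddSubgroup.zsmul_mem _ ((piTorsion_piProj hM {p} x).map r) _⟩
    change _ ∈ H
    rw [← h1, hc]
    exact H.zsmul_mem (H.zsmul_mem hx _) _
  have h1 : FinMod ((r * piProj hM {p}) '' (H : Set (Additive A))) (H ⊔ L) := by
    refine FinMod.of_classes hS (fun y s => ∃ hy : (p : ℤ) ^ e • y ∈ K,
      (⟨_, hy⟩ : K) - s ∈ (zsmulAddGroupHom (α := K) ((p : ℤ) ^ e)).range) ?_ ?_
    · rintro _ ⟨x, hx, rfl⟩
      obtain ⟨s, hs, hxs⟩ := hSK ⟨_, hpe x hx⟩ trivial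
      rw [bot_sup_eq] at hxs
      exact ⟨s, hs, hpe x hx, hxs⟩
    · rintro _ ⟨x, hx, rfl⟩ _ ⟨y, hy, rfl⟩ s ⟨hx', hxs⟩ ⟨hy', hys⟩
      obtain ⟨k, hk⟩ := AddSubgroup.sub_mem _ hxs hys
      rw [sub_sub_sub_cancel_right] at hk
      have hk' : (p : ℤ) ^ e • (k : Additive A) = (p : ℤ) ^ e • (r * piProj hM {p}) x -
        (p : ℤ) ^ e • (r * piProj hM {p}) y := congrArg Subtype.val hk
      rw [show (r * piProj hM {p}) x - (r * piProj hM {p}) y =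
        k + ((r * piProj hM {p}) x - (r * piProj hM {p}) y - k) by abel]
      refine AddSubgroup.add_mem _ (AddSubgroup.mem_sup_left k.2.1.1)
        (AddSubgroup.mem_sup_right ⟨?_, ?_⟩)
      · exact AddSubgroup.sub_mem _ (AddSubgroup.sub_mem _ ⟨_, rfl⟩ ⟨_, rfl⟩) k.2.1.2
      · refine AddMonoidHom.mem_ker.2 ?_
        change (p : ℤ) ^ e • ((r * piProj hM {p}) x - (r * piProj hM {p}) y - k) = 0
        rw [smul_sub, smul_sub, hk', sub_self]
  refine h1.trans ⟨L, hL, fun x hx => ?_⟩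
  obtain ⟨a, ha, l, hl, rfl⟩ := AddSubgroup.mem_sup.1 hx
  exact ⟨l, hl, by simpa using ha⟩

lemma delta_le_IAut (h : IsDivisiblePart hM T r) : delta h ≤ IAut A := by
  refine iSup_le fun p => ?_
  rintro δ ⟨⟨k, hk⟩, -⟩
  refine Subgroup.subset_closure (inertial_of_finMod fun H => ?_)
  obtain ⟨S, hS, hSH⟩ := finMod_image_of_isDivisiblePart h p.2 H
  refine ⟨(fun s => -(k • s)) '' S, hS.image _, ?_⟩
  rintro _ ⟨x, hx, rfl⟩
  obtain ⟨s, hs, hxs⟩ := hSH _ ⟨x, hx, rfl⟩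
  refine ⟨_, ⟨s, hs, rfl⟩, ?_⟩
  obtain ⟨c, hc⟩ := exists_piProj_apply_eq_smul hM {(p : ℕ)} x
  have h1 : toEnd A δ x = x + k • (piProj hM {(p : ℕ)} x - r (piProj hM {(p : ℕ)} x)) := by
    rw [hk]
    rfl
  have h2 : toEnd A δ x - -(k • s) = x + k • c • x - k • (r (piProj hM {(p : ℕ)} x) - s) := by
    rw [h1, hc]
    module
  rw [h2]
  exact H.sub_mem (H.add_mem hx (H.zsmul_mem (H.zsmul_mem hx _) _)) (H.zsmul_mem hxs k)

/-- The automorphism acting as `γ` on the `π`-part and trivially on the `π'`-part. -/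
lemma exists_localization (hM : ∀ x : Additive A, ∃ n : ℕ, n ≠ 0 ∧ n • x = 0) (γ : MulAut A)
    (π : Set ℕ) : ∃ γ' : MulAut A, toEnd A γ' = toEnd A γ * piProj hM π + (1 - piProj hM π) ∧
      toEnd A γ'⁻¹ = toEnd A γ⁻¹ * piProj hM π + (1 - piProj hM π) := by
  have key : ∀ u v : AddMonoid.End (Additive A), u * v = 1 →
      (u * piProj hM π + (1 - piProj hM π)) * (v * piProj hM π + (1 - piProj hM π)) = 1 := by
    intro u v huv
    have h1 := (piProj_comm hM π v).eq
    have h2 := piProj_mul_self hM π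
    have h3 : u * piProj hM π * (v * piProj hM π) = piProj hM π := by
      rw [mul_assoc, ← mul_assoc (piProj hM π), h1, mul_assoc, h2, ← mul_assoc, huv, one_mul]
    have h4 : piProj hM π * (v * piProj hM π) = v * piProj hM π := by
      rw [← mul_assoc, h1, mul_assoc, h2]
    have h5 : u * piProj hM π * piProj hM π = u * piProj hM π := by rw [mul_assoc, h2]
    simp only [add_mul, mul_add, sub_mul, mul_sub, one_mul, mul_one, h2, h3, h4, h5]
    abel
  exact exists_mulAut (key _ _ (toEnd_mul_inv γ)) (key _ _ (toEnd_inv_mul γ))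

end Delta

/-! ### Generation of `IAut A`. -/

section Generation

variable {A : Type*} [CommGroup A] {hM : ∀ x : Additive A, ∃ n : ℕ, n ≠ 0 ∧ n • x = 0} {T : Set ℕ}
  {r : AddMonoid.End (Additive A)}

lemma localization_mem (h : IsDivisiblePart hM T r) {γ : MulAut A} (hγ : IsInertial γ) {p : ℕ}
    (hp : p.Prime) {γ' : MulAut A}
    (hγ' : toEnd A γ' = toEnd A γ * piProj hM {p} + (1 - piProj hM {p})) :
    γ' ∈ PAut A ⊔ (FAut A ⊔ delta h) := by
  have hinj : Function.Injective (toEnd A γ) := fun x y hxy => by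
    have h1 := fun x => DFunLike.congr_fun (toEnd_inv_mul γ) x
    have := congrArg (toEnd A γ⁻¹) hxy
    exact (h1 x).symm.trans (this.trans (h1 y))
  obtain ⟨μ, ν, hμν, hνμ, hμ, k, hk, hfin⟩ :=
    exists_local_factor hM h hinj (addInertial_toEnd hγ) hp
  obtain ⟨m, hm, hm'⟩ := exists_mulAut hμν hνμ
  have hmP : m ∈ PAut A := by
    refine isPowerAut_of_forall (by rwa [hm]) ?_
    rw [hm']
    exact exists_smul_inverse hM hνμ hμ
  obtain ⟨δ, hδ, hδk⟩ : ∃ δ ∈ delta h, toEnd A δ = 1 + (k - 1) • boundedProj hM r p := by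
    rcases hk with rfl | ⟨hpT, hk⟩
    · exact ⟨1, one_mem _, by simp⟩
    · obtain ⟨δ, h1, h2⟩ := exists_mem_deltaComponent h hpT hk
      exact ⟨δ, Subgroup.mem_iSup_of_mem (⟨p, hpT⟩ : T) h1, h2⟩
  have hφ : γ' * m⁻¹ * δ⁻¹ ∈ FAut A := by
    refine isFinitary_iff.2 ?_
    have h1 : toEnd A (γ' * m⁻¹ * δ⁻¹) - 1 =
        (toEnd A γ' - toEnd A δ * toEnd A m) * (toEnd A m⁻¹ * toEnd A δ⁻¹) := by
      rw [sub_mul, ← map_mul, ← map_mul, ← map_mul, ← map_mul, ← map_one (toEnd A)]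
      congr 2
      group
    rw [h1, hγ', hδk, hm]
    exact hfin.mul_right _
  have hγ'eq : γ' = (γ' * m⁻¹ * δ⁻¹) * δ * m := by group
  rw [hγ'eq]
  exact mul_mem (mul_mem (Subgroup.mem_sup_right (Subgroup.mem_sup_left hφ))
    (Subgroup.mem_sup_right (Subgroup.mem_sup_right hδ))) (Subgroup.mem_sup_left hmP)

lemma localization_finset_mem (h : IsDivisiblePart hM T r) {γ : MulAut A} (hγ : IsInertial γ)
    (P : Finset ℕ) (hP : ∀ p ∈ P, p.Prime) :
    ∃ γ' ∈ PAut A ⊔ (FAut A ⊔ delta h),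
      toEnd A γ' = toEnd A γ * piProj hM P + (1 - piProj hM P) := by
  classical
  induction P using Finset.induction_on with
  | empty => exact ⟨1, one_mem _, by simp [piProj_empty]⟩
  | insert p P hpP ih =>
    obtain ⟨γ₁, h1, h1'⟩ := ih fun q hq => hP q (Finset.mem_insert_of_mem hq)
    obtain ⟨γ₂, h2, -⟩ := exists_localization hM γ {p}
    refine ⟨γ₂ * γ₁, mul_mem (localization_mem h hγ (hP p (Finset.mem_insert_self p P)) h2) h1, ?_⟩
    rw [map_mul, h1', h2, Finset.coe_insert, piProj_insert hM (by simpa using hpP)]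
    have h3 : piProj hM {p} * piProj hM (P : Set ℕ) = 0 :=
      piProj_mul_of_disjoint hM (by simpa using hpP)
    have h4 : piProj hM {p} * (toEnd A γ * piProj hM (P : Set ℕ)) = 0 := by
      rw [← mul_assoc, (piProj_comm hM {p} _).eq, mul_assoc, h3, mul_zero]
    simp only [add_mul, mul_add, sub_mul, mul_sub, one_mul, mul_one, mul_assoc, h3, h4, mul_zero]
    abel

/-- At the primes not dividing `|F|`, elements are independent of `F` and `γ x - j • x` can lie in
`F` only if it is zero, so `γ` is a power automorphism there. The finitely many other primes are
treated locally. -/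
lemma IsInertial.mem_sup (h : IsDivisiblePart hM T r) {γ : MulAut A} (hγ : IsInertial γ) :
    γ ∈ PAut A ⊔ (FAut A ⊔ delta h) := by
  obtain ⟨F, hF, hFγ⟩ := (addInertial_toEnd hγ).exists_finite fun x => by
    obtain ⟨n, hn, hx⟩ := hM x
    exact ⟨n, by exact_mod_cast hn, by rwa [natCast_zsmul]⟩
  have hFfin : Finite F := hF.to_subtype
  let n := Nat.card F
  have hn : n ≠ 0 := Nat.card_pos.ne'
  have hnF : ∀ f ∈ F, PiTorsion (n.primeFactors : Set ℕ) f := fun f hf =>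
    ⟨n, hn, fun p hp hd => by simp [hp, hd, hn], by
      have := card_nsmul_eq_zero' (x := (⟨f, hf⟩ : F))
      exact congrArg Subtype.val this⟩
  obtain ⟨γ₁, h1, h1'⟩ := localization_finset_mem h hγ n.primeFactors
    fun p hp => Nat.prime_of_mem_primeFactors hp
  set e := piProj hM (n.primeFactors : Set ℕ) with he
  obtain ⟨γ₂, h2, h2'⟩ := exists_localization hM γ (n.primeFactors : Set ℕ)
  obtain rfl : γ₂ = γ₁ := toEnd_injective (h2.trans h1'.symm)
  have h3 : toEnd A (γ * γ₂⁻¹) = toEnd A γ * (1 - e) + e := by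
    rw [map_mul, h2', ← he, mul_add, ← mul_assoc, toEnd_mul_inv, one_mul, add_comm]
  have hρ : γ * γ₂⁻¹ ∈ PAut A := by
    have hsm : ∀ x, ∃ j : ℤ, toEnd A (γ * γ₂⁻¹) x = j • x := by
      intro x
      obtain ⟨c, hc⟩ := exists_piProj_apply_eq_smul hM (n.primeFactors : Set ℕ) x
      have hy : PiTorsion (n.primeFactors : Set ℕ)ᶜ (x - e x) := piTorsion_sub_piProj hM _ x
      obtain ⟨j, hj⟩ := hFγ (x - e x) fun j hj =>
        (hnF _ hj).eq_zero_of_compl ((piSubgroup _ _).zsmul_mem hy j)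
      have h0 := (hnF _ hj).eq_zero_of_compl
        ((piSubgroup _ _).sub_mem (hy.map (toEnd A γ)) ((piSubgroup _ _).zsmul_mem hy j))
      rw [sub_eq_zero] at h0
      refine ⟨j * (1 - c) + c, ?_⟩
      rw [h3]
      change toEnd A γ (x - e x) + e x = _
      refine (congrArg (· + e x) h0).trans ?_
      change j • (x - e x) + e x = _
      rw [he, hc]
      module
    exact isPowerAut_of_forall hsm (exists_smul_inverse hM (toEnd_inv_mul _) hsm)
  rw [← inv_mul_cancel_right γ γ₂]
  exact mul_mem (Subgroup.mem_sup_left hρ) h1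

lemma coe_IAut_eq (h : IsDivisiblePart hM T r) :
    (IAut A : Set (MulAut A)) =
      (PAut A : Set (MulAut A)) * (FAut A : Set (MulAut A)) * (delta h : Set (MulAut A)) := by
  rw [mul_assoc, ← Subgroup.normal_mul, ← Subgroup.normal_mul]
  congr 1
  apply le_antisymm
  · exact (Subgroup.closure_le _).2 fun γ hγ => IsInertial.mem_sup h hγ
  · exact sup_le PAut_le_IAut (sup_le FAut_le_IAut (delta_le_IAut h))

end Generation

/-! ### Splitting of `FAut A` times `delta`. -/

section Splitting

variable {A : Type*} [CommGroup A] {hM : ∀ x : Additive A, ∃ n : ℕ, n ≠ 0 ∧ n • x = 0} {T : Set ℕ}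
  {r : AddMonoid.End (Additive A)}

lemma PiTorsion.congr_primes {M : Type*} [AddCommGroup M] {π ρ : Set ℕ}
    (h : ∀ p : ℕ, p.Prime → (p ∈ π → p ∈ ρ)) {x : M} (hx : PiTorsion π x) : PiTorsion ρ x := by
  obtain ⟨n, hn, hp, hx⟩ := hx
  exact ⟨n, hn, fun p hp' hd => h p hp' (hp p hp' hd), hx⟩

lemma mem_FAutPi_iff (hM : ∀ x : Additive A, ∃ n : ℕ, n ≠ 0 ∧ n • x = 0) (π : Set ℕ)
    (hπ : ∀ p : ℕ, p.Prime → (p ∈ π ↔ p ∉ T)) {γ : MulAut A} :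
    γ ∈ FAutPi A π ↔ γ ∈ FAut A ⊓ fixLeft (piProj hM T) := by
  have hTπ : ∀ x : Additive A, PiTorsion T x → x.toMul ∈ piPart A πᶜ := fun x hx =>
    hx.congr_primes fun p hp hpT hpπ => (hπ p hp).1 hpπ hpT
  have hπT : ∀ b ∈ piPart A πᶜ, PiTorsion T (Additive.ofMul b) := fun b hb =>
    PiTorsion.congr_primes (π := πᶜ) (ρ := T)
      (fun p hp (hpπ : p ∉ π) => by_contra fun h => hpπ ((hπ p hp).2 h)) hb
  have hc : ∀ x : Additive A, PiTorsion Tᶜ x → x.toMul ∈ piPart A π := fun x hx =>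
    hx.congr_primes fun p hp hpT => (hπ p hp).2 hpT
  constructor
  · rintro ⟨φ, hφ, h1, h2⟩
    have hfix : γ ∈ fixLeft (piProj hM T) := by
      rw [mem_fixLeft]
      ext x
      exact h2 _ (hTπ _ (piTorsion_piProj hM T x))
    refine ⟨isFinitary_iff.2 ?_, hfix⟩
    have hφ' : FiniteRange _ := isFinitary_iff.1 hφ
    refine (Set.Finite.image (fun y : Additive (piPart A π) =>
      (Additive.ofMul (y.toMul : A) : Additive A)) hφ').subset ?_
    rintro _ ⟨x, rfl⟩
    have hx := hc _ (piTorsion_sub_piProj hM T x)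
    refine ⟨_, ⟨Additive.ofMul ⟨_, hx⟩, rfl⟩, ?_⟩
    have h3 : toEnd A γ (x - piProj hM T x) =
        Additive.ofMul ((φ ⟨_, hx⟩ : piPart A π) : A) := h1 ⟨_, hx⟩
    have h4 : toEnd A γ (piProj hM T x) = piProj hM T x := DFunLike.congr_fun hfix x
    have h5 : (toEnd A γ - 1) x = toEnd A γ (x - piProj hM T x) - (x - piProj hM T x) := by
      rw [map_sub, h4, sub_sub_sub_cancel_right]
      rfl
    rw [h5, h3]
    rfl
  · rintro ⟨hγ, hfix⟩
    have hmaps : ∀ (γ : MulAut A), ∀ x ∈ piPart A π, γ x ∈ piPart A π := by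
      intro γ x hx
      have : PiTorsion π (Additive.ofMul x) := hx
      exact this.map (toEnd A γ)
    let φ : MulAut (piPart A π) :=
      { toFun := fun x => ⟨γ x, hmaps γ x x.2⟩
        invFun := fun x => ⟨γ⁻¹ x, hmaps γ⁻¹ x x.2⟩
        left_inv := fun x => Subtype.ext (MulAut.inv_apply_self _ γ x)
        right_inv := fun x => Subtype.ext (MulAut.apply_inv_self _ γ x)
        map_mul' := fun x y => Subtype.ext (map_mul γ (x : A) y) }
    refine ⟨φ, isFinitary_iff.2 ?_, fun _ => rfl, fun b hb => ?_⟩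
    · have hγ' : FiniteRange _ := isFinitary_iff.1 hγ
      refine Set.Finite.of_finite_image (f := fun y : Additive (piPart A π) =>
        (Additive.ofMul (y.toMul : A) : Additive A)) (Set.Finite.subset hγ' ?_)
        (fun x _ y _ hxy => Subtype.ext hxy)
      rintro _ ⟨_, ⟨x, rfl⟩, rfl⟩
      exact ⟨Additive.ofMul (x.toMul : A), rfl⟩
    · have h1 := DFunLike.congr_fun (mem_fixLeft.1 hfix) (Additive.ofMul b)
      change toEnd A γ (piProj hM T _) = piProj hM T _ at h1
      rw [piProj_of_piTorsion hM (hπT b hb)] at h1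
      exact h1

/-- The automorphisms `1 + f`, where `f` maps the bounded part to the divisible part, with
finite image. -/
def sigmaGroup (r : AddMonoid.End (Additive A)) : Subgroup (MulAut A) :=
  FAut A ⊓ fixLeft r ⊓ fixRight (1 - r)

/-- The elements of `FAut A ⊔ delta h` which preserve the bounded part and are trivial outside
the critical components. -/
noncomputable def psiGroup (h : IsDivisiblePart hM T r) : Subgroup (MulAut A) :=
  (FAut A ⊔ delta h) ⊓ fixRight r ⊓ fixLeft (1 - piProj hM T)

lemma mem_sigmaGroup {σ : MulAut A} : σ ∈ sigmaGroup r ↔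
    (σ ∈ FAut A ∧ toEnd A σ * r = r) ∧ (1 - r) * toEnd A σ = 1 - r := Iff.rfl

lemma mem_psiGroup {h : IsDivisiblePart hM T r} {ψ : MulAut A} : ψ ∈ psiGroup h ↔
    (ψ ∈ FAut A ⊔ delta h ∧ r * toEnd A ψ = r) ∧
      toEnd A ψ * (1 - piProj hM T) = 1 - piProj hM T := Iff.rfl

lemma FAut_le_fixLeft (h : IsDivisiblePart hM T r) : FAut A ≤ fixLeft r := by
  intro φ hφ
  have := h.mul_eq_of_finiteRange (isFinitary_iff.1 hφ)
  rwa [sub_mul, one_mul, sub_eq_zero] at this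

lemma sup_le_fixLeft (h : IsDivisiblePart hM T r) : FAut A ⊔ delta h ≤ fixLeft r :=
  sup_le (FAut_le_fixLeft h) (delta_le_fixLeft h)

lemma mem_sigmaGroup_iff {σ : MulAut A} :
    σ ∈ sigmaGroup r ↔ FiniteRange (toEnd A σ - 1) ∧ (toEnd A σ - 1) * r = 0 ∧
      r * (toEnd A σ - 1) = toEnd A σ - 1 := by
  rw [sigmaGroup, Subgroup.mem_inf, Subgroup.mem_inf, mem_fixLeft, mem_fixRight, and_assoc,
    sub_mul _ _ r, one_mul, sub_eq_zero, sub_mul, one_mul, mul_sub, mul_one]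
  refine and_congr isFinitary_iff (and_congr Iff.rfl ?_)
  rw [sub_eq_sub_iff_add_eq_add, sub_eq_sub_iff_add_eq_add, add_comm _ r]
  exact ⟨fun h => by rw [add_comm _ (1 : AddMonoid.End (Additive A)), ← h, add_comm],
    fun h => by rw [← h, add_comm]⟩

/-- The map `f = σ - 1` takes values in the `T`-part and the projection is central, so `f` vanishes
on the `T'`-part. -/
lemma sigmaGroup_le_fixLeft (h : IsDivisiblePart hM T r) :
    sigmaGroup r ≤ fixLeft (1 - piProj hM T) := by
  intro σ hσ
  obtain ⟨-, -, h2⟩ := mem_sigmaGroup_iff.1 hσ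
  rw [mem_fixLeft, ← sub_eq_zero]
  nth_rewrite 2 [← one_mul (1 - piProj hM T)]
  rw [← sub_mul, ← h2, mul_sub, mul_one, ← (piProj_comm hM T _).eq, ← mul_assoc, h.piProj_mul,
    sub_self]

/-- Elements of `psiGroup` satisfy `ψ r = r = r ψ`, so conjugation by them preserves the conditions
involving `r`. -/
lemma psiGroup_le_normalizer (h : IsDivisiblePart hM T r) :
    psiGroup h ≤ Subgroup.normalizer (sigmaGroup r : Set (MulAut A)) := by
  have key : ∀ ψ ∈ psiGroup h, ∀ σ ∈ sigmaGroup r, ψ * σ * ψ⁻¹ ∈ sigmaGroup r := by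
    intro ψ hψ σ hσ
    obtain ⟨⟨hψ, hψr⟩, -⟩ := mem_psiGroup.1 hψ
    obtain ⟨⟨hσ, hσr⟩, hσr'⟩ := mem_sigmaGroup.1 hσ
    have hψ' := sup_le_fixLeft h hψ
    refine mem_sigmaGroup.2 ⟨⟨(FAut_normal A).conj_mem σ hσ ψ,
      mem_fixLeft.1 (mul_mem (mul_mem hψ' (mem_fixLeft.2 hσr)) (inv_mem hψ'))⟩, ?_⟩
    rw [mem_fixLeft] at hψ'
    have hcomm : (1 - r) * toEnd A ψ = toEnd A ψ * (1 - r) := by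
      rw [sub_mul, mul_sub, one_mul, mul_one, hψr, hψ']
    rw [map_mul, map_mul, ← mul_assoc, ← mul_assoc, hcomm, mul_assoc _ (1 - r), hσr', ← hcomm,
      mul_assoc, toEnd_mul_inv, mul_one]
  intro ψ hψ
  rw [Subgroup.mem_normalizer_iff]
  intro σ
  refine ⟨key ψ hψ σ, fun hσ => ?_⟩
  have := key ψ⁻¹ (inv_mem hψ) _ hσ
  rwa [inv_inv, mul_assoc, mul_assoc, inv_mul_cancel, mul_one, inv_mul_cancel_left] at this

lemma disjoint_sigmaGroup_psiGroup (h : IsDivisiblePart hM T r) :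
    Disjoint (sigmaGroup r) (psiGroup h) := by
  rw [Subgroup.disjoint_def]
  intro γ hσ hψ
  obtain ⟨-, h1⟩ := mem_sigmaGroup.1 hσ
  obtain ⟨⟨-, h2⟩, -⟩ := mem_psiGroup.1 hψ
  apply toEnd_injective
  rw [map_one, ← one_mul (toEnd A γ), ← sub_add_cancel (1 : AddMonoid.End (Additive A)) r, add_mul,
    h1, h2]

lemma sup_le_sup_of_sigma_psi (h : IsDivisiblePart hM T r) :
    sigmaGroup r ⊔ psiGroup h ≤ FAut A ⊔ delta h :=
  sup_le (fun _ hσ => Subgroup.mem_sup_left hσ.1.1) fun _ hψ => hψ.1.1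

lemma isInternalDirect (h : IsDivisiblePart hM T r) (π : Set ℕ)
    (hπ : ∀ p : ℕ, p.Prime → (p ∈ π ↔ p ∉ T)) :
    IsInternalDirect ((FAut A : Set (MulAut A)) * (delta h : Set (MulAut A)))
      (FAutPi A π) (sigmaGroup r ⊔ psiGroup h) := by
  have hfix : sigmaGroup r ⊔ psiGroup h ≤ fixLeft (1 - piProj hM T) :=
    sup_le (sigmaGroup_le_fixLeft h) fun _ hψ => hψ.2
  refine ⟨?_, ?_, ?_⟩
  · rw [← Subgroup.normal_mul]
    apply subset_antisymm
    · intro g hg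
      -- `α` is the `T'`-part of `g`; it is finitary because `delta` is trivial outside `T`.
      obtain ⟨α, hα, hα'⟩ := exists_localization hM g Tᶜ
      have hcompl : piProj hM Tᶜ = 1 - piProj hM T := by
        ext x
        exact piProj_eq hM (piTorsion_sub_piProj hM T x) (by
          rw [compl_compl]
          change PiTorsion T (x - (x - piProj hM T x))
          rw [sub_sub_cancel]
          exact piTorsion_piProj hM T x)
      rw [hcompl, sub_sub_cancel] at hα
      have hgf : FiniteRange ((toEnd A g - 1) * (1 - piProj hM T)) := by
        rw [SetLike.mem_coe, ← SetLike.mem_coe, Subgroup.normal_mul] at hg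
        obtain ⟨φ, hφ, δ, hδ, rfl⟩ := hg
        have hδ' := mem_fixLeft.1 (delta_le_fixLeft_compl h hδ)
        have h1 : (toEnd A (φ * δ) - 1) * (1 - piProj hM T) =
            (toEnd A φ - 1) * (1 - piProj hM T) := by
          rw [sub_mul, sub_mul, map_mul, mul_assoc, hδ']
        change FiniteRange ((toEnd A (φ * δ) - 1) * (1 - piProj hM T))
        rw [h1]
        exact (isFinitary_iff.1 hφ).mul_right _
      have hαF : α ∈ FAut A := by
        refine isFinitary_iff.2 ?_
        rwa [hα, show toEnd A g * (1 - piProj hM T) + piProj hM T - 1 =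
          (toEnd A g - 1) * (1 - piProj hM T) by rw [sub_mul, one_mul]; abel]
      have hαπ : α ∈ FAutPi A π := by
        rw [mem_FAutPi_iff hM π hπ]
        refine Subgroup.mem_inf.2 ⟨hαF, ?_⟩
        rw [mem_fixLeft, hα, add_mul, mul_assoc, sub_mul, one_mul, piProj_mul_self, sub_self,
          mul_zero, zero_add]
      refine Set.mem_mul.2 ⟨α, hαπ, α⁻¹ * g, ?_, mul_inv_cancel_left _ _⟩
      have hg' : α⁻¹ * g ∈ FAut A ⊔ delta h :=
        mul_mem (Subgroup.mem_sup_left (inv_mem hαF)) hg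
      have hg'fix : α⁻¹ * g ∈ fixLeft (1 - piProj hM T) := by
        have h1 : toEnd A α * (1 - piProj hM T) = toEnd A g * (1 - piProj hM T) := by
          have h2 : piProj hM T * (1 - piProj hM T) = 0 := by
            rw [mul_sub, mul_one, piProj_mul_self, sub_self]
          rw [hα, add_mul, mul_assoc, h2, add_zero, sub_mul 1, one_mul, h2, sub_zero]
        rw [mem_fixLeft, map_mul, mul_assoc, ← h1, ← mul_assoc, toEnd_inv_mul, one_mul]
      generalize α⁻¹ * g = g' at hg' hg'fix
      have hg'r := mem_fixLeft.1 (sup_le_fixLeft h hg')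
      -- `f` is the off-diagonal entry of `g'`, from the bounded to the divisible part. Removing `σ
      -- = 1 + f` on the right leaves an element with `r ψ = r`.
      obtain ⟨f, hf⟩ : ∃ f, f = r * toEnd A g' - r := ⟨_, rfl⟩
      have hfr : f * r = 0 := by rw [hf, sub_mul, mul_assoc, hg'r, h.mul_self, sub_self]
      have hrf : r * f = f := by rw [hf, mul_sub, ← mul_assoc, h.mul_self]
      have hff : f * f = 0 := by rw [← hrf, ← mul_assoc, hrf, hfr, zero_mul]
      obtain ⟨σ, hσ, hσ'⟩ := exists_mulAut (A := A) (u := 1 + f) (v := 1 - f)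
        (by rw [add_mul, mul_sub, mul_sub, hff]; simp)
        (by rw [sub_mul, mul_add, mul_add, hff]; simp)
      have hffin : FiniteRange f := by
        rw [← SetLike.mem_coe, Subgroup.normal_mul] at hg'
        obtain ⟨φ, hφ, δ, hδ, rfl⟩ := hg'
        have hδ' := mem_fixRight.1 (delta_le_fixRight h hδ)
        have h1 : f = r * ((toEnd A φ - 1) * toEnd A δ) := by
          rw [sub_mul, one_mul, mul_sub, hδ', hf]
          congr 2
        rw [h1]
        exact ((isFinitary_iff.1 hφ).mul_right _).mul_left _
      have hσS : σ ∈ sigmaGroup r := by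
        rw [mem_sigmaGroup_iff, hσ, add_sub_cancel_left]
        exact ⟨hffin, hfr, hrf⟩
      have hψ : g' * σ⁻¹ ∈ psiGroup h := by
        refine mem_psiGroup.2 ⟨⟨mul_mem hg' (inv_mem (Subgroup.mem_sup_left hσS.1.1)), ?_⟩,
          mem_fixLeft.1 (mul_mem hg'fix (inv_mem (sigmaGroup_le_fixLeft h hσS)))⟩
        have hgf' : toEnd A g' * f = f := by rw [← hrf, ← mul_assoc, hg'r]
        rw [map_mul, hσ', mul_sub, mul_one, hgf', mul_sub, hrf, hf, sub_sub_cancel]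
      rw [← inv_mul_cancel_right g' σ]
      exact mul_mem (Subgroup.mem_sup_right hψ) (Subgroup.mem_sup_left hσS)
    · rintro _ ⟨α, hα, β, hβ, rfl⟩
      rw [SetLike.mem_coe, mem_FAutPi_iff hM π hπ] at hα
      exact mul_mem (Subgroup.mem_sup_left hα.1) (sup_le_sup_of_sigma_psi h hβ)
  · rw [Subgroup.disjoint_def]
    intro γ h1 h2
    rw [mem_FAutPi_iff hM π hπ] at h1
    have h1' := mem_fixLeft.1 h1.2
    have h2' := mem_fixLeft.1 (hfix h2)
    apply toEnd_injective
    rw [map_one, ← mul_one (toEnd A γ),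
      ← sub_add_cancel (1 : AddMonoid.End (Additive A)) (piProj hM T), mul_add, h1', h2']
  · intro x hx y hy
    rw [mem_FAutPi_iff hM π hπ] at hx
    have hx' := mem_fixLeft.1 hx.2
    have hy' := mem_fixLeft.1 (hfix hy)
    have hcx := (piProj_comm hM T (toEnd A x)).eq
    have hcy := (piProj_comm hM T (toEnd A y)).eq
    have hx1 : (toEnd A x - 1) * piProj hM T = 0 := by rw [sub_mul, hx', one_mul, sub_self]
    have hy1 : toEnd A y - 1 = piProj hM T * (toEnd A y - 1) := by
      rw [mul_sub, mul_one, sub_eq_sub_iff_add_eq_add] at hy'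
      rw [mul_sub, mul_one, hcy, sub_eq_sub_iff_add_eq_add, hy', add_comm]
    have hxy : (toEnd A x - 1) * (toEnd A y - 1) = 0 := by
      rw [hy1, ← mul_assoc, hx1, zero_mul]
    have hyx : (toEnd A y - 1) * (toEnd A x - 1) = 0 := by
      rw [hy1, (piProj_comm hM T (toEnd A y - 1)).eq, mul_assoc,
        (piProj_comm hM T (toEnd A x - 1)).eq, hx1, mul_zero]
    apply toEnd_injective
    rw [map_mul, map_mul]
    have e1 : toEnd A x * toEnd A y =
        (toEnd A x - 1) * (toEnd A y - 1) + toEnd A x + toEnd A y - 1 := by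
      simp only [sub_mul, mul_sub, one_mul, mul_one]; abel
    have e2 : toEnd A y * toEnd A x =
        (toEnd A y - 1) * (toEnd A x - 1) + toEnd A x + toEnd A y - 1 := by
      simp only [sub_mul, mul_sub, one_mul, mul_one]; abel
    rw [e1, e2, hxy, hyx]

end Splitting

/-! ### The conjugation action of `psiGroup` on `sigmaGroup`. -/

section Action

variable {A : Type*} [CommGroup A] {hM : ∀ x : Additive A, ∃ n : ℕ, n ≠ 0 ∧ n • x = 0} {T : Set ℕ}
  {r : AddMonoid.End (Additive A)}

/-- The maps `σ - 1` land in the divisible part and vanish on it, so their products are zero and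
composition becomes addition. -/
lemma toEnd_mul_of_sigma {σ τ : MulAut A} (hσ : σ ∈ sigmaGroup r) (hτ : τ ∈ sigmaGroup r) :
    toEnd A (σ * τ) = 1 + ((toEnd A σ - 1) + (toEnd A τ - 1)) := by
  obtain ⟨-, h1, -⟩ := mem_sigmaGroup_iff.1 hσ
  obtain ⟨-, -, h2⟩ := mem_sigmaGroup_iff.1 hτ
  have h3 : (toEnd A σ - 1) * (toEnd A τ - 1) = 0 := by
    rw [← h2, ← mul_assoc, h1, zero_mul]
  have h4 : toEnd A σ * toEnd A τ = (toEnd A σ - 1) * (toEnd A τ - 1) + toEnd A σ + toEnd A τ - 1 := by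
    simp only [sub_mul, mul_sub, one_mul, mul_one]; abel
  rw [map_mul, h4, h3]
  abel

lemma toEnd_zpow_of_sigma {σ : MulAut A} (hσ : σ ∈ sigmaGroup r) (m : ℤ) (x : Additive A) :
    toEnd A (σ ^ m) x = x + m • (toEnd A σ - 1) x := by
  have hstep : ∀ n : ℤ, ∀ x, toEnd A (σ ^ (n + 1)) x = toEnd A (σ ^ n) x + (toEnd A σ - 1) x := by
    intro n x
    rw [zpow_add_one, toEnd_mul_of_sigma (zpow_mem hσ n) hσ, ← add_assoc, add_sub_cancel]
    rfl
  induction m using Int.induction_on with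
  | zero => simp
  | succ n ih => rw [hstep, ih, add_smul, one_smul, add_assoc]
  | pred n ih =>
    have := hstep (-(n : ℤ) - 1) x
    rw [sub_add_cancel, ih] at this
    rw [sub_smul, one_smul, ← add_sub_assoc, this, add_sub_cancel_right]

lemma toEnd_pow_of_sigma {σ : MulAut A} (hσ : σ ∈ sigmaGroup r) (m : ℕ) :
    σ ^ m = 1 ↔ ∀ x, m • (toEnd A σ - 1) x = 0 := by
  have key : ∀ x, toEnd A (σ ^ m) x = x + m • (toEnd A σ - 1) x := fun x => by
    have := toEnd_zpow_of_sigma hσ m x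
    rwa [zpow_natCast, natCast_zsmul] at this
  constructor
  · intro h x
    have := key x
    rw [h, map_one] at this
    exact left_eq_add.1 this
  · intro h
    apply toEnd_injective
    ext x
    rw [key, h, add_zero, map_one]
    rfl

lemma sigmaGroup_comm {σ τ : MulAut A} (hσ : σ ∈ sigmaGroup r) (hτ : τ ∈ sigmaGroup r) :
    σ * τ = τ * σ := by
  apply toEnd_injective
  rw [toEnd_mul_of_sigma hσ hτ, toEnd_mul_of_sigma hτ hσ, add_comm (toEnd A σ - 1)]

lemma sigmaGroup_apply (h : IsDivisiblePart hM T r) {σ : MulAut A} (hσ : σ ∈ sigmaGroup r)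
    (x : Additive A) : r ((toEnd A σ - 1) x) = (toEnd A σ - 1) x ∧
      PiTorsion T ((toEnd A σ - 1) x) := by
  have h1 : r ((toEnd A σ - 1) x) = (toEnd A σ - 1) x :=
    DFunLike.congr_fun (mem_sigmaGroup_iff.1 hσ).2.2 x
  exact ⟨h1, h1 ▸ h.piTorsion _⟩

lemma isAbelianPiPrimeGroup_sigmaGroup (h : IsDivisiblePart hM T r) {π : Set ℕ}
    (hπ : ∀ p ∈ π, p.Prime ∧ p ∉ T) : IsAbelianPiPrimeGroup π (sigmaGroup r) := by
  refine ⟨fun σ hσ τ hτ => sigmaGroup_comm hσ hτ, fun σ hσ => ?_⟩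
  obtain ⟨n, hn, hnf⟩ := (mem_sigmaGroup_iff.1 hσ).1.exists_nsmul
  have hfin : IsOfFinOrder σ :=
    isOfFinOrder_iff_pow_eq_one.2 ⟨n, Nat.pos_of_ne_zero hn, (toEnd_pow_of_sigma hσ n).2 hnf⟩
  refine ⟨hfin, fun p hp hd => ?_⟩
  obtain ⟨hpp, hpT⟩ := hπ p hp
  obtain ⟨m, hm⟩ := hd
  have hpos := hfin.orderOf_pos
  have hm0 : 0 < m := by
    rw [hm] at hpos
    exact Nat.pos_of_mul_pos_left hpos
  have hσm : σ ^ m = 1 := by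
    rw [toEnd_pow_of_sigma hσ]
    intro x
    have h1 : PiTorsion T (m • (toEnd A σ - 1) x) :=
      (piSubgroup _ T).nsmul_mem (sigmaGroup_apply h hσ x).2 m
    have h2 : PiTorsion {p} (m • (toEnd A σ - 1) x) := by
      refine (piTorsion_singleton hpp).2 ⟨1, ?_⟩
      rw [pow_one, natCast_zsmul, smul_smul, ← hm]
      exact (toEnd_pow_of_sigma hσ _).1 (pow_orderOf_eq_one σ) x
    exact ((h1.inter h2).mono (ρ := ∅) (by rintro q ⟨hq, rfl⟩; exact hpT hq)).eq_zero
  have := Nat.le_of_dvd hm0 (orderOf_dvd_of_pow_eq_one hσm)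
  rw [hm] at this
  have := Nat.le_mul_of_pos_left m hpp.pos
  have h2 := hpp.two_le
  nlinarith

/-- For `p`-elements, `σ - 1` factors through the bounded part at `p`, of exponent `p ^ e`; for `p ∉
T` it is zero. -/
lemma hasBoundedPrimaryComponents_sigmaGroup (h : IsDivisiblePart hM T r) :
    HasBoundedPrimaryComponents (sigmaGroup r) := by
  intro p hp
  have key : ∀ σ ∈ sigmaGroup r, (∃ k : ℕ, σ ^ p ^ k = 1) →
      ∀ x, PiTorsion {p} ((toEnd A σ - 1) x) := by
    rintro σ hσ ⟨k, hk⟩ x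
    refine (piTorsion_singleton hp).2 ⟨k, ?_⟩
    rw [← Nat.cast_pow, natCast_zsmul]
    exact (toEnd_pow_of_sigma hσ _).1 hk x
  by_cases hpT : p ∈ T
  · obtain ⟨e, he⟩ := h.bounded p hpT
    refine ⟨e, fun σ hσ hk => (toEnd_pow_of_sigma hσ _).2 fun x => ?_⟩
    have h1 : (toEnd A σ - 1) (piProj hM {p} x) = (toEnd A σ - 1) x := by
      have := DFunLike.congr_fun (piProj_comm hM {p} (toEnd A σ - 1)).eq x
      change piProj hM {p} ((toEnd A σ - 1) x) = (toEnd A σ - 1) (piProj hM {p} x) at this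
      rw [← this, piProj_of_piTorsion hM (key σ hσ hk x)]
    have h2 : (toEnd A σ - 1) (r (piProj hM {p} x)) = 0 :=
      DFunLike.congr_fun (mem_sigmaGroup_iff.1 hσ).2.1 _
    have h3 := he _ (piTorsion_piProj hM {p} x)
    rw [← natCast_zsmul, Nat.cast_pow, ← h1,
      ← sub_zero ((toEnd A σ - 1) (piProj hM {p} x)), ← h2, ← map_sub, ← map_zsmul, h3, map_zero]
    exact h2.symm
  · refine ⟨0, fun σ hσ hk => (toEnd_pow_of_sigma hσ _).2 fun x => ?_⟩
    rw [((key σ hσ hk x).inter (sigmaGroup_apply h hσ x).2).mono (ρ := ∅)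
      (by rintro q ⟨rfl, hq⟩; exact hpT hq) |>.eq_zero, smul_zero]

/-- `f * g` is determined by the values of `f` on the finite image of `g`, and these lie in the
finite `n`-torsion of the divisible part. -/
lemma finite_mul_of_finiteRange (h : IsDivisiblePart hM T r) {g : AddMonoid.End (Additive A)}
    (hg : FiniteRange g) :
    {k : AddMonoid.End (Additive A) | ∃ f, r * f = f ∧ k = f * g}.Finite := by
  obtain ⟨n, hn, hng⟩ := hg.exists_nsmul
  have hfin : Finite (Set.range g) := hg.to_subtype
  let Φ : AddMonoid.End (Additive A) → (Set.range g → Additive A) := fun k y => k y.2.choose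
  refine Set.Finite.of_finite_image (f := Φ) ?_ ?_
  · refine (Set.Finite.pi' fun _ : Set.range g => h.finite n hn).subset ?_
    rintro _ ⟨_, ⟨f, hf, rfl⟩, rfl⟩ y
    refine ⟨DFunLike.congr_fun hf _, ?_⟩
    change n • f (g y.2.choose) = 0
    rw [← map_nsmul, hng, map_zero]
  · rintro _ ⟨f, hf, rfl⟩ _ ⟨f', hf', rfl⟩ heq
    ext x
    have hx := congrFun heq ⟨g x, x, rfl⟩
    have hc := (⟨x, rfl⟩ : g x ∈ Set.range g).choose_spec
    change f (g _) = f' (g _) at hx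
    rw [hc] at hx
    exact hx

/-- The image of `f` has bounded exponent, so the projections to its primary components are
multiplications by integers; being central, they pass through `f`. -/
lemma exists_mul_delta_eq (h : IsDivisiblePart hM T r) {δ : MulAut A} (hδ : δ ∈ delta h) :
    ∀ f : AddMonoid.End (Additive A), FiniteRange f → f * r = 0 →
      ∃ m : ℤ, ∀ x, f (toEnd A δ x) = m • f x := by
  refine Subgroup.iSup_induction (fun p : T => deltaComponent h p)
    (C := fun δ => ∀ f : AddMonoid.End (Additive A), FiniteRange f → f * r = 0 →
      ∃ m : ℤ, ∀ x, f (toEnd A δ x) = m • f x) hδ ?_ ?_ ?_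
  · intro p δ hδ
    obtain ⟨⟨k, hk⟩, -⟩ := hδ
    intro f hf hfr
    obtain ⟨n, hn, hnf⟩ := hf.exists_nsmul
    obtain ⟨c, hc⟩ := exists_piProj_eq_smul hM {(p : ℕ)} hn
    refine ⟨1 + k * c, fun x => ?_⟩
    have h1 : f (piProj hM {(p : ℕ)} x) = c • f x := by
      rw [← hc _ (hnf x)]
      exact (DFunLike.congr_fun (piProj_comm hM {(p : ℕ)} f).eq x).symm
    have h2 : f (r (piProj hM {(p : ℕ)} x)) = 0 := DFunLike.congr_fun hfr _
    rw [hk]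
    change f (x + k • (piProj hM {(p : ℕ)} x - r (piProj hM {(p : ℕ)} x))) = _
    rw [map_add, map_zsmul, map_sub, h1, h2, sub_zero, add_smul, one_smul, mul_smul]
  · exact fun f _ _ => ⟨1, fun x => by simp⟩
  · intro δ δ' h1 h2 f hf hfr
    obtain ⟨m, hm⟩ := h1 f hf hfr
    obtain ⟨m', hm'⟩ := h2 f hf hfr
    refine ⟨m * m', fun x => ?_⟩
    rw [map_mul]
    change f (toEnd A δ (toEnd A δ' x)) = _
    rw [hm, hm', mul_smul]

lemma toEnd_conj (h : IsDivisiblePart hM T r) {ψ σ : MulAut A} (hψ : ψ ∈ psiGroup h)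
    (hσ : σ ∈ sigmaGroup r) :
    toEnd A (ψ * σ * ψ⁻¹) = 1 + (toEnd A σ - 1) * toEnd A ψ⁻¹ := by
  have h1 : toEnd A ψ * (toEnd A σ - 1) = toEnd A σ - 1 := by
    rw [← (mem_sigmaGroup_iff.1 hσ).2.2, ← mul_assoc,
      mem_fixLeft.1 (sup_le_fixLeft h (mem_psiGroup.1 hψ).1.1)]
  have h2 : toEnd A (ψ * σ * ψ⁻¹) =
      toEnd A ψ * toEnd A ψ⁻¹ + toEnd A ψ * (toEnd A σ - 1) * toEnd A ψ⁻¹ := by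
    rw [map_mul, map_mul, mul_sub, sub_mul, mul_one]
    abel
  rw [h2, h1, toEnd_mul_inv]

lemma conjAction_apply_coe {G : Type*} [Group G] (N K : Subgroup G)
    (h : K ≤ Subgroup.normalizer (N : Set G)) (k : K) (n : N) :
    ((conjAction N K h k n : N) : G) = k * n * (k : G)⁻¹ := rfl

/-- With `ψ⁻¹ = φ δ` and `f = σ - 1`, one has `f φ δ = f (φ - 1) δ + m f`. The second term
corresponds to `σ ^ m`, and the first ranges over a finite set independent of `H`. -/
lemma isInertial_conjAction (h : IsDivisiblePart hM T r)
    (hn : psiGroup h ≤ Subgroup.normalizer (sigmaGroup r : Set (MulAut A))) (ψ : psiGroup h) :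
    IsInertial (conjAction (sigmaGroup r) (psiGroup h) hn ψ) := by
  have hcomm : ∀ x y : sigmaGroup r, x * y = y * x := fun x y =>
    Subtype.ext (sigmaGroup_comm x.2 y.2)
  refine inertial_of_finite hcomm fun H => ?_
  obtain ⟨φ, hφ, δ, hδ, hψ⟩ : ∃ φ ∈ FAut A, ∃ δ ∈ delta h, φ * δ = (ψ : MulAut A)⁻¹ := by
    have := inv_mem (mem_psiGroup.1 ψ.2).1.1
    rw [← SetLike.mem_coe, Subgroup.normal_mul] at this
    exact Set.mem_mul.1 this
  let Q := {k : AddMonoid.End (Additive A) | ∃ f, r * f = f ∧ k = f * (toEnd A φ - 1)}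
  have hQ : Q.Finite := finite_mul_of_finiteRange h (isFinitary_iff.1 hφ)
  refine ⟨(fun s : sigmaGroup r => toEnd A s) ⁻¹' ((fun k => 1 + k * toEnd A δ) '' Q),
    (hQ.image _).preimage (toEnd_injective.comp Subtype.val_injective).injOn, fun σ hσ => ?_⟩
  have hσS := mem_sigmaGroup_iff.1 σ.2
  obtain ⟨m, hm⟩ := exists_mul_delta_eq h hδ (toEnd A σ - 1) hσS.1 hσS.2.1
  refine ⟨conjAction (sigmaGroup r) (psiGroup h) hn ψ σ * σ ^ (-m),
    ⟨(toEnd A σ - 1) * (toEnd A φ - 1), ⟨_, hσS.2.2, rfl⟩, ?_⟩, ?_⟩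
  · change _ = toEnd A (((conjAction (sigmaGroup r) (psiGroup h) hn ψ σ : sigmaGroup r) :
      MulAut A) * (σ : MulAut A) ^ (-m))
    rw [toEnd_mul_of_sigma (conjAction (sigmaGroup r) (psiGroup h) hn ψ σ).2
      (zpow_mem σ.2 (-m)), conjAction_apply_coe, toEnd_conj h ψ.2 σ.2, ← hψ, map_mul]
    ext x
    have h1 := toEnd_zpow_of_sigma σ.2 (-m) x
    set f := toEnd A (σ : MulAut A) - 1
    change x + f (toEnd A φ (toEnd A δ x) - toEnd A δ x) =
      x + ((x + f (toEnd A φ (toEnd A δ x)) - x) + (toEnd A ((σ : MulAut A) ^ (-m)) x - x))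
    rw [h1, map_sub, hm]
    module
  · rw [mul_inv_rev, hcomm _ (conjAction (sigmaGroup r) (psiGroup h) hn ψ σ)⁻¹, mul_assoc,
      hcomm (σ ^ (-m))⁻¹, inv_mul_cancel_left, ← zpow_neg, neg_neg]
    exact H.zpow_mem hσ m

/-- Since `p` divides the order of `z`, sending `z` to `d` is well defined on `⟨z⟩`, modelled by
`ZMod (addOrderOf z)`; injectivity of `D` extends it to `M`. -/
lemma exists_hom_apply_ne_zero {M : Type*} [AddCommGroup M] {D : AddSubgroup M}
    (hD : IsDivBy {0}ᶜ D) {p : ℕ} {d z : M} (hd : d ∈ D) (hd0 : d ≠ 0) (hpd : p • d = 0)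
    (hp : p ∣ addOrderOf z) : ∃ g : M →+ M, (∀ x, g x ∈ D) ∧ g z ≠ 0 := by
  have : DivisibleBy D ℤ := AddCommGroup.divisibleByIntOfSMulTopEqTop _ fun {n} hn => by
    rw [eq_top_iff]
    rintro ⟨d, hd⟩ -
    obtain ⟨x, hx, rfl⟩ := hD n hn d hd
    exact ⟨⟨x, hx⟩, trivial, rfl⟩
  let i : ZMod (addOrderOf z) →+ M := ZMod.lift _ ⟨zmultiplesHom M z, by simp⟩
  let j : ZMod (addOrderOf z) →+ D := ZMod.lift _ ⟨zmultiplesHom D ⟨d, hd⟩, by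
    obtain ⟨c, hc⟩ := hp
    rw [zmultiplesHom_apply, natCast_zsmul]
    refine Subtype.ext ?_
    change addOrderOf z • d = 0
    rw [hc, mul_comm, mul_smul, hpd, smul_zero]⟩
  have hi : Function.Injective i := by
    rw [ZMod.lift_injective]
    intro m hm
    rw [ZMod.intCast_zmod_eq_zero_iff_dvd]
    exact addOrderOf_dvd_iff_zsmul_eq_zero.2 hm
  obtain ⟨g, hg⟩ := (Module.Baer.of_divisible D).extension_property_addMonoidHom i hi j
  refine ⟨D.subtype.comp g, fun x => (g x).2, ?_⟩
  have h1 : i ((1 : ℤ) : ZMod _) = z := by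
    simp only [i]
    rw [ZMod.lift_coe]
    simp
  have h2 : g z = ⟨d, hd⟩ := by
    have := DFunLike.congr_fun hg ((1 : ℤ) : ZMod _)
    change g (i _) = j _ at this
    rw [h1] at this
    rw [this]
    simp only [j]
    rw [ZMod.lift_coe]
    simp
  change (g z : M) ≠ 0
  rw [h2]
  exact hd0

lemma exists_prime_piProj_ne_zero {y : Additive A} (hy : PiTorsion T y) (hy0 : y ≠ 0) :
    ∃ p ∈ T, p.Prime ∧ piProj hM {p} y ≠ 0 := by
  by_contra! hcon
  refine hy0 (PiTorsion.eq_zero ?_)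
  obtain ⟨n, hn, hnT, hny⟩ := hy
  refine ⟨addOrderOf y, ?_, fun p hp hd => ?_, addOrderOf_nsmul_eq_zero y⟩
  · rintro h0
    have := addOrderOf_dvd_of_nsmul_eq_zero hny
    rw [h0] at this
    exact hn (Nat.eq_zero_of_zero_dvd this)
  · have hpT := hnT p hp (hd.trans (addOrderOf_dvd_of_nsmul_eq_zero hny))
    have h0 := hcon p hpT hp
    have h1 := piTorsion_sub_piProj hM {p} y
    rw [h0, sub_zero] at h1
    obtain ⟨m, -, hmp, hmy⟩ := h1
    exact hmp p hp (hd.trans (addOrderOf_dvd_of_nsmul_eq_zero hmy)) rfl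

lemma conjAction_injective (h : IsDivisiblePart hM T r)
    (hn : psiGroup h ≤ Subgroup.normalizer (sigmaGroup r : Set (MulAut A))) :
    Function.Injective (conjAction (sigmaGroup r) (psiGroup h) hn) := by
  rw [injective_iff_map_eq_one]
  intro ψ hψ
  have hfix : ∀ σ ∈ sigmaGroup r, (toEnd A σ - 1) * toEnd A (ψ : MulAut A)⁻¹ = toEnd A σ - 1 := by
    intro σ hσ
    have h1 : ((conjAction (sigmaGroup r) (psiGroup h) hn ψ ⟨σ, hσ⟩ : sigmaGroup r) :
        MulAut A) = σ := by rw [hψ]; rfl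
    rw [conjAction_apply_coe] at h1
    have h2 := toEnd_conj h ψ.2 hσ
    rw [h1] at h2
    rw [eq_sub_iff_add_eq, add_comm, ← h2]
  obtain ⟨⟨-, hψr⟩, hψe⟩ := mem_psiGroup.1 (inv_mem ψ.2)
  have hψr' : ∀ x, r (toEnd A (ψ : MulAut A)⁻¹ x) = r x := fun x => DFunLike.congr_fun hψr x
  have hone : toEnd A (ψ : MulAut A)⁻¹ = 1 := by
    ext x
    -- A displacement `y` is a `T`-element with `r y = 0`. Some primary component of it is nonzero,
    -- and a homomorphism into the divisible part detecting that component gives an element of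
    -- `sigmaGroup` not fixed by the conjugation.
    by_contra hne
    set y := toEnd A (ψ : MulAut A)⁻¹ x - x with hy
    have hy0 : y ≠ 0 := sub_ne_zero.2 hne
    have hry : r y = 0 := by rw [hy, map_sub, hψr', sub_self]
    have hyT : PiTorsion T y := by
      have h1 : toEnd A (ψ : MulAut A)⁻¹ (x - piProj hM T x) = x - piProj hM T x :=
        DFunLike.congr_fun hψe x
      have h2 : y = toEnd A (ψ : MulAut A)⁻¹ (piProj hM T x) - piProj hM T x := by
        rw [map_sub, sub_eq_sub_iff_add_eq_add] at h1
        rw [hy, sub_eq_sub_iff_add_eq_add, h1]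
        abel
      rw [h2]
      exact (piSubgroup _ T).sub_mem ((piTorsion_piProj hM T x).map _) (piTorsion_piProj hM T x)
    obtain ⟨p, hpT, hp, hz⟩ := exists_prime_piProj_ne_zero (hM := hM) hyT hy0
    have hzt := piTorsion_piProj hM {p} y
    obtain ⟨d, hrd, hd0, hpd⟩ := h.socle p hpT
    have hdiv : IsDivBy {0}ᶜ (AddMonoidHom.range (r : Additive A →+ Additive A)) := by
      rintro n hn _ ⟨x, rfl⟩
      obtain ⟨y, hy⟩ := h.div n hn x
      exact ⟨r y, ⟨y, rfl⟩, hy⟩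
    obtain ⟨g, hgD, hgz⟩ := exists_hom_apply_ne_zero hdiv (⟨d, hrd⟩ : d ∈ AddMonoidHom.range
      (r : Additive A →+ Additive A)) hd0 hpd (z := piProj hM {p} y) (by
        by_contra hnd
        obtain ⟨n, hn, hnp, hnz⟩ := hzt
        refine hz (PiTorsion.eq_zero ⟨addOrderOf (piProj hM {p} y), ?_, fun q hq hd => ?_,
          addOrderOf_nsmul_eq_zero _⟩)
        · intro h0
          rw [h0] at hnd
          exact hnd (dvd_zero p)
        · obtain rfl := hnp q hq (hd.trans (addOrderOf_dvd_of_nsmul_eq_zero hnz))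
          exact hnd hd)
    obtain ⟨e, he⟩ := exists_pow_smul_boundedProj h hpT
    let f : AddMonoid.End (Additive A) := (show AddMonoid.End (Additive A) from g) *
      boundedProj hM r p
    have hfapp : ∀ x, f x = g (boundedProj hM r p x) := fun _ => rfl
    have hrf : r * f = f := by
      ext x
      obtain ⟨w, hw⟩ := hgD (boundedProj hM r p x)
      change r (g (boundedProj hM r p x)) = g (boundedProj hM r p x)
      rw [← hw]
      exact h.idem w
    have hfr : f * r = 0 := by
      change (show AddMonoid.End (Additive A) from g) * boundedProj hM r p * r = 0
      rw [mul_assoc, boundedProj_mul h, mul_zero]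
    have hff : f * f = 0 := by
      rw [← hrf, ← mul_assoc, hrf, hfr, zero_mul]
    have hfin : FiniteRange f := by
      refine (h.finite (p ^ e) (pow_ne_zero _ hp.ne_zero)).subset ?_
      rintro _ ⟨x, rfl⟩
      refine ⟨DFunLike.congr_fun hrf x, ?_⟩
      rw [hfapp, ← map_nsmul, ← natCast_zsmul, Nat.cast_pow, he, map_zero]
    obtain ⟨σ, hσ, -⟩ := exists_mulAut (A := A) (u := 1 + f) (v := 1 - f)
      (by simp only [add_mul, mul_sub, one_mul, mul_one, hff]; abel)
      (by simp only [sub_mul, mul_add, one_mul, mul_one, hff]; abel)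
    have hσS : σ ∈ sigmaGroup r := by
      rw [mem_sigmaGroup_iff, hσ, add_sub_cancel_left]
      exact ⟨hfin, hfr, hrf⟩
    have h1 := DFunLike.congr_fun (hfix σ hσS) x
    rw [hσ, add_sub_cancel_left] at h1
    change f (toEnd A (ψ : MulAut A)⁻¹ x) = f x at h1
    rw [← sub_eq_zero, ← map_sub, ← hy, hfapp, boundedProj_apply] at h1
    have h2 : r (piProj hM {p} y) = 0 := by
      have := DFunLike.congr_fun (piProj_comm hM {p} r).eq y
      change piProj hM {p} (r y) = r (piProj hM {p} y) at this
      rw [← this, hry, map_zero]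
    rw [h2, sub_zero] at h1
    exact hgz h1
  have : (ψ : MulAut A)⁻¹ = 1 := toEnd_injective (by rw [hone, map_one])
  exact Subtype.ext (inv_eq_one.1 this)

end Action

/-! ### The main theorem. -/

theorem theoremA {A : Type*} [CommGroup A] (hA : IsMulTorsion A) :
    ∃ Δ : Subgroup (MulAut A), Δ ≤ IAut A ∧
      IsDirectProductOfFiniteAbelian Δ ∧
      (IAut A : Set (MulAut A)) =
        (PAut A : Set (MulAut A)) * (FAut A : Set (MulAut A)) * (Δ : Set (MulAut A)) ∧
      (IsReducedGroup A → Δ = ⊥) ∧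
      ∃ π : Set ℕ, (∀ p ∈ π, p.Prime) ∧
        ∃ S Ψ : Subgroup (MulAut A), S ≤ IAut A ∧ Ψ ≤ IAut A ∧
          IsAbelianPiPrimeGroup π S ∧
          HasBoundedPrimaryComponents S ∧
          IsInternalDirect ((FAut A : Set (MulAut A)) * (Δ : Set (MulAut A)))
            (FAutPi A π) (S ⊔ Ψ) ∧
          IsInternalSemidirect ((S ⊔ Ψ : Subgroup (MulAut A)) : Set (MulAut A)) S Ψ ∧
          ∃ h : Ψ ≤ Subgroup.normalizer (S : Set (MulAut A)),
            (∀ ψ : Ψ, IsInertial (conjAction S Ψ h ψ)) ∧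
            Function.Injective (conjAction S Ψ h) := by
  have hM : ∀ x : Additive A, ∃ n : ℕ, n ≠ 0 ∧ n • x = 0 := fun x => by
    obtain ⟨n, hn, hx⟩ := isOfFinOrder_iff_pow_eq_one.1 (hA x.toMul)
    exact ⟨n, hn.ne', hx⟩
  obtain ⟨T, r, h⟩ := exists_isDivisiblePart hM
  have hle : FAut A ⊔ delta h ≤ IAut A := sup_le FAut_le_IAut (delta_le_IAut h)
  refine ⟨delta h, delta_le_IAut h, delta_isDirectProduct h, coe_IAut_eq h, fun hred => ?_,
    {p | p.Prime ∧ p ∉ T}, fun p hp => hp.1, sigmaGroup r, psiGroup h,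
    fun σ hσ => FAut_le_IAut hσ.1.1, fun ψ hψ => hle hψ.1.1,
    isAbelianPiPrimeGroup_sigmaGroup h fun p hp => hp,
    hasBoundedPrimaryComponents_sigmaGroup h,
    isInternalDirect h _ fun p hp => ⟨fun h => h.2, fun h => ⟨hp, h⟩⟩,
    ⟨Subgroup.coe_mul_of_right_le_normalizer_left _ _ (psiGroup_le_normalizer h),
      disjoint_sigmaGroup_psiGroup h, psiGroup_le_normalizer h⟩,
    psiGroup_le_normalizer h, isInertial_conjAction h _, conjAction_injective h _⟩
  have hT : T = ∅ := h.eq_empty fun D hD => by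
    have h1 := hred D.toSubgroup' fun n hn d hd => by
      obtain ⟨x, hx, hxd⟩ := hD n (show (n : ℤ) ≠ 0 by exact_mod_cast hn) d hd
      refine ⟨x, hx, ?_⟩
      change (n : ℤ) • (Additive.ofMul x : Additive A) = Additive.ofMul d at hxd
      rw [natCast_zsmul] at hxd
      exact hxd
    exact AddSubgroup.toSubgroup'.injective (h1.trans (map_bot AddSubgroup.toSubgroup').symm)
  subst hT
  rw [delta, iSup_of_empty]
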